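/- Let $N\ge 2$ and $0<\rho_*\le\rho^*$. There are constants $C,c>0$, depending only on $N,\rho_*,\rho^*$, with the following property. Let $T>0$ and let $(\rho^1,u^1,\nabla\Pi^1)$ and $(\rho^2,u^2,\nabla\Pi^2)$ be two solutions on $[0,T]\times\mathbb{R}^N$ of the density-dependent incompressible Euler system $$\partial_t\rho+u\cdot\nabla\rho=0,\qquad \rho\,(\partial_tu+u\cdot\nabla u)+\nabla\Pi=0,\qquad \operatorname{div}u=0,$$ such that $\rho_*\le\rho^1,\rho^2\le\rho^*$ almost everywhere. Here the first equation is understood in the sense of distributions as $\partial_t\rho+\operatorname{div}(\rho u)=0$; in the other two equations the derivatives are weak derivatives, $u,\partial_tu,\nabla u,\nabla\Pi$ are locally integrable functions on $(0,T)\times\mathbb{R}^N$, and the equations hold almost everywhere. Suppose that $\delta\rho:=\rho^1-\rho^2\in\mathcal C([0,T];L^2(\mathbb{R}^N))$, that $\delta u:=u^1-u^2\in\mathcal C^1([0,T];L^2(\mathbb{R}^N))$, and that $\nabla\rho^2,\nabla u^1,\nabla u^2,\nabla\Pi^2$ belong to $L^1([0,T];L^\infty(\mathbb{R}^N))$. Then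 for all $t\in[0,T]$ $$\|\delta\rho(t)\|_{L^2}+\|\delta u(t)\|_{L^2}\le C\,e^{c\,I(t)}\,\bigl(\|\delta\rho(0)\|_{L^2}+\|\delta u(0)\|_{L^2}\bigr),$$ where $$I(t):=\int_0^t\bigl(\|\nabla\rho^2\|_{L^\infty}+\|\nabla u^1\|_{L^\infty}+\|\nabla u^2\|_{L^\infty}+\|\nabla\Pi^2\|_{L^\infty}\bigr)\,d\tau.$$ In particular, if $\delta\rho(0)=0$ and $\delta u(0)=0$, then $\rho^1=\rho^2$, $u^1=u^2$ and $\nabla\Pi^1=\nabla\Pi^2$ almost everywhere on $[0,T]\times\mathbb{R}^N$. -/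

import Mathlib

open MeasureTheory Set
open scoped ContDiff

namespace InhomEuler

/-- The whole space `ℝᴺ` with its Euclidean norm. -/
abbrev Space (N : ℕ) : Type := EuclideanSpace ℝ (Fin N)

/-- The open space-time slab `(0,T) × ℝᴺ`. -/
def slab (N : ℕ) (T : ℝ) : Set (ℝ × Space N) := Ioo 0 T ×ˢ univ

/-- A time-dependent field is locally integrable, jointly in `(t,x)`, on `(0,T) × ℝᴺ`. -/
def LocInt {N : ℕ} {F : Type*} [NormedAddCommGroup F] (T : ℝ) (f : ℝ → Space N → F) : Prop :=
  LocallyIntegrableOn (Function.uncurry f) (slab N T) volume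

/-- Smooth test functions with compact support in `(0,T) × ℝᴺ`. -/
structure IsTestFunction {N : ℕ} (T : ℝ) (φ : ℝ × Space N → ℝ) : Prop where
  smooth : ContDiff ℝ ∞ φ
  compact : HasCompactSupport φ
  support : tsupport φ ⊆ slab N T

/-- `Df` is the weak (distributional) differential on `ℝᴺ` of the locally integrable function `f`:
`Df x v` is the derivative of `f` at `x` in the direction `v`. -/
structure HasWeakFDeriv {N : ℕ} {F : Type*} [NormedAddCommGroup F] [NormedSpace ℝ F]
    (f : Space N → F) (Df : Space N → Space N →L[ℝ] F) : Prop where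
  locInt : LocallyIntegrable f volume
  locInt_deriv : LocallyIntegrable Df volume
  integral_eq : ∀ φ : Space N → ℝ, ContDiff ℝ ∞ φ → HasCompactSupport φ → ∀ v : Space N,
    ∫ x, fderiv ℝ φ x v • f x = - ∫ x, φ x • Df x v

/-- The vector field `g` is the weak gradient of the scalar function `f`. -/
def HasWeakGradient {N : ℕ} (f : Space N → ℝ) (g : Space N → Space N) : Prop :=
  HasWeakFDeriv f (fun x => innerSL ℝ (g x))

/-- `ft` is the weak time derivative `∂ₜ f` on `(0,T) × ℝᴺ`. -/
structure HasWeakTimeDeriv {N : ℕ} (T : ℝ) (f ft : ℝ → Space N → Space N) : Prop where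
  locInt : LocInt T f
  locInt_deriv : LocInt T ft
  integral_eq : ∀ φ : ℝ × Space N → ℝ, IsTestFunction T φ →
    ∫ z, fderiv ℝ φ z (1, 0) • f z.1 z.2 = - ∫ z, φ z • ft z.1 z.2

/-- The trace of a matrix `A : ℝᴺ → ℝᴺ`; applied to the differential of `u` it is `div u`. -/
noncomputable def divOf {N : ℕ} (A : Space N →L[ℝ] Space N) : ℝ :=
  ∑ i : Fin N, A (EuclideanSpace.single i 1) i

/-- `(ρ, u, ∇Π)` is a solution on `[0,T] × ℝᴺ` of the density-dependent incompressible Euler system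
`∂ₜρ + u·∇ρ = 0`, `ρ (∂ₜu + u·∇u) + ∇Π = 0`, `div u = 0`.
Here `Du` is the spatial differential of `u` and `P = ∇Π`. As `div u = 0`, the transport equation is
read in the sense of distributions as `∂ₜρ + div (ρ u) = 0`; in the momentum equation all
derivatives are locally integrable functions, and the equation holds almost everywhere. -/
structure IsEulerSolution {N : ℕ} (T : ℝ) (ρ : ℝ → Space N → ℝ) (u : ℝ → Space N → Space N)
    (Du : ℝ → Space N → Space N →L[ℝ] Space N) (P : ℝ → Space N → Space N) : Prop where
  locInt_density : LocInt T ρ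
  locInt_velocity : LocInt T u
  locInt_flux : LocInt T (fun t x => ρ t x • u t x)
  locInt_gradVelocity : LocInt T Du
  locInt_gradPressure : LocInt T P
  weak_gradVelocity : ∀ᵐ t ∂(volume.restrict (Ioo 0 T)), HasWeakFDeriv (u t) (Du t)
  /-- `P t` is, at almost every time, the gradient of a scalar function (the pressure). -/
  gradPressure : ∀ᵐ t ∂(volume.restrict (Ioo 0 T)), ∃ p : Space N → ℝ, HasWeakGradient p (P t)
  transport : ∀ φ : ℝ × Space N → ℝ, IsTestFunction T φ →
    ∫ z, ρ z.1 z.2 * fderiv ℝ φ z (1, u z.1 z.2) = 0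
  momentum : ∃ ut : ℝ → Space N → Space N, HasWeakTimeDeriv T u ut ∧
    ∀ᵐ t ∂(volume.restrict (Ioo 0 T)), ∀ᵐ x,
      ρ t x • (ut t x + Du t x (u t x)) + P t x = 0
  incompressible : ∀ᵐ t ∂(volume.restrict (Ioo 0 T)), ∀ᵐ x, divOf (Du t x) = 0

/-- `f ∈ L¹([0,T]; L^∞(ℝᴺ))`. -/
structure MemL1Linfty {N : ℕ} {F : Type*} [NormedAddCommGroup F] (T : ℝ)
    (f : ℝ → Space N → F) : Prop where
  meas : AEStronglyMeasurable (Function.uncurry f) (volume.restrict (slab N T))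
  finite : ∫⁻ t in Ioo 0 T, eLpNorm (f t) ⊤ volume < ⊤

/-- `I(t) = ∫₀ᵗ (‖∇ρ²‖_{L^∞} + ‖∇u¹‖_{L^∞} + ‖∇u²‖_{L^∞} + ‖∇Π²‖_{L^∞}) dτ`
(`R` stands for `∇ρ²`, `Du₁`, `Du₂` for `∇u¹`, `∇u²`, and `P₂` for `∇Π²`). -/
noncomputable def lipschitzIntegral {N : ℕ} (R : ℝ → Space N → Space N)
    (Du₁ Du₂ : ℝ → Space N → Space N →L[ℝ] Space N) (P₂ : ℝ → Space N → Space N) (t : ℝ) : ℝ :=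
  (∫⁻ τ in Ioo 0 t, (eLpNorm (R τ) ⊤ volume + eLpNorm (Du₁ τ) ⊤ volume
    + eLpNorm (Du₂ τ) ⊤ volume + eLpNorm (P₂ τ) ⊤ volume)).toReal

end InhomEuler

open MeasureTheory Set
open scoped ContDiff


/-! The estimate is an energy estimate for the differences. Subtracting the equations gives `∂ₜδρ +
u¹·∇δρ = -δu·∇ρ²` and `ρ¹(∂ₜδu + u¹·∇δu) + ∇δΠ = (δρ/ρ²)∇Π² - ρ¹ δu·∇u²`. Only the four `L^∞` norms
in `I` occur as coefficients on the right. With `E = ‖δρ‖² + ∫ ρ¹|δu|²`, the transport by the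
divergence-free field `u¹` contributes nothing, `∇δΠ` is orthogonal to `δu`, and `|E'| ≤ C b E` with
`b` the integrand of `I`. As `ρ_* ≤ ρ¹ ≤ ρ^*`, the energy `E` is comparable to `‖δρ‖² + ‖δu‖²`, and
Grönwall's inequality concludes. Three points need work, because the velocities may grow linearly at
infinity and all equations hold only weakly.

Pressure. `∇δΠ` is not assumed square integrable. It has the form `q = ρ(F - U·∇W)` with `U = u¹`,
`W = δu`, and `U·∇W - W·∇U` is the divergence of an antisymmetric matrix field, hence orthogonal to
gradients. So `U·∇W` may be traded for `W·∇U`, which lies in `L²` although `U` is unbounded; this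
gives `memLp_pressure`. The qualitative input `∂ₜδu ∈ L²` comes from `δu ∈ C¹([0,T]; L²)` and does
not enter the final constants. Orthogonality of an `L²` gradient `q` and an `L²` divergence-free
field `W` (`integral_inner_gradient_eq_zero`) follows from a translation argument: `∫ q·W(· - v)`
does not depend on `v`, and it tends to `0` as `|v| → ∞`.

Energy identity. `hasWeakDeriv_energy` treats a density transported by `U` and an `L²` field `w`
with `∂ₜw + U·∇w = G`. One mollifies in space, cuts off, computes at fixed `x`, and passes to the
limit. The commutators of mollification and transport tend to `0` because `U` is Lipschitz and
divergence free (`tendsto_l2_commOp`). The theorem is used twice: with density `1` and `w = δρ`, and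
with density `ρ¹` and `w = δu`.

Time. The energy is known only at almost every time, so derivatives in time are meant in the sense
of absolutely continuous representatives (`HasWeakDeriv`); initial values are recovered from the
continuity of `‖δρ‖` and `‖δu‖` (`energy_inequality`, `gronwall_integral`). -/

namespace InhomEuler

open Filter Topology Metric
open scoped ENNReal NNReal

/-! ### Mollifiers and the ball kernels that dominate them -/

section Mollifiers

variable {N : ℕ} {F : Type*} [NormedAddCommGroup F] [NormedSpace ℝ F]

/-- The smooth bump from which the mollifiers are obtained by scaling. -/
noncomputable def baseBump (N : ℕ) : ContDiffBump (0 : Space N) :=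
  ⟨1 / 2, 1, by norm_num, by norm_num⟩

/-- A smooth probability density supported in the unit ball. -/
noncomputable def stdKernel (N : ℕ) : Space N → ℝ := (baseBump N).normed volume

/-- The rescaled mollifier `ε⁻ᴺ η(x/ε)`. -/
noncomputable def moll {N : ℕ} (ε : ℝ) (x : Space N) : ℝ := (ε⁻¹) ^ N * stdKernel N (ε⁻¹ • x)

/-- The kernel `ε⁻ᴺ 1_{|x| ≤ ε}`. -/
noncomputable def ballKer {N : ℕ} (ε : ℝ) (x : Space N) : ℝ :=
  (closedBall (0 : Space N) ε).indicator (fun _ => (ε⁻¹) ^ N) x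

/-- The convolution of a scalar kernel with a function. -/
noncomputable def kconv (κ : Space N → ℝ) (f : Space N → F) (x : Space N) : F :=
  ∫ y, κ (x - y) • f y

lemma stdKernel_contDiff : ContDiff ℝ ∞ (stdKernel N) := (baseBump N).contDiff_normed

lemma stdKernel_hasCompactSupport : HasCompactSupport (stdKernel N) :=
  (baseBump N).hasCompactSupport_normed

lemma stdKernel_eq_zero {x : Space N} (hx : 1 < ‖x‖) : stdKernel N x = 0 := by
  have h := (baseBump N).tsupport_normed_eq (μ := volume)
  refine image_eq_zero_of_notMem_tsupport (f := (baseBump N).normed volume) ?_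
  rw [h]
  simpa [baseBump] using hx

lemma fderiv_stdKernel_eq_zero {x : Space N} (hx : 1 < ‖x‖) : fderiv ℝ (stdKernel N) x = 0 := by
  have h := (baseBump N).tsupport_normed_eq (μ := volume)
  refine image_eq_zero_of_notMem_tsupport (f := fderiv ℝ (stdKernel N)) ?_
  refine fun h' => ?_
  have := tsupport_fderiv_subset ℝ h'
  unfold stdKernel at this
  rw [h] at this
  simp [baseBump] at this
  linarith

lemma moll_contDiff (ε : ℝ) : ContDiff ℝ ∞ (moll ε : Space N → ℝ) :=
  contDiff_const.mul (stdKernel_contDiff.comp (contDiff_const_smul _))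

lemma moll_nonneg {ε : ℝ} (hε : 0 < ε) (x : Space N) : 0 ≤ moll ε x :=
  mul_nonneg (by positivity) ((baseBump N).nonneg_normed _)

lemma moll_eq_zero {ε : ℝ} (hε : 0 < ε) {x : Space N} (hx : ε < ‖x‖) : moll ε x = 0 := by
  unfold moll
  rw [stdKernel_eq_zero, mul_zero]
  rw [norm_smul, norm_inv, Real.norm_of_nonneg hε.le]
  rw [← div_eq_inv_mul, one_lt_div hε]; exact hx

lemma moll_hasCompactSupport {ε : ℝ} (hε : 0 < ε) : HasCompactSupport (moll ε : Space N → ℝ) :=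
  HasCompactSupport.intro (isCompact_closedBall 0 ε) fun x hx => moll_eq_zero hε (by
    simpa using hx)

lemma integral_moll {ε : ℝ} (hε : 0 < ε) : ∫ x : Space N, moll ε x = 1 := by
  unfold moll
  rw [integral_const_mul, Measure.integral_comp_smul]
  have : ∫ x, stdKernel N x = 1 := (baseBump N).integral_normed
  rw [this]
  simp only [finrank_euclideanSpace, Fintype.card_fin, smul_eq_mul, mul_one]
  rw [abs_of_pos (by positivity)]
  field_simp

lemma fderiv_moll (ε : ℝ) (x : Space N) :
    fderiv ℝ (moll ε) x = ((ε⁻¹) ^ N * ε⁻¹) • fderiv ℝ (stdKernel N) (ε⁻¹ • x) := by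
  have h1 : DifferentiableAt ℝ (stdKernel N) (ε⁻¹ • x) :=
    (stdKernel_contDiff.differentiable (by simp)).differentiableAt
  have h2 := (h1.hasFDerivAt.comp x ((hasFDerivAt_id x).const_smul ε⁻¹)).const_mul ((ε⁻¹) ^ N)
  have h3 : HasFDerivAt (moll ε) _ x := h2
  rw [h3.fderiv]
  ext v
  simp [mul_assoc]

lemma ballKer_nonneg {ε : ℝ} (hε : 0 < ε) (x : Space N) : 0 ≤ ballKer ε x :=
  indicator_nonneg (fun _ _ => by positivity) _

lemma ballKer_of_le {ε : ℝ} {x : Space N} (hx : ‖x‖ ≤ ε) : ballKer ε x = (ε⁻¹) ^ N :=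
  indicator_of_mem (by simpa using hx) _

lemma ballKer_of_lt {ε : ℝ} {x : Space N} (hx : ε < ‖x‖) : ballKer ε x = 0 :=
  indicator_of_notMem (by simpa using hx) _

lemma measurable_ballKer (ε : ℝ) : Measurable (ballKer ε : Space N → ℝ) :=
  measurable_const.indicator measurableSet_closedBall

/-- Both the mollifier and the first moment of its gradient are controlled by the ball kernel. -/
lemma exists_moll_le (N : ℕ) : ∃ C : ℝ, 0 < C ∧ ∀ ε : ℝ, 0 < ε → ∀ x : Space N,
    moll ε x ≤ C * ballKer ε x ∧ ‖fderiv ℝ (moll ε) x‖ * ‖x‖ ≤ C * ballKer ε x := by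
  obtain ⟨C₁, h₁⟩ := stdKernel_hasCompactSupport.exists_bound_of_continuous
    (stdKernel_contDiff (N := N)).continuous
  obtain ⟨C₂, h₂⟩ := (stdKernel_hasCompactSupport.fderiv ℝ).exists_bound_of_continuous
    ((stdKernel_contDiff (N := N)).continuous_fderiv (by simp))
  refine ⟨max 1 (max C₁ C₂), by positivity, fun ε hε x => ?_⟩
  set C := max 1 (max C₁ C₂)
  rcases le_or_gt ‖x‖ ε with hx | hx
  · rw [ballKer_of_le hx]
    constructor
    · unfold moll
      rw [mul_comm]
      gcongr
      exact (le_abs_self _).trans ((h₁ _).trans ((le_max_left _ _).trans (le_max_right _ _)))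
    · rw [fderiv_moll, norm_smul, Real.norm_of_nonneg (by positivity)]
      have h3 : ‖fderiv ℝ (stdKernel N) (ε⁻¹ • x)‖ ≤ C :=
        (h₂ _).trans ((le_max_right _ _).trans (le_max_right _ _))
      -- The factor `ε⁻¹` produced by the differentiation is absorbed by `‖x‖ ≤ ε` on the support;
      -- this makes the commutator bounds uniform in `ε`.
      have h4 : ε⁻¹ * ‖x‖ ≤ 1 := by rw [← div_eq_inv_mul]; exact div_le_one_of_le₀ hx hε.le
      calc (ε⁻¹) ^ N * ε⁻¹ * ‖fderiv ℝ (stdKernel N) (ε⁻¹ • x)‖ * ‖x‖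
          = (ε⁻¹) ^ N * ‖fderiv ℝ (stdKernel N) (ε⁻¹ • x)‖ * (ε⁻¹ * ‖x‖) := by ring
        _ ≤ (ε⁻¹) ^ N * C * 1 := by gcongr
        _ = _ := by ring
  · rw [ballKer_of_lt hx, moll_eq_zero hε hx, fderiv_moll, fderiv_stdKernel_eq_zero]
    · simp
    · rw [norm_smul, norm_inv, Real.norm_of_nonneg hε.le]
      rw [← div_eq_inv_mul, one_lt_div hε]; exact hx

/-- The constant in the comparison of the mollifiers with the ball kernel. -/
noncomputable def mollC (N : ℕ) : ℝ := (exists_moll_le N).choose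

lemma mollC_pos (N : ℕ) : 0 < mollC N := (exists_moll_le N).choose_spec.1

lemma moll_le {ε : ℝ} (hε : 0 < ε) (x : Space N) : moll ε x ≤ mollC N * ballKer ε x :=
  ((exists_moll_le N).choose_spec.2 ε hε x).1

lemma fderiv_moll_le {ε : ℝ} (hε : 0 < ε) (x : Space N) :
    ‖fderiv ℝ (moll ε) x‖ * ‖x‖ ≤ mollC N * ballKer ε x :=
  ((exists_moll_le N).choose_spec.2 ε hε x).2

/-- A sequence of mollification scales tending to `0`. -/
noncomputable def epsSeq (n : ℕ) : ℝ := 1 / ((n : ℝ) + 1)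

lemma epsSeq_pos (n : ℕ) : 0 < epsSeq n := by unfold epsSeq; positivity

lemma epsSeq_le_one (n : ℕ) : epsSeq n ≤ 1 := by
  unfold epsSeq
  rw [div_le_one (by positivity)]
  have : (0 : ℝ) ≤ n := by positivity
  linarith

lemma tendsto_epsSeq : Tendsto epsSeq atTop (𝓝[>] 0) :=
  tendsto_nhdsWithin_iff.2 ⟨tendsto_one_div_add_atTop_nhds_zero_nat,
    Eventually.of_forall epsSeq_pos⟩

lemma ballKer_sub_eq (ε : ℝ) (x : Space N) :
    (fun y => ballKer ε (x - y)) = (closedBall x ε).indicator (fun _ => (ε⁻¹) ^ N) := by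
  ext y
  unfold ballKer
  by_cases h : y ∈ closedBall x ε
  · rw [indicator_of_mem h, indicator_of_mem]
    rw [mem_closedBall, dist_comm, dist_eq_norm] at h
    simpa using h
  · rw [indicator_of_notMem h, indicator_of_notMem]
    rw [mem_closedBall, dist_comm, dist_eq_norm] at h
    simpa using h

lemma integrable_ballKer_mul {f : Space N → ℝ} (hf : LocallyIntegrable f volume) (ε : ℝ)
    (x : Space N) : Integrable (fun y => ballKer ε (x - y) * f y) volume := by
  have h := (hf.integrableOn_isCompact (isCompact_closedBall x ε)).const_mul ((ε⁻¹) ^ N)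
  refine ((integrable_indicator_iff measurableSet_closedBall).2 h).congr (ae_of_all _ fun y => ?_)
  have := congrFun (ballKer_sub_eq ε x) y
  simp only [this]
  by_cases h : y ∈ closedBall x ε <;> simp [h]

/-- Almost every point is a Lebesgue point, in terms of the ball kernels. -/
lemma ae_tendsto_ballKer {f : Space N → F} (hf : LocallyIntegrable f volume) :
    ∀ᵐ x, Tendsto (fun n => ∫ y, ballKer (epsSeq n) (x - y) * ‖f y - f x‖) atTop (𝓝 0) := by
  filter_upwards [IsUnifLocDoublingMeasure.ae_tendsto_average_norm_sub volume hf 1] with x hx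
  have h1 := hx (fun _ : ℕ => x) epsSeq tendsto_epsSeq
    (Eventually.of_forall fun n => by simp [(epsSeq_pos n).le])
  -- The average divides by the volume of the ball of radius `ε`, the kernel only by `ε ^ N`; the
  -- two differ by the volume of the unit ball.
  have h2 := h1.const_mul (volume.real (closedBall (0 : Space N) 1))
  rw [mul_zero] at h2
  refine h2.congr fun n => ?_
  have hε := epsSeq_pos n
  set ε := epsSeq n
  have hv : volume.real (closedBall x ε) = ε ^ N * volume.real (closedBall (0 : Space N) 1) := by
    have := Measure.addHaar_real_closedBall' (volume : Measure (Space N)) x hε.le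
    simpa using this
  have hpos : 0 < volume.real (closedBall (0 : Space N) 1) :=
    ENNReal.toReal_pos (measure_closedBall_pos _ _ one_pos).ne' measure_closedBall_lt_top.ne
  rw [setAverage_eq, hv, smul_eq_mul]
  have : ∀ y, ballKer ε (x - y) * ‖f y - f x‖
      = (closedBall x ε).indicator (fun y => (ε⁻¹) ^ N * ‖f y - f x‖) y := fun y => by
    have := congrFun (ballKer_sub_eq ε x) y
    simp only [this]
    by_cases h : y ∈ closedBall x ε <;> simp [h]
  simp_rw [this]
  rw [integral_indicator measurableSet_closedBall, integral_const_mul, inv_pow]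
  field_simp

lemma integrable_kconv {κ : Space N → ℝ} (hκ : Continuous κ) (hc : HasCompactSupport κ)
    {f : Space N → F} (hf : LocallyIntegrable f volume) (x : Space N) :
    Integrable (fun y => κ (x - y) • f y) volume := by
  refine hf.integrable_smul_left_of_hasCompactSupport (g := fun y => κ (x - y))
    (hκ.comp (continuous_const.sub continuous_id)) ?_
  exact hc.comp_homeomorph (Homeomorph.subLeft x)

lemma kconv_eq_convolution (κ : Space N → ℝ) (f : Space N → F) :
    kconv κ f = convolution κ f (ContinuousLinearMap.lsmul ℝ ℝ) volume := by
  ext x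
  rw [convolution_lsmul_swap]; rfl

lemma integral_moll_sub {ε : ℝ} (hε : 0 < ε) (x : Space N) : ∫ y, moll ε (x - y) = 1 := by
  rw [integral_sub_left_eq_self (fun y => moll ε y) volume x, integral_moll hε]

lemma locallyIntegrable_norm_sub {f : Space N → F} (hf : LocallyIntegrable f volume) (a : F) :
    LocallyIntegrable (fun y => ‖f y - a‖) volume := fun x => by
  obtain ⟨s, hs, h⟩ := (hf.sub (locallyIntegrable_const a)) x
  exact ⟨s, hs, h.norm⟩

/-- As the mollifier has integral `1`, the constant `a` can be moved under the integral. With `a = f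
x` this gives convergence at Lebesgue points, with `a = 0` a plain bound. -/
lemma norm_kconv_moll_sub_le [CompleteSpace F] {ε : ℝ} (hε : 0 < ε) {f : Space N → F}
    (hf : LocallyIntegrable f volume) (x : Space N) (a : F) :
    ‖kconv (moll ε) f x - a‖ ≤ mollC N * ∫ y, ballKer ε (x - y) * ‖f y - a‖ := by
  have hi := integrable_kconv (moll_contDiff ε).continuous (moll_hasCompactSupport hε) hf x
  have hia := integrable_kconv (moll_contDiff ε).continuous (moll_hasCompactSupport hε)
    (locallyIntegrable_const (μ := (volume : Measure (Space N))) a) x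
  have h1 : kconv (moll ε) f x - a = ∫ y, moll ε (x - y) • (f y - a) := by
    simp_rw [smul_sub]
    rw [integral_sub hi hia, integral_smul_const, integral_moll_sub hε, one_smul]; rfl
  rw [h1, ← integral_const_mul]
  refine norm_integral_le_of_norm_le ?_ (ae_of_all _ fun y => ?_)
  · exact (integrable_ballKer_mul (locallyIntegrable_norm_sub hf a) ε x).const_mul _
  · rw [norm_smul, Real.norm_of_nonneg (moll_nonneg hε _), ← mul_assoc]
    gcongr
    exact moll_le hε _

lemma ae_tendsto_kconv_moll [CompleteSpace F] {f : Space N → F}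
    (hf : LocallyIntegrable f volume) :
    ∀ᵐ x, Tendsto (fun n => kconv (moll (epsSeq n)) f x) atTop (𝓝 (f x)) := by
  filter_upwards [ae_tendsto_ballKer hf] with x hx
  rw [tendsto_iff_norm_sub_tendsto_zero]
  refine squeeze_zero (fun _ => norm_nonneg _)
    (fun n => norm_kconv_moll_sub_le (epsSeq_pos n) hf x (f x)) ?_
  simpa using hx.const_mul (mollC N)

lemma kconv_congr {κ : Space N → ℝ} {f g : Space N → F} (h : f =ᵐ[volume] g) :
    kconv κ f = kconv κ g := by
  ext x
  exact integral_congr_ae (h.mono fun y hy => by simp only [hy])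

lemma norm_kconv_moll_le {ε M : ℝ} (hε : 0 < ε) {f : Space N → F}
    (hM : ∀ᵐ x, ‖f x‖ ≤ M) (x : Space N) : ‖kconv (moll ε) f x‖ ≤ M := by
  have h : ‖kconv (moll ε) f x‖ ≤ ∫ y, moll ε (x - y) * M := by
    refine norm_integral_le_of_norm_le ?_ (hM.mono fun y hy => ?_)
    · have := integrable_kconv (moll_contDiff ε).continuous (moll_hasCompactSupport hε)
        (locallyIntegrable_const (μ := (volume : Measure (Space N))) M) x
      simpa using this
    · rw [norm_smul, Real.norm_of_nonneg (moll_nonneg hε _)]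
      gcongr
      exact moll_nonneg hε _
  rwa [integral_mul_const, integral_moll_sub hε, one_mul] at h

lemma contDiff_kconv [CompleteSpace F] {κ : Space N → ℝ} (hκ : ContDiff ℝ ∞ κ)
    (hc : HasCompactSupport κ) {f : Space N → F} (hf : LocallyIntegrable f volume) :
    ContDiff ℝ ∞ (kconv κ f) := by
  rw [kconv_eq_convolution]
  exact hc.contDiff_convolution_left _ hκ hf

lemma fderiv_kconv [CompleteSpace F] {κ : Space N → ℝ} (hκ : ContDiff ℝ ∞ κ)
    (hc : HasCompactSupport κ) {f : Space N → F} (hf : LocallyIntegrable f volume)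
    (x v : Space N) :
    fderiv ℝ (kconv κ f) x v = ∫ y, fderiv ℝ κ (x - y) v • f y := by
  rw [kconv_eq_convolution, (hc.hasFDerivAt_convolution_left _
    (hκ.of_le (by exact_mod_cast le_top)) hf x).fderiv]
  rw [convolution_eq_swap, ContinuousLinearMap.integral_apply]
  · rfl
  · have := (hc.fderiv ℝ).convolutionExists_left
      ((ContinuousLinearMap.lsmul ℝ ℝ : ℝ →L[ℝ] F →L[ℝ] F).precompL (Space N))
      (hκ.continuous_fderiv (by simp)) hf x
    rw [ConvolutionExistsAt] at this
    have := this.comp_sub_left x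
    simpa using this

end Mollifiers

end InhomEuler


namespace InhomEuler

open Filter Topology Metric
open scoped ENNReal NNReal

/-! ### Real-valued `L²` norms -/

section SquareIntegrable

variable {N : ℕ} {F G : Type*} [NormedAddCommGroup F] [NormedAddCommGroup G]

/-- The `L²` norm as a real number. -/
noncomputable def l2 (f : Space N → F) : ℝ := (eLpNorm f 2 volume).toReal

lemma l2_nonneg (f : Space N → F) : 0 ≤ l2 f := ENNReal.toReal_nonneg

lemma l2_congr {f g : Space N → F} (h : f =ᵐ[volume] g) : l2 f = l2 g := by
  unfold l2; rw [eLpNorm_congr_ae h]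

lemma integrable_norm_sq {f : Space N → F} (hf : MemLp f 2 volume) :
    Integrable (fun x => ‖f x‖ ^ 2) volume := hf.integrable_norm_pow (by norm_num)

lemma l2_sq {f : Space N → F} (hf : MemLp f 2 volume) : l2 f ^ 2 = ∫ x, ‖f x‖ ^ 2 := by
  unfold l2
  rw [hf.eLpNorm_eq_integral_rpow_norm (by norm_num) (by norm_num)]
  have h0 : 0 ≤ ∫ x, ‖f x‖ ^ 2 := integral_nonneg fun x => by positivity
  simp only [ENNReal.toReal_ofNat, Real.rpow_two]
  rw [ENNReal.toReal_ofReal (by positivity), ← one_div, ← Real.sqrt_eq_rpow, Real.sq_sqrt h0]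

lemma integrable_norm_mul_norm {f : Space N → F} {g : Space N → G} (hf : MemLp f 2 volume)
    (hg : MemLp g 2 volume) : Integrable (fun x => ‖f x‖ * ‖g x‖) volume :=
  hf.norm.integrable_mul hg.norm

lemma integral_norm_mul_norm_le {f : Space N → F} {g : Space N → G} (hf : MemLp f 2 volume)
    (hg : MemLp g 2 volume) : ∫ x, ‖f x‖ * ‖g x‖ ≤ l2 f * l2 g := by
  have h := integral_mul_norm_le_Lp_mul_Lq (μ := (volume : Measure (Space N)))
    (f := fun x => ‖f x‖) (g := fun x => ‖g x‖) Real.HolderConjugate.two_two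
    (by simpa using hf.norm) (by simpa using hg.norm)
  simp only [norm_norm, Real.rpow_two] at h
  rwa [← l2_sq hf, ← l2_sq hg, ← Real.sqrt_eq_rpow, ← Real.sqrt_eq_rpow,
    Real.sqrt_sq (l2_nonneg f), Real.sqrt_sq (l2_nonneg g)] at h

lemma memLp_two_of_le_mul {f : Space N → F} {g : Space N → G} {c : ℝ} (hf : MemLp f 2 volume)
    (hg : AEStronglyMeasurable g volume) (h : ∀ᵐ x, ‖g x‖ ≤ c * ‖f x‖) : MemLp g 2 volume :=
  MemLp.of_le_mul hf hg h

lemma l2_le_mul {f : Space N → F} {g : Space N → G} {c : ℝ} (hc : 0 ≤ c) (hf : MemLp f 2 volume)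
    (h : ∀ᵐ x, ‖g x‖ ≤ c * ‖f x‖) : l2 g ≤ c * l2 f := by
  have h1 := eLpNorm_le_mul_eLpNorm_of_ae_le_mul h 2
  unfold l2
  have h2 := ENNReal.toReal_mono (ENNReal.mul_ne_top ENNReal.ofReal_ne_top hf.2.ne) h1
  rwa [ENNReal.toReal_mul, ENNReal.toReal_ofReal hc] at h2

lemma l2_add_le {f g : Space N → F} (hf : MemLp f 2 volume) (hg : MemLp g 2 volume) :
    l2 (fun x => f x + g x) ≤ l2 f + l2 g := by
  unfold l2
  rw [← ENNReal.toReal_add hf.2.ne hg.2.ne]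
  exact ENNReal.toReal_mono (ENNReal.add_ne_top.2 ⟨hf.2.ne, hg.2.ne⟩)
    (eLpNorm_add_le hf.1 hg.1 (by norm_num))

lemma l2_sub_le {f g : Space N → F} (hf : MemLp f 2 volume) (hg : MemLp g 2 volume) :
    l2 (fun x => f x - g x) ≤ l2 f + l2 g := by
  unfold l2
  rw [← ENNReal.toReal_add hf.2.ne hg.2.ne]
  exact ENNReal.toReal_mono (ENNReal.add_ne_top.2 ⟨hf.2.ne, hg.2.ne⟩)
    (eLpNorm_sub_le hf.1 hg.1 (by norm_num))

end SquareIntegrable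

/-! ### Young's inequality and convergence of mollifications in `L¹` -/

section ConvolutionInequalities

variable {N : ℕ} {F : Type*} [NormedAddCommGroup F]

/-- Young's inequality `L¹ * L² ⊆ L²`: writing `k = k^(1/2) k^(1/2)`, Cauchy–Schwarz bounds the
square of the convolution by `‖k‖₁` times the convolution of `k` with `f ^ 2`, and Tonelli finishes.
-/
lemma lintegral_conv_sq_le {k f : Space N → ℝ≥0∞} (hk : Measurable k)
    (hf : AEMeasurable f volume) :
    ∫⁻ x, (∫⁻ y, k (x - y) * f y) ^ 2 ≤ (∫⁻ x, k x) ^ 2 * ∫⁻ x, f x ^ 2 := by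
  have hkx : ∀ x : Space N, Measurable fun y => k (x - y) := fun x =>
    hk.comp (measurable_const.sub measurable_id)
  have key : ∀ x : Space N, (∫⁻ y, k (x - y) * f y) ^ 2
      ≤ (∫⁻ y, k y) * ∫⁻ y, k (x - y) * f y ^ 2 := by
    intro x
    have h1 := ENNReal.lintegral_mul_le_Lp_mul_Lq (volume : Measure (Space N))
      Real.HolderConjugate.two_two (f := fun y => k (x - y) ^ (1 / 2 : ℝ))
      (g := fun y => k (x - y) ^ (1 / 2 : ℝ) * f y) ((hkx x).pow_const _).aemeasurable
      (((hkx x).pow_const _).aemeasurable.mul hf)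
    have h2 : ∀ a : ℝ≥0∞, a ^ (1 / 2 : ℝ) * a ^ (1 / 2 : ℝ) = a := fun a => by
      rw [← ENNReal.rpow_add_of_nonneg _ _ (by norm_num) (by norm_num)]; norm_num
    have h3 : ∀ a : ℝ≥0∞, (a ^ (1 / 2 : ℝ)) ^ 2 = a := fun a => by rw [sq, h2]
    simp only [Pi.mul_apply, ← mul_assoc, h2, ENNReal.rpow_two, mul_pow, h3] at h1
    calc (∫⁻ y, k (x - y) * f y) ^ 2
        ≤ ((∫⁻ y, k (x - y)) ^ (1 / 2 : ℝ) * (∫⁻ y, k (x - y) * f y ^ 2) ^ (1 / 2 : ℝ)) ^ 2 := by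
          gcongr
      _ = (∫⁻ y, k (x - y)) * ∫⁻ y, k (x - y) * f y ^ 2 := by rw [mul_pow, h3, h3]
      _ = _ := by rw [lintegral_sub_left_eq_self (fun y => k y) x]
  calc ∫⁻ x, (∫⁻ y, k (x - y) * f y) ^ 2
      ≤ ∫⁻ x, (∫⁻ y, k y) * ∫⁻ y, k (x - y) * f y ^ 2 := lintegral_mono key
    _ = (∫⁻ y, k y) * ∫⁻ x, ∫⁻ y, k (x - y) * f y ^ 2 := by
        refine lintegral_const_mul'' _ ?_
        refine AEMeasurable.lintegral_prod_right' (f := fun z : Space N × Space N =>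
          k (z.1 - z.2) * f z.2 ^ 2) ?_
        exact (hk.comp (measurable_fst.sub measurable_snd)).aemeasurable.mul
          ((hf.comp_snd).pow_const 2)
    _ = (∫⁻ y, k y) * ∫⁻ y, ∫⁻ x, k (x - y) * f y ^ 2 := by
        rw [lintegral_lintegral_swap]
        exact (hk.comp (measurable_fst.sub measurable_snd)).aemeasurable.mul
          ((hf.comp_snd).pow_const 2)
    _ = (∫⁻ y, k y) * ∫⁻ y, (∫⁻ x, k x) * f y ^ 2 := by
        congr 1
        refine lintegral_congr fun y => ?_
        have hky : Measurable fun x => k (x - y) := hk.comp (measurable_id.sub measurable_const)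
        rw [lintegral_mul_const _ hky, lintegral_sub_right_eq_self (fun y => k y) y]
    _ = _ := by
        rw [lintegral_const_mul'' _ (hf.pow_const 2), sq, mul_assoc]

/-- The mass is scale invariant, so every convolution bound through the ball kernel is uniform in
`ε`. -/
lemma lintegral_ballKer {ε : ℝ} (hε : 0 < ε) :
    ∫⁻ x : Space N, ENNReal.ofReal (ballKer ε x) = volume (closedBall (0 : Space N) 1) := by
  have : ∀ x : Space N, ENNReal.ofReal (ballKer ε x)
      = (closedBall (0 : Space N) ε).indicator (fun _ => ENNReal.ofReal ((ε⁻¹) ^ N)) x := by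
    intro x
    unfold ballKer
    by_cases h : x ∈ closedBall (0 : Space N) ε <;> simp [indicator, h]
  simp_rw [this]
  rw [lintegral_indicator measurableSet_closedBall, lintegral_const,
    Measure.restrict_apply_univ, Measure.addHaar_closedBall' _ _ hε.le]
  rw [finrank_euclideanSpace, Fintype.card_fin, ← mul_assoc, ← ENNReal.ofReal_mul (by positivity)]
  rw [← mul_pow, inv_mul_cancel₀ hε.ne', one_pow, ENNReal.ofReal_one, one_mul]

/-- The volume of the unit ball. -/
noncomputable def ballVol (N : ℕ) : ℝ := volume.real (closedBall (0 : Space N) 1)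

lemma ballVol_pos (N : ℕ) : 0 < ballVol N :=
  ENNReal.toReal_pos (measure_closedBall_pos _ _ one_pos).ne' measure_closedBall_lt_top.ne

lemma eLpNorm_two_eq (k : Space N → F) :
    eLpNorm k 2 volume = (∫⁻ x, ‖k x‖ₑ ^ 2) ^ (1 / 2 : ℝ) := by
  rw [eLpNorm_eq_lintegral_rpow_enorm_toReal (by norm_num) (by norm_num)]
  simp

/-- Young's inequality for the ball kernels. -/
lemma l2_le_of_le_ballKer {G : Type*} [NormedAddCommGroup G] {ε C : ℝ} (hε : 0 < ε) (hC : 0 ≤ C)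
    {f : Space N → F} {h : Space N → G} (hf : MemLp f 2 volume)
    (hh : AEStronglyMeasurable h volume)
    (hle : ∀ᵐ x, ‖h x‖ ≤ C * ∫ y, ballKer ε (x - y) * ‖f y‖) :
    MemLp h 2 volume ∧ l2 h ≤ C * ballVol N * l2 f := by
  have hk : Measurable fun x : Space N => ENNReal.ofReal (ballKer ε x) :=
    (measurable_ballKer ε).ennreal_ofReal
  have h1 : ∀ᵐ x, ‖h x‖ₑ ≤ ENNReal.ofReal C *
      ∫⁻ y, ENNReal.ofReal (ballKer ε (x - y)) * ‖f y‖ₑ := by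
    filter_upwards [hle] with x hx
    have h2 : ∀ y, ENNReal.ofReal (ballKer ε (x - y)) * ‖f y‖ₑ
        = ENNReal.ofReal (ballKer ε (x - y) * ‖f y‖) := fun y => by
      rw [ENNReal.ofReal_mul (ballKer_nonneg hε _), ofReal_norm]
    simp_rw [h2]
    have hfl : LocallyIntegrable f volume := hf.locallyIntegrable (by norm_num)
    have hfn : LocallyIntegrable (fun y => ‖f y‖) volume := fun x => by
      obtain ⟨s, hs, h⟩ := hfl x
      exact ⟨s, hs, h.norm⟩
    rw [← ofReal_integral_eq_lintegral_ofReal (integrable_ballKer_mul hfn ε x)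
      (ae_of_all _ fun y => mul_nonneg (ballKer_nonneg hε _) (norm_nonneg _)),
      ← ENNReal.ofReal_mul hC, ← ofReal_norm]
    exact ENNReal.ofReal_le_ofReal hx
  have h4 : eLpNorm h 2 volume ≤ ENNReal.ofReal (C * ballVol N) * eLpNorm f 2 volume := by
    have h5 : ∫⁻ x, ‖h x‖ₑ ^ 2 ≤ ENNReal.ofReal (C * ballVol N) ^ 2 * ∫⁻ x, ‖f x‖ₑ ^ 2 := by
      calc ∫⁻ x, ‖h x‖ₑ ^ 2 ≤ ∫⁻ x, (ENNReal.ofReal C *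
            ∫⁻ y, ENNReal.ofReal (ballKer ε (x - y)) * ‖f y‖ₑ) ^ 2 :=
            lintegral_mono_ae (h1.mono fun x hx => by gcongr)
        _ = ENNReal.ofReal C ^ 2 * ∫⁻ x,
            (∫⁻ y, ENNReal.ofReal (ballKer ε (x - y)) * ‖f y‖ₑ) ^ 2 := by
            simp_rw [mul_pow]
            rw [lintegral_const_mul' _ _ (by finiteness)]
        _ ≤ ENNReal.ofReal C ^ 2 * ((∫⁻ x : Space N, ENNReal.ofReal (ballKer ε x)) ^ 2 *
            ∫⁻ x, ‖f x‖ₑ ^ 2) := by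
            gcongr
            exact lintegral_conv_sq_le hk hf.1.enorm
        _ = _ := by
            rw [lintegral_ballKer hε, ENNReal.ofReal_mul hC, mul_pow, mul_assoc, ballVol,
              measureReal_def, ENNReal.ofReal_toReal measure_closedBall_lt_top.ne]
    rw [eLpNorm_two_eq, eLpNorm_two_eq]
    calc (∫⁻ x, ‖h x‖ₑ ^ 2) ^ (1 / 2 : ℝ)
        ≤ (ENNReal.ofReal (C * ballVol N) ^ 2 * ∫⁻ x, ‖f x‖ₑ ^ 2) ^ (1 / 2 : ℝ) := by gcongr
      _ = _ := by
          rw [ENNReal.mul_rpow_of_nonneg _ _ (by norm_num), ← ENNReal.rpow_two,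
            ← ENNReal.rpow_mul]
          norm_num
  have h6 : ENNReal.ofReal (C * ballVol N) * eLpNorm f 2 volume ≠ ⊤ :=
    ENNReal.mul_ne_top ENNReal.ofReal_ne_top hf.2.ne
  refine ⟨⟨hh, h4.trans_lt h6.lt_top⟩, ?_⟩
  have := ENNReal.toReal_mono h6 h4
  rwa [ENNReal.toReal_mul, ENNReal.toReal_ofReal
    (mul_nonneg hC (ballVol_pos N).le)] at this

variable [NormedSpace ℝ F] [CompleteSpace F]

lemma l2_kconv_le {ε : ℝ} (hε : 0 < ε) {f : Space N → F} (hf : MemLp f 2 volume) :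
    MemLp (kconv (moll ε) f) 2 volume ∧ l2 (kconv (moll ε) f) ≤ mollC N * ballVol N * l2 f := by
  have hfl := hf.locallyIntegrable (by norm_num)
  refine l2_le_of_le_ballKer hε (mollC_pos N).le hf
    (contDiff_kconv (moll_contDiff ε) (moll_hasCompactSupport hε)
      hfl).continuous.aestronglyMeasurable (ae_of_all _ fun x => ?_)
  simpa using norm_kconv_moll_sub_le hε hfl x 0

lemma lintegral_kconv_le {ε : ℝ} (hε : 0 < ε) {f : Space N → F} (hf : Integrable f volume) :
    ∫⁻ x, ‖kconv (moll ε) f x‖ₑ ≤ ∫⁻ x, ‖f x‖ₑ := by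
  have hk : Measurable fun x : Space N => ENNReal.ofReal (moll ε x) :=
    (moll_contDiff ε).continuous.measurable.ennreal_ofReal
  have hint : ∫⁻ x : Space N, ENNReal.ofReal (moll ε x) = 1 := by
    rw [← ofReal_integral_eq_lintegral_ofReal, integral_moll hε, ENNReal.ofReal_one]
    · exact (moll_contDiff ε).continuous.integrable_of_hasCompactSupport
        (moll_hasCompactSupport hε)
    · exact ae_of_all _ fun x => moll_nonneg hε x
  calc ∫⁻ x, ‖kconv (moll ε) f x‖ₑ
      ≤ ∫⁻ x, ∫⁻ y, ENNReal.ofReal (moll ε (x - y)) * ‖f y‖ₑ := by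
        refine lintegral_mono fun x => (enorm_integral_le_lintegral_enorm _).trans_eq ?_
        refine lintegral_congr fun y => ?_
        rw [enorm_smul, ← ofReal_norm, Real.norm_of_nonneg (moll_nonneg hε _)]
    _ = ∫⁻ y, ∫⁻ x, ENNReal.ofReal (moll ε (x - y)) * ‖f y‖ₑ := by
        rw [lintegral_lintegral_swap]
        exact (hk.comp (measurable_fst.sub measurable_snd)).aemeasurable.mul
          (hf.1.enorm.comp_snd)
    _ = ∫⁻ y, ‖f y‖ₑ := by
        refine lintegral_congr fun y => ?_
        have hky : Measurable fun x => ENNReal.ofReal (moll ε (x - y)) :=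
          hk.comp (measurable_id.sub measurable_const)
        rw [lintegral_mul_const _ hky,
          lintegral_sub_right_eq_self (fun y => ENNReal.ofReal (moll ε y)) y, hint, one_mul]

/-- Mollification converges in `L¹`. -/
lemma tendsto_lintegral_kconv_sub {f : Space N → F} (hf : Integrable f volume) :
    Tendsto (fun n => ∫⁻ x, ‖kconv (moll (epsSeq n)) f x - f x‖ₑ) atTop (𝓝 0) := by
  -- For continuous `k` with compact support, dominated convergence applies: scales are at most `1`,
  -- so all mollifications live in one ball of radius `R + 1`. The general case follows by density,
  -- as mollification is an `L¹` contraction.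
  have hcs : ∀ k : Space N → F, Continuous k → HasCompactSupport k →
      Tendsto (fun n => ∫⁻ x, ‖kconv (moll (epsSeq n)) k x - k x‖ₑ) atTop (𝓝 0) := by
    intro k hk hkc
    obtain ⟨M, hM⟩ := hkc.exists_bound_of_continuous hk
    have hM0 : 0 ≤ M := (norm_nonneg _).trans (hM 0)
    obtain ⟨R, hR⟩ := hkc.isCompact.isBounded.subset_closedBall (0 : Space N)
    have hkl : LocallyIntegrable k volume := hk.locallyIntegrable
    have hz : ∀ x, R < ‖x‖ → k x = 0 := fun x hx => image_eq_zero_of_notMem_tsupport fun h => by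
      have := hR h
      rw [mem_closedBall, dist_zero_right] at this
      linarith
    have hlim := tendsto_lintegral_of_dominated_convergence'
      (μ := (volume : Measure (Space N)))
      (F := fun n x => ‖kconv (moll (epsSeq n)) k x - k x‖ₑ) (f := fun _ => 0)
      ((closedBall (0 : Space N) (R + 1)).indicator fun _ => ENNReal.ofReal (M + M))
      (fun n => ((contDiff_kconv (moll_contDiff _) (moll_hasCompactSupport (epsSeq_pos n))
        hkl).continuous.sub hk).enorm.measurable.aemeasurable)
      (fun n => ae_of_all _ fun x => by
        simp only
        by_cases hx : x ∈ closedBall (0 : Space N) (R + 1)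
        · rw [indicator_of_mem hx, ← ofReal_norm]
          refine ENNReal.ofReal_le_ofReal ((norm_sub_le _ _).trans (add_le_add ?_ (hM x)))
          exact norm_kconv_moll_le (epsSeq_pos n) (ae_of_all _ hM) x
        · rw [indicator_of_notMem hx]
          rw [mem_closedBall, dist_zero_right, not_le] at hx
          have h1 : kconv (moll (epsSeq n)) k x = 0 := by
            refine integral_eq_zero_of_ae (ae_of_all _ fun y => ?_)
            simp only [Pi.zero_apply]
            by_cases hy : R < ‖y‖
            · simp [hz y hy]
            · rw [moll_eq_zero (epsSeq_pos n)]
              · simp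
              · have := norm_sub_norm_le x y
                have := epsSeq_le_one n
                linarith
          rw [h1, hz x (by linarith)]
          simp)
      (by
        rw [lintegral_indicator measurableSet_closedBall, lintegral_const,
          Measure.restrict_apply_univ]
        exact ENNReal.mul_ne_top ENNReal.ofReal_ne_top measure_closedBall_lt_top.ne)
      (by
        filter_upwards [ae_tendsto_kconv_moll hkl] with x hx
        have := (hx.sub_const (k x)).enorm
        simpa using this)
    simpa using hlim
  rw [ENNReal.tendsto_nhds_zero]
  intro δ hδ
  obtain ⟨k, hkc, hfk, hk, hki⟩ := hf.exists_hasCompactSupport_lintegral_sub_le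
    (ε := δ / 3) (by simpa using hδ.ne')
  filter_upwards [ENNReal.tendsto_nhds_zero.1 (hcs k hk hkc) (δ / 3)
    (ENNReal.div_pos hδ.ne' (by norm_num))] with n hn
  have hεn := epsSeq_pos n
  set J := kconv (F := F) (moll (N := N) (epsSeq n)) with hJ
  have hsub : ∀ x, J f x - f x = J (f - k) x + ((J k x - k x) - (f x - k x)) := by
    intro x
    have : J (f - k) x = J f x - J k x := by
      simp only [hJ, kconv, Pi.sub_apply, smul_sub]
      exact integral_sub
        (integrable_kconv (moll_contDiff _).continuous (moll_hasCompactSupport hεn)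
          hf.locallyIntegrable x)
        (integrable_kconv (moll_contDiff _).continuous (moll_hasCompactSupport hεn)
          hki.locallyIntegrable x)
    rw [this]; abel
  have hm : ∀ {g : Space N → F}, Integrable g volume → Measurable fun x => ‖J g x‖ₑ :=
    fun {g} hg => (contDiff_kconv (moll_contDiff _) (moll_hasCompactSupport hεn)
      hg.locallyIntegrable).continuous.enorm.measurable
  calc ∫⁻ x, ‖J f x - f x‖ₑ
      ≤ ∫⁻ x, (‖J (f - k) x‖ₑ + (‖J k x - k x‖ₑ + ‖f x - k x‖ₑ)) := by
        refine lintegral_mono fun x => ?_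
        rw [hsub x]
        refine (enorm_add_le _ _).trans ?_
        gcongr
        exact enorm_sub_le
    _ = (∫⁻ x, ‖J (f - k) x‖ₑ) + ((∫⁻ x, ‖J k x - k x‖ₑ) + ∫⁻ x, ‖f x - k x‖ₑ) := by
        rw [lintegral_add_left (hm (hf.sub hki)), lintegral_add_left]
        exact ((contDiff_kconv (moll_contDiff _) (moll_hasCompactSupport hεn)
          hki.locallyIntegrable).continuous.sub hk).enorm.measurable
    _ ≤ δ / 3 + (δ / 3 + δ / 3) := by
        gcongr
        exact (lintegral_kconv_le hεn (hf.sub hki)).trans hfk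
    _ = δ := by rw [← add_assoc]; exact ENNReal.add_thirds δ

/-- Mollification converges in `L¹_loc`. -/
lemma tendsto_integral_ball_kconv_sub {f : Space N → F} (hf : LocallyIntegrable f volume) (R : ℝ) :
    Tendsto (fun n => ∫ x in closedBall (0 : Space N) R, ‖kconv (moll (epsSeq n)) f x - f x‖)
      atTop (𝓝 0) := by
  -- On the ball of radius `R` the mollification sees only the values of `f` on the ball of radius
  -- `R + 1`, so `f` may be truncated to an integrable function.
  set g := (closedBall (0 : Space N) (R + 1)).indicator f
  have hg : Integrable g volume := (integrable_indicator_iff measurableSet_closedBall).2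
    (hf.integrableOn_isCompact (isCompact_closedBall 0 (R + 1)))
  have h1 := tendsto_lintegral_kconv_sub hg
  have h2 := (ENNReal.tendsto_toReal ENNReal.zero_ne_top).comp h1
  simp only [ENNReal.toReal_zero] at h2
  have hfin : ∀ᶠ n in atTop, ∫⁻ x, ‖kconv (moll (epsSeq n)) g x - g x‖ₑ < ⊤ :=
    (tendsto_order.1 h1).2 ⊤ ENNReal.zero_lt_top
  refine squeeze_zero' (Eventually.of_forall fun n => integral_nonneg fun x => norm_nonneg _) ?_ h2
  filter_upwards [hfin] with n hn
  have heq : ∀ x ∈ closedBall (0 : Space N) R,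
      kconv (moll (epsSeq n)) f x - f x = kconv (moll (epsSeq n)) g x - g x := by
    intro x hx
    rw [mem_closedBall, dist_zero_right] at hx
    have hx1 : x ∈ closedBall (0 : Space N) (R + 1) := by
      rw [mem_closedBall, dist_zero_right]; linarith
    congr 1
    · refine integral_congr_ae (ae_of_all _ fun y => ?_)
      by_cases hy : y ∈ closedBall (0 : Space N) (R + 1)
      · simp [g, indicator_of_mem hy]
      · rw [mem_closedBall, dist_zero_right, not_le] at hy
        simp only
        rw [moll_eq_zero (epsSeq_pos n), zero_smul, zero_smul]
        have := norm_sub_norm_le y x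
        rw [norm_sub_rev] at this
        have := epsSeq_le_one n
        linarith
    · simp [g, indicator_of_mem hx1]
  rw [setIntegral_congr_fun measurableSet_closedBall fun x hx => by rw [heq x hx]]
  have hmeas : AEStronglyMeasurable (fun x => kconv (moll (epsSeq n)) g x - g x) volume :=
    (contDiff_kconv (moll_contDiff _) (moll_hasCompactSupport (epsSeq_pos n))
      hg.locallyIntegrable).continuous.aestronglyMeasurable.sub hg.1
  have hint : Integrable (fun x => ‖kconv (moll (epsSeq n)) g x - g x‖) volume :=
    Integrable.norm ⟨hmeas, hn⟩
  refine (setIntegral_le_integral hint (ae_of_all _ fun x => norm_nonneg _)).trans_eq ?_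
  rw [integral_norm_eq_lintegral_enorm hmeas]
  rfl

end ConvolutionInequalities

end InhomEuler


namespace InhomEuler

open Filter Topology Metric
open scoped ENNReal NNReal

/-! ### Lipschitz functions and divergence-free Lipschitz fields -/

section Lipschitz

variable {N : ℕ}

/-- If one point lies in the ball of radius `R` containing the support, either the other lies in the
ball of radius `R + 1`, where compactness gives a constant, or the two are at distance at least `1`
and the sup bound `M` serves as constant. -/
lemma LocallyLipschitz.exists_lipschitzWith_of_hasCompactSupport {a : Space N → ℝ}
    (ha : LocallyLipschitz a) (hc : HasCompactSupport a) : ∃ K : ℝ≥0, LipschitzWith K a := by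
  obtain ⟨M, hM⟩ := hc.exists_bound_of_continuous ha.continuous
  have hM0 : 0 ≤ M := (norm_nonneg _).trans (hM 0)
  obtain ⟨R, hR⟩ := hc.isCompact.isBounded.subset_closedBall (0 : Space N)
  have hz : ∀ x, R < ‖x‖ → a x = 0 := fun x hx => image_eq_zero_of_notMem_tsupport fun h => by
    have := hR h
    rw [mem_closedBall, dist_zero_right] at this
    linarith
  obtain ⟨K, hK⟩ := (ha.locallyLipschitzOn (s := closedBall (0 : Space N) (R + 1))
    ).exists_lipschitzOnWith_of_compact (isCompact_closedBall 0 (R + 1))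
  have key : ∀ x y : Space N, ‖x‖ ≤ R → dist (a x) (a y) ≤ max (K : ℝ) M * dist x y := by
    intro x y hx
    by_cases hy : ‖y‖ ≤ R + 1
    · refine (hK.dist_le_mul x (by simp; linarith) y (by simpa using hy)).trans ?_
      gcongr
      exact le_max_left _ _
    · rw [not_le] at hy
      have h1 : 1 ≤ dist x y := by
        rw [dist_comm, dist_eq_norm]
        have := norm_sub_norm_le y x
        linarith
      rw [hz y (by linarith), dist_zero_right]
      calc ‖a x‖ ≤ M * 1 := by simpa using hM x
        _ ≤ max (K : ℝ) M * dist x y := by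
          gcongr
          exact le_max_right _ _
  refine ⟨(max (K : ℝ) M).toNNReal, LipschitzWith.of_dist_le_mul fun x y => ?_⟩
  rw [Real.coe_toNNReal _ (by positivity)]
  by_cases hx : ‖x‖ ≤ R
  · exact key x y hx
  · by_cases hy : ‖y‖ ≤ R
    · rw [dist_comm, dist_comm x y]; exact key y x hy
    · rw [hz x (not_le.1 hx), hz y (not_le.1 hy), dist_self]
      positivity

lemma LocallyLipschitz.mul_real {a b : Space N → ℝ} (ha : LocallyLipschitz a)
    (hb : LocallyLipschitz b) : LocallyLipschitz fun x => a x * b x :=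
  (ContDiff.locallyLipschitz (𝕂 := ℝ) (contDiff_mul (𝕜 := ℝ) (𝔸 := ℝ) (n := 1))).comp
    (ha.prodMk hb)

lemma locallyLipschitz_inner (E : Type*) [NormedAddCommGroup E] [InnerProductSpace ℝ E] :
    LocallyLipschitz fun p : E × E => inner ℝ p.1 p.2 := by
  have h : ContDiff ℝ 1 fun p : E × E => inner ℝ p.1 p.2 := contDiff_fst.inner ℝ contDiff_snd
  exact h.locallyLipschitz

lemma LocallyLipschitz.inner_real {α E : Type*} [PseudoEMetricSpace α] [NormedAddCommGroup E]
    [InnerProductSpace ℝ E] {a b : α → E} (ha : LocallyLipschitz a)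
    (hb : LocallyLipschitz b) : LocallyLipschitz fun x => inner ℝ (a x) (b x) :=
  (locallyLipschitz_inner E).comp (ha.prodMk hb)

lemma norm_fderiv_le_of_lip {F : Type*} [NormedAddCommGroup F] [NormedSpace ℝ F] {f : Space N → F}
    {K : ℝ≥0} (h : LipschitzWith K f) (x : Space N) : ‖fderiv ℝ f x‖ ≤ K :=
  norm_fderiv_le_of_lipschitz ℝ h

/-- A Lipschitz vector field with vanishing divergence. -/
structure LipDivFree (U : Space N → Space N) (K : ℝ≥0) : Prop where
  lip : LipschitzWith K U
  div : ∀ᵐ x, divOf (fderiv ℝ U x) = 0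

lemma LipDivFree.const (v : Space N) : LipDivFree (fun _ : Space N => v) 0 where
  lip := LipschitzWith.const v
  div := ae_of_all _ fun x => by simp [divOf]

lemma LipDivFree.continuous {U : Space N → Space N} {K : ℝ≥0} (hU : LipDivFree U K) :
    Continuous U := hU.lip.continuous

lemma sum_single_smul (v : Space N) : ∑ i, v i • EuclideanSpace.single i (1 : ℝ) = v := by
  have := (EuclideanSpace.basisFun (Fin N) ℝ).sum_repr v
  simpa using this

/-- A divergence-free Lipschitz field is orthogonal to gradients of compactly supported
Lipschitz functions. -/
lemma integral_fderiv_apply_eq_zero {a : Space N → ℝ} (ha : LocallyLipschitz a)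
    (hc : HasCompactSupport a) {U : Space N → Space N} {K : ℝ≥0} (hU : LipDivFree U K) :
    ∫ x, fderiv ℝ a x (U x) = 0 := by
  obtain ⟨C, hC⟩ := LocallyLipschitz.exists_lipschitzWith_of_hasCompactSupport ha hc
  have hUi : ∀ i, LipschitzWith K fun x => U x i := fun i => by
    refine LipschitzWith.of_dist_le_mul fun x y => ?_
    refine le_trans ?_ (hU.lip.dist_le_mul x y)
    rw [dist_eq_norm, dist_eq_norm]
    exact (EuclideanSpace.norm_eq (U x - U y)) ▸ PiLp.norm_apply_le (U x - U y) i
  -- Integration by parts, one coordinate at a time. Both factors are merely Lipschitz, so this is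
  -- the version for almost everywhere derivatives; only `a` needs compact support. Summing over
  -- `i`, the left sides add up to `∫ a div U = 0`.
  have h1 : ∀ i : Fin N, ∫ x, lineDeriv ℝ (fun x => U x i) x (EuclideanSpace.single i 1) * a x
      = ∫ x, lineDeriv ℝ a x (-EuclideanSpace.single i 1) * U x i := fun i =>
    LipschitzWith.integral_lineDeriv_mul_eq (hUi i) hC hc (EuclideanSpace.single i 1)
  have hdU : ∀ᵐ x, DifferentiableAt ℝ U x := hU.lip.ae_differentiableAt
  have hda : ∀ᵐ x, DifferentiableAt ℝ a x := hC.ae_differentiableAt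
  have hmeas : ∀ i, Measurable fun x => U x i := fun i => (hUi i).continuous.measurable
  have hint1 : ∀ i : Fin N, Integrable (fun x =>
      lineDeriv ℝ (fun x => U x i) x (EuclideanSpace.single i 1) * a x) volume := fun i => by
    have h := (ha.continuous.integrable_of_hasCompactSupport (μ := volume) hc).bdd_mul
      (f := fun x => lineDeriv ℝ (fun x => U x i) x (EuclideanSpace.single i 1)) (c := K * ‖(EuclideanSpace.single i (1 : ℝ) : Space N)‖)
      (measurable_lineDeriv (hUi i).continuous).aestronglyMeasurable
      (ae_of_all _ fun x => norm_lineDeriv_le_of_lipschitz ℝ (hUi i))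
    exact h
  have hsupp : ∀ i : Fin N, HasCompactSupport fun x =>
      lineDeriv ℝ a x (-EuclideanSpace.single i 1) := fun i => by
    refine HasCompactSupport.intro hc.isCompact fun x hx => ?_
    have : a =ᶠ[𝓝 x] fun _ => 0 := notMem_tsupport_iff_eventuallyEq.1 hx
    rw [Filter.EventuallyEq.lineDeriv_eq this]
    simp [lineDeriv]
  have hint2 : ∀ i : Fin N, Integrable (fun x =>
      lineDeriv ℝ a x (-EuclideanSpace.single i 1) * U x i) volume := fun i => by
    have hb : LocallyIntegrable (fun x => U x i) volume := (hUi i).continuous.locallyIntegrable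
    have hK := (hb.integrableOn_isCompact hc.isCompact).bdd_mul
      (f := fun x => lineDeriv ℝ a x (-EuclideanSpace.single i 1)) (c := C * ‖-(EuclideanSpace.single i (1 : ℝ) : Space N)‖)
      (measurable_lineDeriv hC.continuous).aestronglyMeasurable
      (ae_of_all _ fun x => norm_lineDeriv_le_of_lipschitz ℝ hC)
    refine (integrableOn_iff_integrable_of_support_subset fun x hx => ?_).1 hK
    by_contra hx'
    apply hx
    have : a =ᶠ[𝓝 x] fun _ => 0 := notMem_tsupport_iff_eventuallyEq.1 hx'
    simp only
    rw [Filter.EventuallyEq.lineDeriv_eq this]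
    simp [lineDeriv]
  have h2 : ∫ x, fderiv ℝ a x (U x)
      = - ∑ i : Fin N, ∫ x, lineDeriv ℝ a x (-EuclideanSpace.single i 1) * U x i := by
    rw [← integral_finsetSum _ fun i _ => hint2 i, ← integral_neg]
    refine integral_congr_ae (hda.mono fun x hx => ?_)
    simp only
    conv_lhs => rw [← sum_single_smul (U x)]
    rw [map_sum, ← Finset.sum_neg_distrib]
    refine Finset.sum_congr rfl fun i _ => ?_
    rw [hx.lineDeriv_eq_fderiv, map_neg, map_smul, smul_eq_mul]
    ring
  rw [h2, Finset.sum_congr rfl fun i _ => (h1 i).symm, ← integral_finsetSum _ fun i _ => hint1 i,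
    neg_eq_zero]
  refine integral_eq_zero_of_ae ?_
  filter_upwards [hdU, hU.div] with x hx hdiv
  rw [← Finset.sum_mul]
  have : ∀ i : Fin N, lineDeriv ℝ (fun x => U x i) x (EuclideanSpace.single i 1)
      = fderiv ℝ U x (EuclideanSpace.single i 1) i := fun i => by
    have h3 : HasFDerivAt (fun x => U x i)
        ((EuclideanSpace.proj i : Space N →L[ℝ] ℝ).comp (fderiv ℝ U x)) x :=
      (EuclideanSpace.proj i : Space N →L[ℝ] ℝ).hasFDerivAt.comp x hx.hasFDerivAt
    rw [h3.differentiableAt.lineDeriv_eq_fderiv, h3.fderiv]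
    rfl
  simp_rw [this]
  unfold divOf at hdiv
  rw [hdiv, zero_mul]; rfl

end Lipschitz

/-! ### Bounded weak differentials give Lipschitz representatives -/

section WeakDerivative

variable {N : ℕ} {F : Type*} [NormedAddCommGroup F] [NormedSpace ℝ F]

/-- The mollification of a weakly differentiable function is differentiated under the integral. -/
lemma HasWeakFDeriv.fderiv_kconv_moll [CompleteSpace F] {f : Space N → F}
    {Df : Space N → Space N →L[ℝ] F} (h : HasWeakFDeriv f Df) {ε : ℝ} (hε : 0 < ε)
    (x v : Space N) : fderiv ℝ (kconv (moll ε) f) x v = kconv (moll ε) (fun y => Df y v) x := by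
  rw [fderiv_kconv (moll_contDiff ε) (moll_hasCompactSupport hε) h.locInt]
  have hsm : ContDiff ℝ ∞ fun y : Space N => moll ε (x - y) :=
    (moll_contDiff ε).comp (contDiff_const.sub contDiff_id)
  have hcs : HasCompactSupport fun y : Space N => moll ε (x - y) :=
    (moll_hasCompactSupport hε).comp_homeomorph (Homeomorph.subLeft x)
  have h1 := h.integral_eq _ hsm hcs v
  have h2 : ∀ y, fderiv ℝ (fun y : Space N => moll ε (x - y)) y v
      = - fderiv ℝ (moll ε) (x - y) v := fun y => by
    have h3 : HasFDerivAt (fun y : Space N => x - y) (-ContinuousLinearMap.id ℝ (Space N)) y := by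
      simpa using (hasFDerivAt_id y).const_sub x
    have h4 := (((moll_contDiff (N := N) ε).differentiable (by simp)).differentiableAt
      (x := x - y)).hasFDerivAt.comp y h3
    have h5 : fderiv ℝ (fun y : Space N => moll ε (x - y)) y = _ := h4.fderiv
    rw [h5]; simp
  simp_rw [h2, neg_smul, integral_neg, neg_inj] at h1
  exact h1

variable [FiniteDimensional ℝ F]

lemma locallyIntegrable_fderiv_apply {g : Space N → F} {K : ℝ≥0} (hg : LipschitzWith K g)
    (v : Space N) : LocallyIntegrable (fun x => fderiv ℝ g x v) volume := by
  have := FiniteDimensional.complete ℝ F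
  borelize F
  have : ProperSpace F := FiniteDimensional.proper_real F
  refine (locallyIntegrable_const (K * ‖v‖)).mono
    (measurable_fderiv_apply_const ℝ g v).aestronglyMeasurable (ae_of_all _ fun x => ?_)
  rw [Real.norm_of_nonneg (by positivity)]
  exact ((fderiv ℝ g x).le_opNorm v).trans (by gcongr; exact norm_fderiv_le_of_lip hg x)

/-- A function with bounded weak differential has a Lipschitz representative. -/
lemma HasWeakFDeriv.exists_lipschitzWith {f : Space N → F} {Df : Space N → Space N →L[ℝ] F}
    (h : HasWeakFDeriv f Df) {L : ℝ≥0} (hL : ∀ᵐ x, ‖Df x‖ ≤ L) :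
    ∃ g : Space N → F, LipschitzWith L g ∧ f =ᵐ[volume] g ∧ Df =ᵐ[volume] fderiv ℝ g := by
  have := FiniteDimensional.complete ℝ F
  set fn : ℕ → Space N → F := fun n => kconv (moll (epsSeq n)) f with hfn
  have hsmooth : ∀ n, ContDiff ℝ ∞ (fn n) := fun n =>
    contDiff_kconv (moll_contDiff _) (moll_hasCompactSupport (epsSeq_pos n)) h.locInt
  -- The differential of the mollification is the mollification of `Df`, so the bound `L` is
  -- inherited at every scale.
  have hlip : ∀ n, LipschitzWith L (fn n) := fun n => by
    refine lipschitzWith_of_nnnorm_fderiv_le (𝕜 := ℝ) ((hsmooth n).differentiable (by simp))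
      fun x => ?_
    rw [← NNReal.coe_le_coe, coe_nnnorm]
    refine ContinuousLinearMap.opNorm_le_bound _ L.2 fun v => ?_
    rw [h.fderiv_kconv_moll (epsSeq_pos n)]
    refine norm_kconv_moll_le (epsSeq_pos n) (hL.mono fun y hy => ?_) x
    exact ((Df y).le_opNorm v).trans (by gcongr)
  have hae := ae_tendsto_kconv_moll h.locInt
  have hdense : Dense {x | Tendsto (fun n => fn n x) atTop (𝓝 (f x))} :=
    Measure.dense_of_ae hae
  -- A uniformly Lipschitz sequence that converges on a dense set converges everywhere; the `+ 1` in
  -- the radius covers `L = 0`.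
  have hlim : ∀ x, ∃ z, Tendsto (fun n => fn n x) atTop (𝓝 z) := fun x => by
    refine cauchySeq_tendsto_of_complete (Metric.cauchySeq_iff.2 fun δ hδ => ?_)
    obtain ⟨y, hy, hxy⟩ := hdense.exists_dist_lt x (ε := δ / (3 * (L + 1))) (by positivity)
    obtain ⟨n₀, hn₀⟩ := Metric.cauchySeq_iff.1 (Tendsto.cauchySeq hy) (δ / 3) (by positivity)
    have hb : (L : ℝ) * dist x y < δ / 3 := by
      calc (L : ℝ) * dist x y ≤ L * (δ / (3 * (L + 1))) := by gcongr
        _ < (L + 1) * (δ / (3 * (L + 1))) := by gcongr; linarith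
        _ = δ / 3 := by field_simp
    refine ⟨n₀, fun m hm n hn => ?_⟩
    calc dist (fn m x) (fn n x)
        ≤ dist (fn m x) (fn m y) + dist (fn m y) (fn n y) + dist (fn n y) (fn n x) :=
          dist_triangle4 _ _ _ _
      _ < δ / 3 + δ / 3 + δ / 3 := by
          have h1 := (hlip m).dist_le_mul x y
          have h2 := (hlip n).dist_le_mul y x
          rw [dist_comm y x] at h2
          have h3 := hn₀ m hm n hn
          linarith
      _ = δ := by ring
  choose g hg using hlim
  have hgl : LipschitzWith L g := LipschitzWith.of_dist_le_mul fun x y =>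
    le_of_tendsto ((hg x).dist (hg y)) (Eventually.of_forall fun n => (hlip n).dist_le_mul x y)
  have hfg : f =ᵐ[volume] g := hae.mono fun x hx => tendsto_nhds_unique hx (hg x)
  refine ⟨g, hgl, hfg, ?_⟩
  have hDv : ∀ v : Space N, LocallyIntegrable (fun x => Df x v) volume := fun v =>
    fun x => ((ContinuousLinearMap.apply ℝ F v).integrableAtFilter_comp (h.locInt_deriv x))
  have hdg : ∀ᵐ x, DifferentiableAt ℝ g x := hgl.ae_differentiableAt
  have key : ∀ v : Space N, ∀ᵐ x, Df x v = fderiv ℝ g x v := fun v => by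
    refine ae_eq_of_integral_contDiff_smul_eq (hDv v) (locallyIntegrable_fderiv_apply hgl v)
      fun φ hφ hφc => ?_
    have h1 : ∫ x, φ x • Df x v = - ∫ x, fderiv ℝ φ x v • g x := by
      rw [← neg_eq_iff_eq_neg, ← h.integral_eq φ hφ hφc v]
      exact integral_congr_ae (hfg.mono fun x hx => by simp only [hx])
    rw [h1, eq_comm, ← sub_eq_zero, sub_neg_eq_add]
    have hφd : ContDiff ℝ 1 φ := hφ.of_le (by simp)
    have hi1 : Integrable (fun x => φ x • fderiv ℝ g x v) volume :=
      (locallyIntegrable_fderiv_apply hgl v).integrable_smul_left_of_hasCompactSupport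
        hφ.continuous hφc
    have hi2 : Integrable (fun x => fderiv ℝ φ x v • g x) volume :=
      hgl.continuous.locallyIntegrable.integrable_smul_left_of_hasCompactSupport
        ((hφ.continuous_fderiv (by simp)).clm_apply continuous_const) (hφc.fderiv_apply ℝ v)
    -- Composing with functionals `ℓ` reduces to a scalar function; then the claim is that the
    -- derivative of `φ * ℓ ∘ g` in the constant, hence divergence-free, direction `v` has integral
    -- zero.
    refine SeparatingDual.eq_zero_of_forall_dual_eq_zero (R := ℝ) fun ℓ => ?_
    rw [map_add, ← ℓ.integral_comp_comm hi1, ← ℓ.integral_comp_comm hi2]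
    have ha : LocallyLipschitz fun x => φ x * ℓ (g x) :=
      LocallyLipschitz.mul_real (hφd.locallyLipschitz (𝕂 := ℝ))
        (ℓ.lipschitz.comp hgl).locallyLipschitz
    have hac : HasCompactSupport fun x => φ x * ℓ (g x) := hφc.mul_right
    have h0 := integral_fderiv_apply_eq_zero ha hac (LipDivFree.const v)
    have hi1' := ℓ.integrable_comp hi1
    have hi2' := ℓ.integrable_comp hi2
    rw [← integral_add hi1' hi2', ← h0]
    refine integral_congr_ae (hdg.mono fun x hx => ?_)
    have h3 : HasFDerivAt (fun x => φ x * ℓ (g x)) _ x :=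
      ((hφ.differentiable (by simp)).differentiableAt (x := x)).hasFDerivAt.mul
        (ℓ.hasFDerivAt.comp x hx.hasFDerivAt)
    simp only [h3.fderiv]
    simp [mul_comm]
  have hall : ∀ᵐ x, ∀ i : Fin N, Df x (EuclideanSpace.single i 1)
      = fderiv ℝ g x (EuclideanSpace.single i 1) := ae_all_iff.2 fun i => key _
  filter_upwards [hall] with x hx
  ext v
  rw [← sum_single_smul v]
  simp only [map_sum, map_smul, hx]

end WeakDerivative

end InhomEuler


namespace InhomEuler

open Filter Topology Metric
open scoped ENNReal NNReal

/-! ### Cutoff functions -/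

section Cutoff

variable {N : ℕ}

noncomputable def cutBump (N : ℕ) : ContDiffBump (0 : Space N) :=
  ⟨1, 2, by norm_num, by norm_num⟩

/-- A smooth cutoff function which is `1` on the ball of radius `R` and vanishes outside the ball
of radius `2R`. -/
noncomputable def cut (R : ℝ) (x : Space N) : ℝ := cutBump N (R⁻¹ • x)

lemma cut_contDiff (R : ℝ) : ContDiff ℝ ∞ (cut R : Space N → ℝ) :=
  (cutBump N).contDiff.comp (contDiff_const_smul _)

lemma cut_nonneg (R : ℝ) (x : Space N) : 0 ≤ cut R x := (cutBump N).nonneg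

lemma cut_le_one (R : ℝ) (x : Space N) : cut R x ≤ 1 := (cutBump N).le_one

lemma norm_inv_smul_lt {R : ℝ} (hR : 0 < R) {x : Space N} {c : ℝ} (hx : c * R ≤ ‖x‖) :
    c ≤ ‖R⁻¹ • x‖ := by
  rw [norm_smul, norm_inv, Real.norm_of_nonneg hR.le, ← div_eq_inv_mul, le_div_iff₀ hR]
  exact hx

lemma cut_eq_one {R : ℝ} (hR : 0 < R) {x : Space N} (hx : ‖x‖ ≤ R) : cut R x = 1 := by
  refine (cutBump N).one_of_mem_closedBall ?_
  rw [mem_closedBall, dist_zero_right, norm_smul, norm_inv, Real.norm_of_nonneg hR.le,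
    ← div_eq_inv_mul]
  exact div_le_one_of_le₀ hx hR.le

lemma cut_eq_zero {R : ℝ} (hR : 0 < R) {x : Space N} (hx : 2 * R ≤ ‖x‖) : cut R x = 0 := by
  refine (cutBump N).zero_of_le_dist ?_
  rw [dist_zero_right]
  exact norm_inv_smul_lt hR hx

lemma cut_hasCompactSupport {R : ℝ} (hR : 0 < R) : HasCompactSupport (cut R : Space N → ℝ) :=
  HasCompactSupport.intro (isCompact_closedBall 0 (2 * R)) fun x hx => cut_eq_zero hR (by
    rw [mem_closedBall, dist_zero_right, not_le] at hx
    exact hx.le)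

lemma fderiv_cut (R : ℝ) (x : Space N) :
    fderiv ℝ (cut R) x = R⁻¹ • fderiv ℝ (cutBump N) (R⁻¹ • x) := by
  have h1 : DifferentiableAt ℝ (cutBump N) (R⁻¹ • x) :=
    ((cutBump N).contDiff (n := 1)).differentiable (by simp) |>.differentiableAt
  have h3 : HasFDerivAt (cut R) _ x :=
    h1.hasFDerivAt.comp x ((hasFDerivAt_id x).const_smul R⁻¹)
  rw [h3.fderiv]
  ext v
  simp

lemma fderiv_cut_eq_zero_of_lt {R : ℝ} (hR : 0 < R) {x : Space N} (hx : 2 * R < ‖x‖) :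
    fderiv ℝ (cut R) x = 0 := by
  have : cut R =ᶠ[𝓝 x] fun _ => (0 : ℝ) := by
    filter_upwards [(isOpen_lt continuous_const continuous_norm).mem_nhds hx] with y hy
    exact cut_eq_zero hR (le_of_lt hy)
  rw [this.fderiv_eq]; simp

lemma fderiv_cut_eq_zero_of_gt {R : ℝ} (hR : 0 < R) {x : Space N} (hx : ‖x‖ < R) :
    fderiv ℝ (cut R) x = 0 := by
  have : cut R =ᶠ[𝓝 x] fun _ => (1 : ℝ) := by
    filter_upwards [(isOpen_lt continuous_norm continuous_const).mem_nhds hx] with y hy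
    exact cut_eq_one hR (le_of_lt hy)
  rw [this.fderiv_eq]; simp

lemma exists_fderiv_cut_le (N : ℕ) : ∃ C : ℝ, 0 < C ∧ ∀ R : ℝ, 0 < R → ∀ x : Space N,
    ‖fderiv ℝ (cut R) x‖ ≤ C / R := by
  obtain ⟨C, hC⟩ := ((cutBump N).hasCompactSupport.fderiv ℝ).exists_bound_of_continuous
    (((cutBump N).contDiff (n := 1)).continuous_fderiv (by simp))
  refine ⟨max 1 C, by positivity, fun R hR x => ?_⟩
  rw [fderiv_cut, norm_smul, norm_inv, Real.norm_of_nonneg hR.le, ← div_eq_inv_mul]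
  gcongr
  exact (hC _).trans (le_max_right _ _)

/-- The constant in the gradient bound of the cutoff functions. -/
noncomputable def cutC (N : ℕ) : ℝ := (exists_fderiv_cut_le N).choose

lemma cutC_pos (N : ℕ) : 0 < cutC N := (exists_fderiv_cut_le N).choose_spec.1

lemma norm_fderiv_cut_le {R : ℝ} (hR : 0 < R) (x : Space N) :
    ‖fderiv ℝ (cut R) x‖ ≤ cutC N / R := (exists_fderiv_cut_le N).choose_spec.2 R hR x

/-- On the support of the gradient of the cutoff, a Lipschitz field grows at most linearly. -/
lemma norm_fderiv_cut_mul_le {R a L : ℝ} (hR : 0 < R) (hL : 0 ≤ L) (ha : 0 ≤ a)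
    {U : Space N → Space N} (hU : ∀ x, ‖U x‖ ≤ a + L * ‖x‖) (x : Space N) :
    ‖fderiv ℝ (cut R) x‖ * ‖U x‖ ≤ cutC N * (a / R + 2 * L) := by
  have hC := (cutC_pos N).le
  rcases le_or_gt ‖x‖ (2 * R) with hx | hx
  · calc ‖fderiv ℝ (cut R) x‖ * ‖U x‖ ≤ cutC N / R * (a + L * (2 * R)) := by
          refine mul_le_mul (norm_fderiv_cut_le hR x) ((hU x).trans (by gcongr))
            (norm_nonneg _) (by positivity)
      _ = _ := by field_simp
  · rw [fderiv_cut_eq_zero_of_lt hR hx, norm_zero, zero_mul]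
    positivity

lemma LipDivFree.norm_le {U : Space N → Space N} {K : ℝ≥0} (hU : LipDivFree U K) (x : Space N) :
    ‖U x‖ ≤ ‖U 0‖ + K * ‖x‖ := by
  have h := hU.lip.dist_le_mul x 0
  rw [dist_zero_right, dist_eq_norm] at h
  have := norm_le_norm_add_norm_sub' (U x) (U 0)
  linarith

lemma tendsto_cut (x : Space N) :
    Tendsto (fun n : ℕ => cut ((n : ℝ) + 1) x) atTop (𝓝 1) := by
  refine tendsto_const_nhds.congr' ?_
  filter_upwards [eventually_ge_atTop ⌈‖x‖⌉₊] with n hn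
  refine (cut_eq_one (by positivity) ?_).symm
  have := Nat.ceil_le.1 hn
  linarith

end Cutoff

/-! ### Gradients are orthogonal to divergences of antisymmetric matrices -/

section Pressure

variable {N : ℕ}

lemma two_le_infty : (2 : WithTop ℕ∞) ≤ ((⊤ : ℕ∞) : WithTop ℕ∞) := by
  change ((2 : ℕ∞) : WithTop ℕ∞) ≤ _
  exact WithTop.coe_le_coe.2 le_top

lemma aestronglyMeasurable_fderiv_apply {F : Type*} [NormedAddCommGroup F] [NormedSpace ℝ F]
    [FiniteDimensional ℝ F] (a : Space N → F) {U : Space N → Space N}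
    (hU : Continuous U) : AEStronglyMeasurable (fun x => fderiv ℝ a x (U x)) volume := by
  have := FiniteDimensional.complete ℝ F
  borelize F
  have : ProperSpace F := FiniteDimensional.proper_real F
  have h1 : Measurable (fderiv ℝ a) := measurable_fderiv ℝ a
  exact (isBoundedBilinearMap_apply.continuous.comp_aestronglyMeasurable
    (h1.aestronglyMeasurable.prodMk hU.aestronglyMeasurable))

lemma integrable_fderiv_apply {a : Space N → ℝ} (ha : LocallyLipschitz a)
    (hc : HasCompactSupport a) {U : Space N → Space N} (hU : Continuous U) :
    Integrable (fun x => fderiv ℝ a x (U x)) volume := by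
  obtain ⟨C, hC⟩ := LocallyLipschitz.exists_lipschitzWith_of_hasCompactSupport ha hc
  have h1 : LocallyIntegrable U volume := hU.locallyIntegrable
  have h2 : IntegrableOn (fun x => fderiv ℝ a x (U x)) (tsupport a) volume := by
    refine Integrable.mono' ((h1.integrableOn_isCompact hc.isCompact).norm.const_mul C)
      (aestronglyMeasurable_fderiv_apply a hU).restrict (ae_of_all _ fun x => ?_)
    exact ((fderiv ℝ a x).le_opNorm _).trans (by gcongr; exact norm_fderiv_le_of_lip hC x)
  refine (integrableOn_iff_integrable_of_support_subset fun x hx => ?_).1 h2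
  by_contra hx'
  apply hx
  have : a =ᶠ[𝓝 x] fun _ => 0 := notMem_tsupport_iff_eventuallyEq.1 hx'
  rw [this.fderiv_eq]
  simp

/-- The localized commutator of two divergence-free fields: the divergence of the antisymmetric
matrix field `χ (W ⊗ U - U ⊗ W)`. -/
noncomputable def skewField (χ : Space N → ℝ) (U W : Space N → Space N) (x : Space N) : Space N :=
  χ x • (fderiv ℝ W x (U x) - fderiv ℝ U x (W x)) + fderiv ℝ χ x (U x) • W x
    - fderiv ℝ χ x (W x) • U x

variable {U W : Space N → Space N} {K K' : ℝ≥0} {χ : Space N → ℝ}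

/-- The functions `χ ∂_W ψ` and `χ ∂_U ψ` are differentiated along the divergence-free fields `U`
and `W` respectively; both integrals vanish. In their difference the Hessian of `ψ` cancels by
symmetry, and what remains is `dψ` applied to `skewField`. -/
lemma integral_fderiv_skewField (hU : LipDivFree U K) (hW : LipDivFree W K')
    (hχ : ContDiff ℝ ∞ χ) (hc : HasCompactSupport χ) {ψ : Space N → ℝ} (hψ : ContDiff ℝ ∞ ψ) :
    ∫ x, fderiv ℝ ψ x (skewField χ U W x) = 0 := by
  have hψ' : ContDiff ℝ 1 (fderiv ℝ ψ) := hψ.fderiv_right (by rw [one_add_one_eq_two]; exact two_le_infty)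
  have heval : LocallyLipschitz fun p : (Space N →L[ℝ] ℝ) × Space N => p.1 p.2 :=
    (isBoundedBilinearMap_apply (𝕜 := ℝ) (E := Space N) (F := ℝ)).contDiff.locallyLipschitz
      (𝕂 := ℝ)
  have hχl : LocallyLipschitz χ := (hχ.of_le (by simp)).locallyLipschitz (𝕂 := ℝ)
  have hlip : ∀ {V : Space N → Space N} {k : ℝ≥0}, LipschitzWith k V →
      LocallyLipschitz fun x => χ x * fderiv ℝ ψ x (V x) := fun {V k} hV =>
    LocallyLipschitz.mul_real hχl
      (heval.comp ((hψ'.locallyLipschitz (𝕂 := ℝ)).prodMk hV.locallyLipschitz))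
  have ha := integral_fderiv_apply_eq_zero (hlip hW.lip) hc.mul_right hU
  have hb := integral_fderiv_apply_eq_zero (hlip hU.lip) hc.mul_right hW
  have hia := integrable_fderiv_apply (hlip hW.lip) hc.mul_right hU.continuous
  have hib := integrable_fderiv_apply (hlip hU.lip) hc.mul_right hW.continuous
  rw [← sub_eq_zero.2 (ha.trans hb.symm), ← integral_sub hia hib]
  refine integral_congr_ae ?_
  filter_upwards [hU.lip.ae_differentiableAt, hW.lip.ae_differentiableAt] with x hx hx'
  have hd : ∀ {V : Space N → Space N}, DifferentiableAt ℝ V x → ∀ v,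
      fderiv ℝ (fun x => χ x * fderiv ℝ ψ x (V x)) x v
      = χ x * (fderiv ℝ (fderiv ℝ ψ) x v (V x) + fderiv ℝ ψ x (fderiv ℝ V x v))
        + fderiv ℝ χ x v * fderiv ℝ ψ x (V x) := fun {V} hV v => by
    have h1 : HasFDerivAt (fun x => fderiv ℝ ψ x (V x)) _ x :=
      ((hψ'.differentiable (by simp)).differentiableAt (x := x)).hasFDerivAt.clm_apply
        hV.hasFDerivAt
    have h2 : HasFDerivAt (fun x => χ x * fderiv ℝ ψ x (V x)) _ x :=
      ((hχ.differentiable (by simp)).differentiableAt (x := x)).hasFDerivAt.mul h1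
    rw [h2.fderiv]
    simp
    ring
  have hsymm : fderiv ℝ (fderiv ℝ ψ) x (U x) (W x) = fderiv ℝ (fderiv ℝ ψ) x (W x) (U x) :=
    (hψ.contDiffAt.isSymmSndFDerivAt (by simpa using two_le_infty)).eq _ _
  simp only [hd hx', hd hx, skewField, map_sub, map_add, map_smul, smul_eq_mul, hsymm]
  ring

lemma exists_skewField_le (hU : LipDivFree U K) (hW : LipDivFree W K')
    (hχ : ContDiff ℝ ∞ χ) (hc : HasCompactSupport χ) :
    ∃ M R : ℝ, 0 ≤ M ∧ (∀ x, ‖skewField χ U W x‖ ≤ M) ∧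
      ∀ x, R < ‖x‖ → skewField χ U W x = 0 := by
  obtain ⟨R, hR⟩ := hc.isCompact.isBounded.subset_closedBall (0 : Space N)
  have hz : ∀ x, R < ‖x‖ → χ x = 0 ∧ fderiv ℝ χ x = 0 := fun x hx => by
    have h1 : x ∉ tsupport χ := fun h => by
      have := hR h
      rw [mem_closedBall, dist_zero_right] at this
      linarith
    refine ⟨image_eq_zero_of_notMem_tsupport h1, ?_⟩
    exact image_eq_zero_of_notMem_tsupport fun h => h1 (tsupport_fderiv_subset ℝ h)
  obtain ⟨c₁, h₁⟩ := hc.exists_bound_of_continuous hχ.continuous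
  obtain ⟨c₂, h₂⟩ := (hc.fderiv ℝ).exists_bound_of_continuous (hχ.continuous_fderiv (by simp))
  have hc₁ := (norm_nonneg _).trans (h₁ 0)
  have hc₂ := (norm_nonneg _).trans (h₂ 0)
  set u := ‖U 0‖ + K * |R|
  set w := ‖W 0‖ + K' * |R|
  refine ⟨c₁ * (K' * u + K * w) + c₂ * u * w + c₂ * w * u, R, by positivity, fun x => ?_,
    fun x hx => by simp [skewField, hz x hx]⟩
  by_cases hx : R < ‖x‖
  · simp only [skewField, hz x hx]
    simp
    positivity
  · rw [not_lt] at hx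
    have hu : ‖U x‖ ≤ u := (hU.norm_le x).trans
      (add_le_add le_rfl (mul_le_mul_of_nonneg_left (hx.trans (le_abs_self R)) K.2))
    have hw : ‖W x‖ ≤ w := (hW.norm_le x).trans
      (add_le_add le_rfl (mul_le_mul_of_nonneg_left (hx.trans (le_abs_self R)) K'.2))
    have e1 : ‖fderiv ℝ W x (U x)‖ ≤ K' * u := ((fderiv ℝ W x).le_opNorm _).trans
      (mul_le_mul (norm_fderiv_le_of_lip hW.lip x) hu (norm_nonneg _) K'.2)
    have e2 : ‖fderiv ℝ U x (W x)‖ ≤ K * w := ((fderiv ℝ U x).le_opNorm _).trans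
      (mul_le_mul (norm_fderiv_le_of_lip hU.lip x) hw (norm_nonneg _) K.2)
    have e3 : ‖fderiv ℝ χ x (U x)‖ ≤ c₂ * u := ((fderiv ℝ χ x).le_opNorm _).trans
      (mul_le_mul (h₂ x) hu (norm_nonneg _) hc₂)
    have e4 : ‖fderiv ℝ χ x (W x)‖ ≤ c₂ * w := ((fderiv ℝ χ x).le_opNorm _).trans
      (mul_le_mul (h₂ x) hw (norm_nonneg _) hc₂)
    refine (norm_sub_le _ _).trans (add_le_add ((norm_add_le _ _).trans (add_le_add ?_ ?_)) ?_)
    · rw [norm_smul]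
      exact mul_le_mul (h₁ x) ((norm_sub_le _ _).trans (add_le_add e1 e2)) (norm_nonneg _) hc₁
    · rw [norm_smul]
      exact mul_le_mul e3 hw (norm_nonneg _) (by positivity)
    · rw [norm_smul]
      exact mul_le_mul e4 hu (norm_nonneg _) (by positivity)

lemma aestronglyMeasurable_skewField (hU : LipDivFree U K) (hW : LipDivFree W K')
    (hχ : ContDiff ℝ ∞ χ) : AEStronglyMeasurable (skewField χ U W) volume := by
  have h1 := aestronglyMeasurable_fderiv_apply W hU.continuous
  have h2 := aestronglyMeasurable_fderiv_apply U hW.continuous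
  have h3 := aestronglyMeasurable_fderiv_apply χ hU.continuous
  have h4 := aestronglyMeasurable_fderiv_apply χ hW.continuous
  exact ((hχ.continuous.aestronglyMeasurable.smul (h1.sub h2)).add
    (h3.smul hW.continuous.aestronglyMeasurable)).sub (h4.smul hU.continuous.aestronglyMeasurable)

lemma HasWeakFDeriv.kconv_inner {p : Space N → ℝ} {q : Space N → Space N}
    (hq : HasWeakGradient p q) {ε : ℝ} (hε : 0 < ε) (hql : LocallyIntegrable q volume)
    (x v : Space N) : fderiv ℝ (kconv (moll ε) p) x v = inner ℝ (kconv (moll ε) q x) v := by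
  rw [HasWeakFDeriv.fderiv_kconv_moll hq hε]
  unfold kconv
  have h := integrable_kconv (moll_contDiff ε).continuous (moll_hasCompactSupport hε) hql x
  rw [real_inner_comm, ← integral_inner h v]
  refine integral_congr_ae (ae_of_all _ fun y => ?_)
  simp [inner_smul_right, real_inner_comm]

/-- A weak gradient is orthogonal to the localized commutators of divergence-free fields. -/
lemma integral_inner_skewField (hU : LipDivFree U K) (hW : LipDivFree W K')
    (hχ : ContDiff ℝ ∞ χ) (hc : HasCompactSupport χ) {p : Space N → ℝ} {q : Space N → Space N}
    (hq : HasWeakGradient p q) (hql : LocallyIntegrable q volume) :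
    ∫ x, inner ℝ (q x) (skewField χ U W x) = 0 := by
  obtain ⟨M, R, hM0, hM, hR⟩ := exists_skewField_le hU hW hχ hc
  set V := skewField χ U W with hV
  have hVm : AEStronglyMeasurable V volume := aestronglyMeasurable_skewField hU hW hχ
  have hint : ∀ {g : Space N → Space N}, LocallyIntegrable g volume →
      Integrable (fun x => inner ℝ (g x) (V x)) volume := fun {g} hg => by
    have h1 : IntegrableOn (fun x => inner ℝ (g x) (V x)) (closedBall 0 R) volume := by
      refine Integrable.mono' ((hg.integrableOn_isCompact
        (isCompact_closedBall 0 R)).norm.mul_const M)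
        (hg.aestronglyMeasurable.inner hVm).restrict (ae_of_all _ fun x => ?_)
      exact (norm_inner_le_norm _ _).trans (by gcongr; exact hM x)
    refine (integrableOn_iff_integrable_of_support_subset fun x hx => ?_).1 h1
    by_contra hx'
    rw [mem_closedBall, dist_zero_right, not_le] at hx'
    exact hx (by simp [hR x hx'])
  have hsm : ∀ n, ContDiff ℝ ∞ (kconv (moll (epsSeq n)) q) := fun n =>
    contDiff_kconv (moll_contDiff _) (moll_hasCompactSupport (epsSeq_pos n)) hql
  have h0 : ∀ n, ∫ x, inner ℝ (kconv (moll (epsSeq n)) q x) (V x) = 0 := fun n => by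
    rw [← integral_fderiv_skewField hU hW hχ hc
      (contDiff_kconv (moll_contDiff (epsSeq n)) (moll_hasCompactSupport (epsSeq_pos n)) hq.locInt)]
    simp_rw [HasWeakFDeriv.kconv_inner hq (epsSeq_pos n) hql]
    rfl
  -- The mollified gradient is the gradient of a smooth function, so its pairing with `V` vanishes.
  -- Since `V` is bounded with compact support, convergence of the mollifications in `L¹_loc`
  -- suffices, which is all that `q` allows.
  have hb : ∀ n, ‖∫ x, inner ℝ (q x) (V x)‖
      ≤ (∫ x in closedBall (0 : Space N) R, ‖kconv (moll (epsSeq n)) q x - q x‖) * M := fun n => by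
    rw [← norm_neg, ← zero_sub, ← h0 n, ← integral_sub
      (hint (hsm n).continuous.locallyIntegrable) (hint hql)]
    simp_rw [← inner_sub_left]
    rw [← setIntegral_eq_integral_of_forall_compl_eq_zero (s := closedBall (0 : Space N) R),
      ← integral_mul_const]
    · refine norm_integral_le_of_norm_le ?_ (ae_of_all _ fun x => ?_)
      · exact ((((hsm n).continuous.locallyIntegrable.sub hql).integrableOn_isCompact
          (isCompact_closedBall 0 R)).norm).mul_const M
      · exact (norm_inner_le_norm _ _).trans (by gcongr; exact hM x)
    · intro x hx
      rw [mem_closedBall, dist_zero_right, not_le] at hx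
      simp [hR x hx]
  have hlim := (tendsto_integral_ball_kconv_sub hql R).mul_const M
  rw [zero_mul] at hlim
  exact norm_le_zero_iff.1 (ge_of_tendsto' hlim hb)

end Pressure

end InhomEuler


namespace InhomEuler

open Filter Topology Metric
open scoped ENNReal NNReal

/-! ### Square integrability of the pressure gradient and its orthogonality to the velocity -/

section PressureEstimates

variable {N : ℕ} {U W : Space N → Space N} {K K' : ℝ≥0}

lemma integrable_inner_of_cut {χ : Space N → ℝ} (hχ : Continuous χ) (hc : HasCompactSupport χ)
    {q G : Space N → Space N} (hq : LocallyIntegrable (fun x => inner ℝ (q x) (G x)) volume) :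
    Integrable (fun x => χ x * inner ℝ (q x) (G x)) volume := by
  simpa using hq.integrable_smul_left_of_hasCompactSupport hχ hc

lemma locallyIntegrable_inner_continuous {q G : Space N → Space N}
    (hq : LocallyIntegrable q volume) (hG : AEStronglyMeasurable G volume)
    (hb : ∀ R : ℝ, ∃ M, ∀ x, ‖x‖ ≤ R → ‖G x‖ ≤ M) :
    LocallyIntegrable (fun x => inner ℝ (q x) (G x)) volume := by
  rw [locallyIntegrable_iff]
  intro k hk
  obtain ⟨R, hR⟩ := hk.isBounded.subset_closedBall (0 : Space N)
  obtain ⟨M, hM⟩ := hb R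
  refine Integrable.mono' ((hq.integrableOn_isCompact hk).norm.mul_const M)
    (hq.aestronglyMeasurable.inner hG).restrict ((ae_restrict_iff' hk.measurableSet).2
      (ae_of_all _ fun x hx => ?_))
  refine (norm_inner_le_norm _ _).trans (mul_le_mul_of_nonneg_left (hM x ?_) (norm_nonneg _))
  simpa using hR hx

lemma LipDivFree.bounded_fderiv_apply (hU : LipDivFree U K) (hW : LipDivFree W K') (R : ℝ) :
    ∃ M, ∀ x, ‖x‖ ≤ R → ‖fderiv ℝ W x (U x)‖ ≤ M := by
  refine ⟨K' * (‖U 0‖ + K * R), fun x hx => ((fderiv ℝ W x).le_opNorm _).trans ?_⟩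
  exact mul_le_mul (norm_fderiv_le_of_lip hW.lip x) ((hU.norm_le x).trans (by gcongr))
    (norm_nonneg _) K'.2

/-- Elliptic estimate for the pressure gradient: if `q = ρ (F - U · ∇W)` is a gradient, where `U`
and `W` are divergence free, then `q` is square integrable. -/
theorem memLp_pressure (hU : LipDivFree U K) (hW : LipDivFree W K') (hW2 : MemLp W 2 volume)
    {ρ : Space N → ℝ} {lo hi : ℝ} (hlo : 0 < lo) (hρ : ∀ᵐ x, lo ≤ ρ x ∧ ρ x ≤ hi)
    {p : Space N → ℝ} {q F : Space N → Space N} (hq : HasWeakGradient p q)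
    (hql : LocallyIntegrable q volume) (hF : MemLp F 2 volume)
    (heq : ∀ᵐ x, q x = ρ x • (F x - fderiv ℝ W x (U x))) :
    MemLp q 2 volume ∧ l2 q ≤ hi * (l2 F + K * (1 + 8 * cutC N) * l2 W) := by
  have hhi : 0 < hi := by
    obtain ⟨x, hx⟩ := hρ.exists
    linarith
  have hcC := (cutC_pos N).le
  have hlF := l2_nonneg F
  have hlW := l2_nonneg W
  set A : ℝ := ‖U 0‖
  -- the localized estimate
  have key : ∀ R : ℝ, 0 < R → MemLp (fun x => cut R x • q x) 2 volume ∧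
      l2 (fun x => cut R x • q x)
        ≤ hi * (l2 F + (K + 4 * (cutC N * (A / R + 2 * K))) * l2 W) := by
    intro R hR
    have hcs : HasCompactSupport (cut R : Space N → ℝ) := cut_hasCompactSupport hR
    have hsm := cut_contDiff (N := N) R
    -- Finiteness only: on the support of the cutoff `U · ∇W` is bounded. The bound depends on `R`,
    -- but it is what permits dividing by the norm `Q` at the end.
    have hq2 : MemLp (fun x => cut R x • q x) 2 volume := by
      obtain ⟨M, hM⟩ := hU.bounded_fderiv_apply hW (2 * R)
      have h1 : MemLp (fun x => cut R x • fderiv ℝ W x (U x)) 2 volume := by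
        have hind : MemLp ((closedBall (0 : Space N) (2 * R)).indicator fun _ => M) 2 volume :=
          memLp_indicator_const 2 measurableSet_closedBall M
            (Or.inr measure_closedBall_lt_top.ne)
        refine hind.mono (hsm.continuous.aestronglyMeasurable.smul
          (aestronglyMeasurable_fderiv_apply W hU.continuous)) (ae_of_all _ fun x => ?_)
        by_cases hx : x ∈ closedBall (0 : Space N) (2 * R)
        · rw [indicator_of_mem hx, norm_smul, Real.norm_of_nonneg (cut_nonneg _ _)]
          rw [mem_closedBall, dist_zero_right] at hx
          calc cut R x * ‖fderiv ℝ W x (U x)‖ ≤ 1 * M :=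
                mul_le_mul (cut_le_one _ _) (hM x hx) (norm_nonneg _) zero_le_one
            _ ≤ ‖M‖ := by rw [one_mul]; exact le_abs_self M
        · rw [mem_closedBall, dist_zero_right, not_le] at hx
          rw [cut_eq_zero hR hx.le]
          simp
      have h2 : MemLp (fun x => cut R x • F x) 2 volume := by
        refine hF.mono (hsm.continuous.aestronglyMeasurable.smul hF.1) (ae_of_all _ fun x => ?_)
        rw [norm_smul, Real.norm_of_nonneg (cut_nonneg _ _)]
        exact mul_le_of_le_one_left (norm_nonneg _) (cut_le_one _ _)
      refine memLp_two_of_le_mul (c := hi) (h2.sub h1)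
        (hsm.continuous.aestronglyMeasurable.smul hql.aestronglyMeasurable) ?_
      filter_upwards [heq, hρ] with x hx hx'
      rw [Pi.sub_apply, ← smul_sub, hx, smul_comm, norm_smul]
      gcongr
      rw [Real.norm_of_nonneg (hlo.le.trans hx'.1)]
      exact hx'.2
    refine ⟨hq2, ?_⟩
    set Q := l2 fun x => cut R x • q x
    set s := cutC N * (A / R + 2 * K)
    have hs0 : 0 ≤ s := by positivity
    -- the cutoff used in the orthogonality relation
    set χ : Space N → ℝ := fun x => cut R x * cut R x with hχdef
    have hχ : ContDiff ℝ ∞ χ := hsm.mul hsm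
    have hχc : HasCompactSupport χ := hcs.mul_right
    -- Squaring the cutoff leaves one factor `cut R` in the gradient of `χ`, so the error terms are
    -- controlled by `cut R • q` rather than by `q`.
    have hDχ : ∀ x v, fderiv ℝ χ x v = 2 * cut R x * fderiv ℝ (cut R) x v := fun x v => by
      have hd := ((hsm.differentiable (by simp)).differentiableAt (x := x)).hasFDerivAt
      have h1 : HasFDerivAt χ _ x := hd.mul hd
      rw [h1.fderiv]
      simp
      ring
    have horth := integral_inner_skewField hU hW hχ hχc hq hql
    -- pointwise inequality
    have hpt : ∀ᵐ x, hi⁻¹ * ‖cut R x • q x‖ ^ 2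
        ≤ ‖cut R x • q x‖ * ‖F x‖ + (K + 4 * s) * (‖cut R x • q x‖ * ‖W x‖)
          - inner ℝ (q x) (skewField χ U W x) := by
      filter_upwards [heq, hρ] with x hx hx'
      have hρ0 : 0 < ρ x := hlo.trans_le hx'.1
      have hFx : F x - fderiv ℝ W x (U x) = (ρ x)⁻¹ • q x := by
        rw [hx, smul_smul, inv_mul_cancel₀ hρ0.ne', one_smul]
      have hc0 := cut_nonneg R x
      have hc1 := cut_le_one R x
      set c := cut R x
      have hn : ‖c • q x‖ = c * ‖q x‖ := by rw [norm_smul, Real.norm_of_nonneg hc0]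
      -- Coercivity: dividing the equation by `ρ ≤ hi` and pairing with `q`.
      have e0 : hi⁻¹ * ‖q x‖ ^ 2 ≤ inner ℝ (q x) (F x) - inner ℝ (q x) (fderiv ℝ W x (U x)) := by
        rw [← inner_sub_right, hFx, inner_smul_right, real_inner_self_eq_norm_sq]
        gcongr
        exact hx'.2
      have e1 : inner ℝ (q x) (F x) ≤ ‖q x‖ * ‖F x‖ := real_inner_le_norm _ _
      -- After the exchange of `U · ∇W` for `W · ∇U` only the Lipschitz constant of `U` and the size
      -- of `W` are seen, not the size of `U`.
      have e2 : -inner ℝ (q x) (fderiv ℝ U x (W x)) ≤ ‖q x‖ * (K * ‖W x‖) := by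
        refine (neg_le_abs _).trans ((abs_real_inner_le_norm _ _).trans ?_)
        gcongr
        exact ((fderiv ℝ U x).le_opNorm _).trans (by gcongr; exact norm_fderiv_le_of_lip hU.lip x)
      -- The linear growth of `U` is compensated by the `1 / R` in the gradient of the cutoff, so
      -- `s` stays bounded as `R` grows.
      have hsx : ‖fderiv ℝ (cut R) x‖ * ‖U x‖ ≤ s :=
        norm_fderiv_cut_mul_le hR K.2 (norm_nonneg _) hU.norm_le x
      have e3 : fderiv ℝ (cut R) x (U x) * inner ℝ (q x) (W x) ≤ s * (‖q x‖ * ‖W x‖) := by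
        refine (le_abs_self _).trans ?_
        rw [abs_mul]
        exact mul_le_mul (((fderiv ℝ (cut R) x).le_opNorm _).trans hsx)
          (abs_real_inner_le_norm _ _) (abs_nonneg _) hs0
      have e4 : -(fderiv ℝ (cut R) x (W x) * inner ℝ (q x) (U x)) ≤ s * (‖q x‖ * ‖W x‖) := by
        refine (neg_le_abs _).trans ?_
        rw [abs_mul]
        calc |fderiv ℝ (cut R) x (W x)| * |inner ℝ (q x) (U x)|
            ≤ (‖fderiv ℝ (cut R) x‖ * ‖W x‖) * (‖q x‖ * ‖U x‖) :=
              mul_le_mul ((fderiv ℝ (cut R) x).le_opNorm _) (abs_real_inner_le_norm _ _)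
                (abs_nonneg _) (by positivity)
          _ = (‖fderiv ℝ (cut R) x‖ * ‖U x‖) * (‖q x‖ * ‖W x‖) := by ring
          _ ≤ _ := by gcongr
      have hV : inner ℝ (q x) (skewField χ U W x)
          = c * c * (inner ℝ (q x) (fderiv ℝ W x (U x)) - inner ℝ (q x) (fderiv ℝ U x (W x)))
            + 2 * c * (fderiv ℝ (cut R) x (U x) * inner ℝ (q x) (W x))
            - 2 * c * (fderiv ℝ (cut R) x (W x) * inner ℝ (q x) (U x)) := by
        simp only [skewField, inner_sub_right, inner_add_right, inner_smul_right, hDχ]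
        simp only [hχdef]
        ring
      rw [hV, hn]
      have m0 := mul_le_mul_of_nonneg_left e0 (mul_nonneg hc0 hc0)
      have m1 := mul_le_mul_of_nonneg_left e1 (mul_nonneg hc0 hc0)
      have m2 := mul_le_mul_of_nonneg_left e2 (mul_nonneg hc0 hc0)
      have m3 := mul_le_mul_of_nonneg_left e3 (mul_nonneg zero_le_two hc0)
      have m4 := mul_le_mul_of_nonneg_left e4 (mul_nonneg zero_le_two hc0)
      have m5 : c * c * (‖q x‖ * ‖F x‖) ≤ c * ‖q x‖ * ‖F x‖ := by
        calc c * c * (‖q x‖ * ‖F x‖) ≤ c * 1 * (‖q x‖ * ‖F x‖) := by gcongr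
          _ = _ := by ring
      have m6 : c * c * (‖q x‖ * (K * ‖W x‖)) ≤ K * (c * ‖q x‖ * ‖W x‖) := by
        calc c * c * (‖q x‖ * (K * ‖W x‖)) ≤ c * 1 * (‖q x‖ * (K * ‖W x‖)) := by gcongr
          _ = _ := by ring
      calc hi⁻¹ * (c * ‖q x‖) ^ 2 = c * c * (hi⁻¹ * ‖q x‖ ^ 2) := by ring
        _ ≤ _ := by linarith
    have hi1 : Integrable (fun x => ‖cut R x • q x‖ * ‖F x‖) volume :=
      integrable_norm_mul_norm hq2 hF
    have hi2 : Integrable (fun x => ‖cut R x • q x‖ * ‖W x‖) volume :=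
      integrable_norm_mul_norm hq2 hW2
    have hi3 : Integrable (fun x => inner ℝ (q x) (skewField χ U W x)) volume := by
      obtain ⟨M, R', hM0, hM, hR'⟩ := exists_skewField_le hU hW hχ hχc
      have h1 := locallyIntegrable_inner_continuous hql (aestronglyMeasurable_skewField hU hW hχ)
        fun _ => ⟨M, fun x _ => hM x⟩
      have h2 := h1.integrableOn_isCompact (isCompact_closedBall (0 : Space N) R')
      refine (integrableOn_iff_integrable_of_support_subset fun x hx => ?_).1 h2
      by_contra hx'
      rw [mem_closedBall, dist_zero_right, not_le] at hx'
      exact hx (by simp [hR' x hx'])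
    have hi12 : Integrable (fun x => ‖cut R x • q x‖ * ‖F x‖
        + (K + 4 * s) * (‖cut R x • q x‖ * ‖W x‖)) volume := hi1.add (hi2.const_mul _)
    have hmain : hi⁻¹ * Q ^ 2 ≤ Q * l2 F + (K + 4 * s) * (Q * l2 W) := by
      calc hi⁻¹ * Q ^ 2 = ∫ x, hi⁻¹ * ‖cut R x • q x‖ ^ 2 := by
            rw [l2_sq hq2, integral_const_mul]
        _ ≤ ∫ x, (‖cut R x • q x‖ * ‖F x‖ + (K + 4 * s) * (‖cut R x • q x‖ * ‖W x‖)
            - inner ℝ (q x) (skewField χ U W x)) :=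
            integral_mono_ae ((integrable_norm_sq hq2).const_mul _)
              (hi12.sub hi3) hpt
        _ = (∫ x, ‖cut R x • q x‖ * ‖F x‖) + (K + 4 * s) * ∫ x, ‖cut R x • q x‖ * ‖W x‖ := by
            rw [integral_sub hi12 hi3, horth, sub_zero,
              integral_add hi1 (hi2.const_mul _), integral_const_mul]
        _ ≤ _ := by
            gcongr
            · exact integral_norm_mul_norm_le hq2 hF
            · exact integral_norm_mul_norm_le hq2 hW2
    have hQ0 : 0 ≤ Q := l2_nonneg _
    rcases hQ0.eq_or_lt with h | h
    · rw [← h]; positivity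
    · have h5 : hi⁻¹ * Q ≤ l2 F + (K + 4 * s) * l2 W := by
        refine le_of_mul_le_mul_right ?_ h
        linarith
      calc Q = hi * (hi⁻¹ * Q) := by field_simp
        _ ≤ _ := by gcongr
  -- removal of the cutoff
  have hlim : ∀ᵐ x, Tendsto (fun n : ℕ => cut ((n : ℝ) + 1) x • q x) atTop (𝓝 (q x)) :=
    ae_of_all _ fun x => by simpa using (tendsto_cut x).smul_const (q x)
  have hfatou := Lp.eLpNorm_lim_le_liminf_eLpNorm (p := 2)
    (fun n : ℕ => (key ((n : ℝ) + 1) (by positivity)).1.1) q hlim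
  set B : ℕ → ℝ := fun n => hi * (l2 F + (K + 4 * (cutC N * (A / ((n : ℝ) + 1) + 2 * K))) * l2 W)
  -- The contribution of `U 0` disappears with `1 / R`; the limit of `K + 4 * s` is `K * (1 + 8 *
  -- cutC N)`.
  have hB : Tendsto B atTop (𝓝 (hi * (l2 F + K * (1 + 8 * cutC N) * l2 W))) := by
    have h0 : Tendsto (fun n : ℕ => A / ((n : ℝ) + 1)) atTop (𝓝 0) := by
      have := (tendsto_one_div_add_atTop_nhds_zero_nat (𝕜 := ℝ)).const_mul A
      simpa [div_eq_mul_inv] using this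
    have h1 := (((((((h0.add_const (2 * (K : ℝ))).const_mul (cutC N)).const_mul 4).const_add
      (K : ℝ)).mul_const (l2 W)).const_add (l2 F)).const_mul hi)
    convert h1 using 2
    ring
  have hle : eLpNorm q 2 volume
      ≤ ENNReal.ofReal (hi * (l2 F + K * (1 + 8 * cutC N) * l2 W)) := by
    refine hfatou.trans ?_
    have h2 := (ENNReal.tendsto_ofReal hB).liminf_eq
    rw [← h2]
    refine liminf_le_liminf (Eventually.of_forall fun n => ?_)
    have h3 := key ((n : ℝ) + 1) (by positivity)
    rw [← ENNReal.ofReal_toReal h3.1.2.ne]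
    exact ENNReal.ofReal_le_ofReal h3.2
  refine ⟨⟨hql.aestronglyMeasurable, hle.trans_lt ENNReal.ofReal_lt_top⟩, ?_⟩
  exact ENNReal.toReal_le_of_le_ofReal (by positivity) hle

lemma tendsto_l2_indicator {F : Type*} [NormedAddCommGroup F] {f : Space N → F}
    (hf : MemLp f 2 volume) (S : ℕ → Set (Space N)) (hms : ∀ n, MeasurableSet (S n))
    (hlim : ∀ᵐ x : Space N, Tendsto (fun n => ‖((S n).indicator f) x‖ ^ 2) atTop (𝓝 (0 : ℝ))) :
    Tendsto (fun n : ℕ => l2 ((S n).indicator f)) atTop (𝓝 0) := by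
  have hi : ∀ n, Integrable (fun x => ‖((S n).indicator f) x‖ ^ 2) volume := fun n => by
    have hm := hf.indicator (hms n)
    exact integrable_norm_sq hm
  have hi0 : Integrable (fun x => ‖f x‖ ^ 2) volume := integrable_norm_sq hf
  have hle : ∀ n, ∀ᵐ x : Space N, ‖‖((S n).indicator f) x‖ ^ 2‖ ≤ ‖f x‖ ^ 2 := fun n => by
    refine ae_of_all _ fun x => ?_
    rw [norm_pow, norm_norm]
    exact pow_le_pow_left₀ (norm_nonneg _) (norm_indicator_le_norm_self _ _) 2
  have h1 := tendsto_integral_of_dominated_convergence _ (fun n => (hi n).1) hi0 hle hlim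
  rw [integral_zero] at h1
  have h3 : ∀ n, l2 ((S n).indicator f) = √(∫ x, ‖((S n).indicator f) x‖ ^ 2) := fun n => by
    have hm := hf.indicator (hms n)
    rw [← l2_sq hm, Real.sqrt_sq (l2_nonneg _)]
  simp_rw [h3]
  have h2 := h1.sqrt
  rwa [Real.sqrt_zero] at h2

lemma tendsto_l2_tail {F : Type*} [NormedAddCommGroup F] {f : Space N → F}
    (hf : MemLp f 2 volume) :
    Tendsto (fun n : ℕ => l2 ({x : Space N | (n : ℝ) ≤ ‖x‖}.indicator f)) atTop (𝓝 0) := by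
  refine tendsto_l2_indicator hf _ (fun n => measurableSet_le measurable_const measurable_norm) ?_
  refine ae_of_all _ fun x => ?_
  refine tendsto_const_nhds.congr' ?_
  filter_upwards [eventually_gt_atTop ⌈‖x‖⌉₊] with n hn
  have h2 : ‖x‖ < n := (Nat.le_ceil _).trans_lt (by exact_mod_cast hn)
  have h3 : x ∉ {x : Space N | (n : ℝ) ≤ ‖x‖} := fun h => absurd h2 (not_lt.2 h)
  rw [indicator_of_notMem h3, norm_zero]
  norm_num

lemma fderiv_comp_sub_const (W : Space N → Space N) (v x : Space N) :
    fderiv ℝ (fun x => W (x - v)) x = fderiv ℝ W (x - v) := by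
  simpa [sub_eq_add_neg] using fderiv_comp_add_right (f := W) (x := x) (𝕜 := ℝ) (-v)

lemma LipDivFree.translate (hW : LipDivFree W K) (v : Space N) :
    LipDivFree (fun x => W (x - v)) K where
  lip := LipschitzWith.of_dist_le_mul fun x y => by
    simpa using hW.lip.dist_le_mul (x - v) (y - v)
  div := by
    have h := (measurePreserving_sub_right volume v).quasiMeasurePreserving.ae hW.div
    filter_upwards [h] with x hx
    rw [fderiv_comp_sub_const]
    exact hx

lemma memLp_translate {F : Type*} [NormedAddCommGroup F] {f : Space N → F} (hf : MemLp f 2 volume)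
    (v : Space N) : MemLp (fun x => f (x - v)) 2 volume ∧ l2 (fun x => f (x - v)) = l2 f := by
  have h := measurePreserving_sub_right (volume : Measure (Space N)) v
  refine ⟨hf.comp_measurePreserving h, ?_⟩
  unfold l2
  congr 1
  exact eLpNorm_comp_measurePreserving hf.1 h

/-- For a constant field `v` the commutator with `W` is `∂_v W`, which is minus the derivative of `W
(x - s • v)` in `s`. Orthogonality of `q` to `skewField` therefore turns the derivative of the
translated pairing into terms carrying the gradient of the cutoff, of size `1 / R`. No growth
information on `p` is used, in contrast to a direct integration by parts. -/
lemma abs_integral_cut_translate_le (hW : LipDivFree W K) (hW2 : MemLp W 2 volume)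
    {p : Space N → ℝ} {q : Space N → Space N} (hq : HasWeakGradient p q) (hq2 : MemLp q 2 volume)
    {R : ℝ} (hR : 0 < R) (v : Space N) :
    |(∫ x, cut R x * inner ℝ (q x) (W (x - v))) - ∫ x, cut R x * inner ℝ (q x) (W x)|
      ≤ 2 * (cutC N / R) * ‖v‖ * (l2 q * l2 W) := by
  have hql : LocallyIntegrable q volume := hq2.locallyIntegrable (by norm_num)
  have hcs : HasCompactSupport (cut R : Space N → ℝ) := cut_hasCompactSupport hR
  have hsm := cut_contDiff (N := N) R
  have hint : ∀ {G : Space N → Space N} {M : ℝ}, AEStronglyMeasurable G volume →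
      (∀ x, ‖G x‖ ≤ M) → Integrable (fun x => cut R x * inner ℝ (q x) (G x)) volume :=
    fun hG hM => integrable_inner_of_cut hsm.continuous hcs
      (locallyIntegrable_inner_continuous hql hG fun _ => ⟨_, fun x _ => hM x⟩)
  have hintc : ∀ {G : Space N → Space N}, Continuous G →
      Integrable (fun x => cut R x * inner ℝ (q x) (G x)) volume := fun {G} hG => by
    refine integrable_inner_of_cut hsm.continuous hcs
      (locallyIntegrable_inner_continuous hql hG.aestronglyMeasurable fun r => ?_)
    obtain ⟨M, hM⟩ := (isCompact_closedBall (0 : Space N) r).exists_bound_of_continuousOn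
      hG.continuousOn
    exact ⟨M, fun x hx => hM x (by simpa using hx)⟩
  have hDm : ∀ s : ℝ, AEStronglyMeasurable (fun x => fderiv ℝ W (x - s • v) v) volume := fun s => by
    have h := aestronglyMeasurable_fderiv_apply (fun x => W (x - s • v))
      (continuous_const (y := v) : Continuous fun _ : Space N => v)
    simpa only [fderiv_comp_sub_const] using h
  have hDb : ∀ (s : ℝ) (x : Space N), ‖fderiv ℝ W (x - s • v) v‖ ≤ K * ‖v‖ := fun s x =>
    ((fderiv ℝ W _).le_opNorm _).trans (by gcongr; exact norm_fderiv_le_of_lip hW.lip _)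
  -- the derivative along the translation
  have hder : ∀ s : ℝ, HasDerivAt (fun s : ℝ => ∫ x, cut R x * inner ℝ (q x) (W (x - s • v)))
      (∫ x, cut R x * inner ℝ (q x) (-fderiv ℝ W (x - s • v) v)) s := fun s => by
    refine (hasDerivAt_integral_of_dominated_loc_of_lip (s := univ)
      (bound := fun x => ‖cut R x * (‖q x‖ * (K * ‖v‖))‖) univ_mem
      (Eventually.of_forall fun s =>
        (hintc (hW.continuous.comp (continuous_id.sub continuous_const))).1)
      (hintc (hW.continuous.comp (continuous_id.sub continuous_const)))
      (hint (hDm s).neg (M := K * ‖v‖) fun x => by rw [Pi.neg_apply, norm_neg]; exact hDb s x).1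
      ?_ ?_ ?_).2
    · refine ae_of_all _ fun x => LipschitzWith.lipschitzOnWith
        (LipschitzWith.of_dist_le_mul fun a b => ?_)
      rw [Real.dist_eq, ← mul_sub, ← inner_sub_right, abs_mul, Real.coe_nnabs, Real.norm_eq_abs,
        abs_abs, abs_mul, mul_assoc]
      refine mul_le_mul_of_nonneg_left ?_ (abs_nonneg _)
      rw [abs_of_nonneg (a := ‖q x‖ * (K * ‖v‖)) (by positivity), mul_assoc]
      refine (abs_real_inner_le_norm _ _).trans ?_
      gcongr
      have h := hW.lip.dist_le_mul (x - a • v) (x - b • v)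
      rw [dist_eq_norm] at h
      refine h.trans_eq ?_
      rw [dist_sub_left, dist_eq_norm, ← sub_smul, norm_smul, Real.dist_eq, Real.norm_eq_abs]
      ring
    · have h1 : LocallyIntegrable (fun x => ‖q x‖ * (K * ‖v‖)) volume := fun x => by
        obtain ⟨t, ht, h⟩ := hql x
        exact ⟨t, ht, h.norm.mul_const _⟩
      simpa using (h1.integrable_smul_left_of_hasCompactSupport hsm.continuous hcs).norm
    · have h := (measurePreserving_sub_right volume (s • v)).quasiMeasurePreserving.ae
        hW.lip.ae_differentiableAt
      filter_upwards [h] with x hx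
      have h1 : HasDerivAt (fun s : ℝ => x - s • v) (-v) s := by
        simpa using ((hasDerivAt_id s).smul_const v).const_sub x
      have h2 := hx.hasFDerivAt.comp_hasDerivAt s h1
      have h3 := ((innerSL ℝ (q x)).hasFDerivAt.comp_hasDerivAt s h2).const_mul (cut R x)
      simpa using h3
  have hbound : ∀ s : ℝ, |∫ x, cut R x * inner ℝ (q x) (-fderiv ℝ W (x - s • v) v)|
      ≤ 2 * (cutC N / R) * ‖v‖ * (l2 q * l2 W) := fun s => by
    have hWs := hW.translate (s • v)
    obtain ⟨hWs2, hWsn⟩ := memLp_translate hW2 (s • v)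
    have h0 := integral_inner_skewField (LipDivFree.const v) hWs hsm hcs hq hql
    set G : Space N → Space N := fun x => fderiv ℝ (cut R) x v • W (x - s • v)
      - fderiv ℝ (cut R) x (W (x - s • v)) • v
    have hG : ∀ x, ‖inner ℝ (q x) (G x)‖
        ≤ 2 * (cutC N / R) * ‖v‖ * (‖q x‖ * ‖W (x - s • v)‖) := fun x => by
      refine (norm_inner_le_norm _ _).trans ?_
      have h1 : ‖G x‖ ≤ 2 * (cutC N / R) * ‖v‖ * ‖W (x - s • v)‖ := by
        refine (norm_sub_le _ _).trans ?_
        rw [norm_smul, norm_smul]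
        have hc := norm_fderiv_cut_le hR x
        have e1 : ‖fderiv ℝ (cut R) x v‖ ≤ cutC N / R * ‖v‖ :=
          ((fderiv ℝ (cut R) x).le_opNorm _).trans (by gcongr)
        have e2 : ‖fderiv ℝ (cut R) x (W (x - s • v))‖ ≤ cutC N / R * ‖W (x - s • v)‖ :=
          ((fderiv ℝ (cut R) x).le_opNorm _).trans (by gcongr)
        have e3 := mul_le_mul_of_nonneg_right e1 (norm_nonneg (W (x - s • v)))
        have e4 := mul_le_mul_of_nonneg_right e2 (norm_nonneg v)
        linarith
      calc ‖q x‖ * ‖G x‖ ≤ ‖q x‖ * (2 * (cutC N / R) * ‖v‖ * ‖W (x - s • v)‖) := by gcongr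
        _ = _ := by ring
    have hdi := integrable_norm_mul_norm hq2 hWs2
    have hGm : AEStronglyMeasurable G volume := by
      have m1 := aestronglyMeasurable_fderiv_apply (cut R) (continuous_const (y := v))
      have m2 := aestronglyMeasurable_fderiv_apply (cut R) hWs.continuous
      exact (m1.smul hWs.continuous.aestronglyMeasurable).sub (m2.smul aestronglyMeasurable_const)
    have hGi : Integrable (fun x => inner ℝ (q x) (G x)) volume :=
      Integrable.mono' (hdi.const_mul _) (hq2.1.inner hGm) (ae_of_all _ hG)
    have h2 : ∫ x, cut R x * inner ℝ (q x) (-fderiv ℝ W (x - s • v) v)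
        = ∫ x, inner ℝ (q x) (G x) := by
      have hi1 : Integrable (fun x => cut R x * inner ℝ (q x) (-fderiv ℝ W (x - s • v) v)) volume :=
        hint (hDm s).neg (M := K * ‖v‖) fun x => by rw [norm_neg]; exact hDb s x
      rw [← sub_eq_zero, ← integral_sub hi1 hGi, ← neg_eq_zero, ← integral_neg, ← h0]
      refine integral_congr_ae (ae_of_all _ fun x => ?_)
      simp only [skewField, G, fderiv_comp_sub_const, fderiv_fun_const, Pi.zero_apply,
        zero_apply, sub_zero, inner_sub_right, inner_add_right, inner_smul_right, inner_neg_right]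
      ring
    rw [h2, ← Real.norm_eq_abs]
    refine (norm_integral_le_of_norm_le (hdi.const_mul _) (ae_of_all _ hG)).trans ?_
    rw [integral_const_mul, ← hWsn]
    have := (cutC_pos N).le
    gcongr
    exact integral_norm_mul_norm_le hq2 hWs2
  -- Mean value inequality between `s = 0` and `s = 1`.
  have hmv := norm_image_sub_le_of_norm_deriv_le_segment_01'
    (fun s _ => (hder s).hasDerivWithinAt) (fun s _ => by
      rw [Real.norm_eq_abs]; exact hbound s)
  simpa using hmv

/-- Square integrable gradients and divergence-free fields are orthogonal. -/
theorem integral_inner_gradient_eq_zero (hN : 0 < N) (hW : LipDivFree W K)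
    (hW2 : MemLp W 2 volume) {p : Space N → ℝ} {q : Space N → Space N}
    (hq : HasWeakGradient p q) (hq2 : MemLp q 2 volume) : ∫ x, inner ℝ (q x) (W x) = 0 := by
  have hlim : ∀ {G : Space N → Space N}, MemLp G 2 volume →
      Tendsto (fun n : ℕ => ∫ x, cut ((n : ℝ) + 1) x * inner ℝ (q x) (G x)) atTop
        (𝓝 (∫ x, inner ℝ (q x) (G x))) := fun {G} hG => by
    refine tendsto_integral_of_dominated_convergence (fun x => ‖q x‖ * ‖G x‖)
      (fun n => (cut_contDiff _).continuous.aestronglyMeasurable.mul (hq2.1.inner hG.1))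
      (integrable_norm_mul_norm hq2 hG) (fun n => ae_of_all _ fun x => ?_)
      (ae_of_all _ fun x => by simpa using (tendsto_cut x).mul_const (inner ℝ (q x) (G x)))
    rw [norm_mul, Real.norm_of_nonneg (cut_nonneg _ _)]
    exact (mul_le_of_le_one_left (norm_nonneg _) (cut_le_one _ _)).trans (norm_inner_le_norm _ _)
  -- Letting the cutoff radius tend to infinity, the pairing becomes independent of the translation.
  have htrans : ∀ v : Space N,
      ∫ x, inner ℝ (q x) (W (x - v)) = ∫ x, inner ℝ (q x) (W x) := fun v => by
    have h1 := ((hlim (memLp_translate hW2 v).1).sub (hlim hW2)).abs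
    have h2 : Tendsto (fun n : ℕ => 2 * (cutC N / ((n : ℝ) + 1)) * ‖v‖ * (l2 q * l2 W)) atTop
        (𝓝 0) := by
      have h3 := (((((tendsto_one_div_add_atTop_nhds_zero_nat (𝕜 := ℝ)).const_mul
        (cutC N)).const_mul 2).mul_const ‖v‖).mul_const (l2 q * l2 W))
      simpa [div_eq_mul_inv] using h3
    have h4 := le_of_tendsto_of_tendsto' h1 h2 fun n =>
      abs_integral_cut_translate_le hW hW2 hq hq2 (by positivity) v
    exact sub_eq_zero.1 (abs_nonpos_iff.1 h4)
  set e : Space N := EuclideanSpace.single ⟨0, hN⟩ 1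
  have he : ‖e‖ = 1 := by simp [e]
  have hb : ∀ n : ℕ, |∫ x, inner ℝ (q x) (W x)|
      ≤ l2 ({x : Space N | (n : ℝ) ≤ ‖x‖}.indicator q) * l2 W
        + l2 q * l2 ({x : Space N | (n : ℝ) ≤ ‖x‖}.indicator W) := fun n => by
    have hms : MeasurableSet {x : Space N | (n : ℝ) ≤ ‖x‖} :=
      measurableSet_le measurable_const measurable_norm
    -- With `‖v‖ = 2 * n`, each `x` satisfies `n ≤ ‖x‖` or `n ≤ ‖x - v‖`, so in the translated
    -- pairing one factor is always an `L²` tail. A direction `e` exists because `0 < N`.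
    set v : Space N := (2 * (n : ℝ)) • e
    have hv : ‖v‖ = 2 * n := by
      rw [norm_smul, he, mul_one, Real.norm_of_nonneg (by positivity)]
    have hqi := hq2.indicator hms
    have hWi := hW2.indicator hms
    have t1 := memLp_translate hW2 v
    have t2 := memLp_translate hWi v
    have i1 := integrable_norm_mul_norm hqi t1.1
    have i2 := integrable_norm_mul_norm hq2 t2.1
    rw [← htrans v, ← Real.norm_eq_abs]
    refine (norm_integral_le_of_norm_le (i1.add i2) (ae_of_all _ fun x => ?_)).trans ?_
    · refine (norm_inner_le_norm _ _).trans ?_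
      simp only [Pi.add_apply]
      by_cases hx : (n : ℝ) ≤ ‖x‖
      · rw [indicator_of_mem (show x ∈ {x : Space N | (n : ℝ) ≤ ‖x‖} from hx)]
        exact le_add_of_nonneg_right (by positivity)
      · have hx' : (n : ℝ) ≤ ‖x - v‖ := by
          have := norm_sub_norm_le v x
          rw [norm_sub_rev] at this
          linarith
        rw [indicator_of_mem (show x - v ∈ {x : Space N | (n : ℝ) ≤ ‖x‖} from hx')]
        exact le_add_of_nonneg_left (by positivity)
    · rw [integral_add' i1 i2]
      refine add_le_add ?_ ?_
      · have := integral_norm_mul_norm_le hqi t1.1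
        rwa [t1.2] at this
      · have := integral_norm_mul_norm_le hq2 t2.1
        rwa [t2.2] at this
  have hz := ((tendsto_l2_tail hq2).mul_const (l2 W)).add ((tendsto_l2_tail hW2).const_mul (l2 q))
  rw [zero_mul, mul_zero, add_zero] at hz
  exact abs_nonpos_iff.1 (ge_of_tendsto' hz hb)

end PressureEstimates

end InhomEuler


namespace InhomEuler

open Filter Topology Metric
open scoped ENNReal NNReal

/-! ### Weak derivatives in time -/

section WeakDeriv

/-- `a'` is the weak derivative of `a` on `(0,T)`: `a` agrees almost everywhere with a primitive of
the locally integrable function `a'`. -/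
structure HasWeakDeriv (T : ℝ) (a a' : ℝ → ℝ) : Prop where
  intervalIntegrable : ∀ s ∈ Ioo 0 T, ∀ t ∈ Ioo 0 T, IntervalIntegrable a' volume s t
  ae_eq : ∃ c, ∀ᵐ t ∂(volume.restrict (Ioo 0 T)), a t = c + ∫ τ in (T / 2)..t, a' τ

/-- Smooth functions with compact support in `(0,T)`. -/
structure IsTimeTest (T : ℝ) (l : ℝ → ℝ) : Prop where
  smooth : ContDiff ℝ ∞ l
  compact : HasCompactSupport l
  support : tsupport l ⊆ Ioo 0 T

variable {T : ℝ} {a a' b b' l : ℝ → ℝ}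

lemma half_mem {s : ℝ} (hs : s ∈ Ioo 0 T) : T / 2 ∈ Ioo 0 T := by
  have := hs.1.trans hs.2
  constructor <;> linarith

lemma uIcc_subset_Ioo {s t : ℝ} (hs : s ∈ Ioo 0 T) (ht : t ∈ Ioo 0 T) : uIcc s t ⊆ Ioo 0 T :=
  (ordConnected_Ioo).uIcc_subset hs ht

lemma LocallyIntegrableOn.intervalIntegrable_of_mem (ha : LocallyIntegrableOn a (Ioo 0 T) volume)
    {s t : ℝ} (hs : s ∈ Ioo 0 T) (ht : t ∈ Ioo 0 T) : IntervalIntegrable a volume s t :=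
  intervalIntegrable_iff.2 ((ha.integrableOn_compact_subset (uIcc_subset_Ioo hs ht)
    isCompact_uIcc).mono_set uIoc_subset_uIcc)

lemma IsTimeTest.exists_Icc (hl : IsTimeTest T l) (hT : 0 < T) :
    ∃ s ∈ Ioo 0 T, ∃ t ∈ Ioo 0 T, s ≤ t ∧ ∀ x, x ∉ Ioo s t → l x = 0 ∧ deriv l x = 0 := by
  rcases (tsupport l).eq_empty_or_nonempty with h | h
  · refine ⟨T / 2, ⟨by linarith, by linarith⟩, T / 2, ⟨by linarith, by linarith⟩, le_rfl,
      fun x _ => ?_⟩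
    have hx : x ∉ tsupport l := by simp [h]
    exact ⟨image_eq_zero_of_notMem_tsupport hx,
      image_eq_zero_of_notMem_tsupport fun h' => hx (tsupport_deriv_subset h')⟩
  · have hc : IsCompact (tsupport l) := hl.compact
    obtain ⟨m, hm, hm'⟩ := hc.exists_isLeast h
    obtain ⟨M, hM, hM'⟩ := hc.exists_isGreatest h
    have h1 := hl.support hm
    have h2 := hl.support hM
    have h3 := hm' hM
    -- The endpoints are taken strictly between the support and the ends of `(0,T)`, so that `l`
    -- vanishes at `s` and `t` themselves and boundary terms drop out.
    refine ⟨m / 2, ⟨by linarith [h1.1], by linarith [h1.1, h1.2]⟩, (M + T) / 2,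
      ⟨by linarith [h2.1, h2.2], by linarith [h2.2]⟩, by linarith [h1.1, h2.2], fun x hx => ?_⟩
    have hx : x ∉ tsupport l := fun h => hx ⟨by linarith [hm' h, h1.1], by linarith [hM' h, h2.2]⟩
    exact ⟨image_eq_zero_of_notMem_tsupport hx,
      image_eq_zero_of_notMem_tsupport fun h' => hx (tsupport_deriv_subset h')⟩

lemma IsTimeTest.continuous (hl : IsTimeTest T l) : Continuous l := hl.smooth.continuous

lemma IsTimeTest.continuous_deriv (hl : IsTimeTest T l) : Continuous (deriv l) :=
  hl.smooth.continuous_deriv (by simp)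

lemma integral_eq_intervalIntegral {f : ℝ → ℝ} {s t : ℝ} (hst : s ≤ t)
    (hf : ∀ x, x ∉ Ioo s t → f x = 0) : ∫ x, f x = ∫ x in s..t, f x := by
  rw [intervalIntegral.integral_of_le hst]
  refine (setIntegral_eq_integral_of_forall_compl_eq_zero fun x hx => hf x fun h => hx ?_).symm
  exact ⟨h.1, h.2.le⟩

/-- The primitive of an integrable function is absolutely continuous with the expected
derivative. -/
lemma primitive_ac {k : ℝ → ℝ} {s t m : ℝ} (hk : ∀ s ∈ Ioo 0 T, ∀ t ∈ Ioo 0 T,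
      IntervalIntegrable k volume s t) (hs : s ∈ Ioo 0 T) (ht : t ∈ Ioo 0 T) (hm : m ∈ Ioo 0 T)
    (c : ℝ) :
    AbsolutelyContinuousOnInterval (fun x => c + ∫ τ in m..x, k τ) s t ∧
      ∀ᵐ x, x ∈ uIcc s t → HasDerivAt (fun x => c + ∫ τ in m..x, k τ) (k x) x := by
  have hmin : min m (min s t) ∈ Ioo 0 T := by simp only [mem_Ioo, lt_min_iff, min_lt_iff] at *; tauto
  have hmax : max m (max s t) ∈ Ioo 0 T := by simp only [mem_Ioo, max_lt_iff, lt_max_iff] at *; tauto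
  have hi := hk _ hmin _ hmax
  have hle : min m (min s t) ≤ max m (max s t) := (min_le_left _ _).trans (le_max_left _ _)
  have hmm : m ∈ uIcc (min m (min s t)) (max m (max s t)) := by
    rw [uIcc_of_le hle]; exact ⟨min_le_left _ _, le_max_left _ _⟩
  have hsub : uIcc s t ⊆ uIcc (min m (min s t)) (max m (max s t)) := by
    rw [uIcc_of_le hle]
    exact Icc_subset_Icc (min_le_right _ _) (le_max_right _ _)
  constructor
  · have h1 := (hi.absolutelyContinuousOnInterval_intervalIntegral hmm).mono hsub
    have h2 : AbsolutelyContinuousOnInterval (fun _ : ℝ => c) s t :=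
      (contDiff_const.contDiffOn).absolutelyContinuousOnInterval
    exact h2.add h1
  · filter_upwards [hi.ae_hasDerivAt_integral] with x hx hxs
    exact (hx (hsub hxs) m hmm).const_add c

/-- Integration by parts for the absolutely continuous representative, on an interval at whose
endpoints `l` vanishes. -/
lemma HasWeakDeriv.integral_eq (h : HasWeakDeriv T a a') (hT : 0 < T) (hl : IsTimeTest T l) :
    ∫ t, deriv l t * a t = - ∫ t, l t * a' t := by
  obtain ⟨s, hs, t, ht, hst, hz⟩ := hl.exists_Icc hT
  obtain ⟨c, hc⟩ := h.ae_eq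
  have hm := half_mem hs
  obtain ⟨hac, hd⟩ := primitive_ac h.intervalIntegrable hs ht hm c
  have hlac : AbsolutelyContinuousOnInterval l s t :=
    ((hl.smooth.of_le (by simp)).contDiffOn).absolutelyContinuousOnInterval
  rw [integral_eq_intervalIntegral hst fun x hx => by simp [(hz x hx).2],
    integral_eq_intervalIntegral hst fun x hx => by simp [(hz x hx).1]]
  have e1 : ∫ x in s..t, deriv l x * a x
      = ∫ x in s..t, deriv l x * (c + ∫ τ in (T / 2)..x, a' τ) := by
    refine intervalIntegral.integral_congr_ae ?_
    filter_upwards [(ae_restrict_iff' measurableSet_Ioo).1 hc] with x hx hxs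
    rw [hx (uIcc_subset_Ioo hs ht (uIoc_subset_uIcc hxs))]
  have e2 : ∫ x in s..t, l x * a' x
      = ∫ x in s..t, l x * deriv (fun x => c + ∫ τ in (T / 2)..x, a' τ) x := by
    refine intervalIntegral.integral_congr_ae ?_
    filter_upwards [hd] with x hx hxs
    rw [(hx (uIoc_subset_uIcc hxs)).deriv]
  rw [e1, e2, hlac.integral_mul_deriv_eq_deriv_mul hac, (hz s (by simp)).1, (hz t (by simp)).1]
  ring

/-- The product of the two absolutely continuous representatives is absolutely continuous, has the
expected derivative almost everywhere, and is the integral of it. -/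
lemma HasWeakDeriv.mul (ha : HasWeakDeriv T a a') (hb : HasWeakDeriv T b b') (hT : 0 < T) :
    HasWeakDeriv T (fun t => a t * b t) (fun t => a' t * b t + a t * b' t) := by
  obtain ⟨c, hc⟩ := ha.ae_eq
  obtain ⟨d, hd⟩ := hb.ae_eq
  have hm : T / 2 ∈ Ioo 0 T := ⟨by linarith, by linarith⟩
  set A := fun x => c + ∫ τ in (T / 2)..x, a' τ
  set B := fun x => d + ∫ τ in (T / 2)..x, b' τ
  rw [ae_restrict_iff' measurableSet_Ioo] at hc hd
  have key : ∀ s ∈ Ioo 0 T, ∀ t ∈ Ioo 0 T, ∀ᵐ x, x ∈ uIcc s t →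
      deriv (A * B) x = a' x * b x + a x * b' x := fun s hs t ht => by
    filter_upwards [(primitive_ac ha.intervalIntegrable hs ht hm c).2,
      (primitive_ac hb.intervalIntegrable hs ht hm d).2, hc, hd] with x h1 h2 h3 h4 hx
    rw [((h1 hx).mul (h2 hx)).deriv, h3 (uIcc_subset_Ioo hs ht hx), h4 (uIcc_subset_Ioo hs ht hx)]
  have hAC : ∀ s ∈ Ioo 0 T, ∀ t ∈ Ioo 0 T, AbsolutelyContinuousOnInterval (A * B) s t :=
    fun s hs t ht => (primitive_ac ha.intervalIntegrable hs ht hm c).1.mul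
      (primitive_ac hb.intervalIntegrable hs ht hm d).1
  refine ⟨fun s hs t ht => ?_, A (T / 2) * B (T / 2), ?_⟩
  · refine (hAC s hs t ht).intervalIntegrable_deriv.congr_ae ?_
    rw [EventuallyEq, ae_restrict_iff' measurableSet_uIoc]
    filter_upwards [key s hs t ht] with x hx hxs
    exact hx (uIoc_subset_uIcc hxs)
  · rw [ae_restrict_iff' measurableSet_Ioo]
    filter_upwards [hc, hd] with t h3 h4 ht
    have h5 := (hAC _ hm t ht).integral_deriv_eq_sub
    have h6 : ∫ x in (T / 2)..t, deriv (A * B) x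
        = ∫ x in (T / 2)..t, (a' x * b x + a x * b' x) := by
      refine intervalIntegral.integral_congr_ae ?_
      filter_upwards [key _ hm t ht] with x hx hxs
      exact hx (uIoc_subset_uIcc hxs)
    rw [← h6, h5, h3 ht, h4 ht]
    simp only [Pi.mul_apply, A, B]
    ring

/-- Locally integrable functions with a weak derivative in the sense of distributions. -/
lemma hasWeakDeriv_of_integral_eq (hT : 0 < T) (ha : LocallyIntegrableOn a (Ioo 0 T) volume)
    (ha' : LocallyIntegrableOn a' (Ioo 0 T) volume)
    (h : ∀ l, IsTimeTest T l → ∫ t, deriv l t * a t = - ∫ t, l t * a' t) : HasWeakDeriv T a a' := by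
  have hm : T / 2 ∈ Ioo 0 T := ⟨by linarith, by linarith⟩
  have hii : ∀ s ∈ Ioo 0 T, ∀ t ∈ Ioo 0 T, IntervalIntegrable a' volume s t :=
    fun s hs t ht => LocallyIntegrableOn.intervalIntegrable_of_mem ha' hs ht
  set A := fun x => (0 : ℝ) + ∫ τ in (T / 2)..x, a' τ with hA
  have hAw : HasWeakDeriv T A a' := ⟨hii, 0, ae_of_all _ fun t => rfl⟩
  have hAc : ContinuousOn A (Ioo 0 T) := by
    intro x hx
    have hx1 : x / 2 ∈ Ioo 0 T := ⟨by linarith [hx.1], by linarith [hx.1, hx.2]⟩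
    have hx2 : (x + T) / 2 ∈ Ioo 0 T := ⟨by linarith [hx.1, hx.2], by linarith [hx.2]⟩
    have := (primitive_ac hii hx1 hx2 hm 0).1.continuousOn
    refine (this.continuousAt ?_).continuousWithinAt
    rw [uIcc_of_le (by linarith [hx.1, hx.2])]
    exact Icc_mem_nhds (by linarith [hx.1]) (by linarith [hx.2])
  have hAl : LocallyIntegrableOn A (Ioo 0 T) volume :=
    hAc.locallyIntegrableOn measurableSet_Ioo
  have hint : ∀ {k : ℝ → ℝ}, LocallyIntegrableOn k (Ioo 0 T) volume → ∀ {f : ℝ → ℝ},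
      Continuous f → HasCompactSupport f → tsupport f ⊆ Ioo 0 T →
      Integrable (fun t => f t * k t) volume := fun {k} hk {f} hf hfc hfs => by
    have h1 : IntegrableOn (fun t => f t * k t) (tsupport f) volume :=
      (hk.integrableOn_compact_subset hfs hfc).continuousOn_mul hf.continuousOn hfc
    refine (integrableOn_iff_integrable_of_support_subset fun x hx => ?_).1 h1
    exact subset_tsupport _ fun h0 => hx (by simp [h0])
  set g := fun t => a t - A t with hg
  have hgl : LocallyIntegrableOn g (Ioo 0 T) volume := ha.sub hAl
  -- The difference `g` of `a` and the primitive `A` of `a'` has weak derivative zero; it remains to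
  -- see that it is constant.
  have hder : ∀ l, IsTimeTest T l → ∫ t, deriv l t * g t = 0 := fun l hl => by
    have hds : tsupport (deriv l) ⊆ Ioo 0 T := tsupport_deriv_subset.trans hl.support
    have e : ∀ t, deriv l t * g t = deriv l t * a t - deriv l t * A t := fun t => by
      simp only [hg]; ring
    simp_rw [e]
    rw [integral_sub (hint ha hl.continuous_deriv hl.compact.deriv hds)
      (hint hAl hl.continuous_deriv hl.compact.deriv hds), h l hl, hAw.integral_eq hT hl, sub_self]
  obtain ⟨f₀, hf₀s, hf₀c, hf₀d, hf₀r, hf₀1⟩ :=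
    exists_contDiff_tsupport_subset (n := ⊤) (isOpen_Ioo.mem_nhds hm)
  have hI : 0 < ∫ t, f₀ t := by
    refine hf₀d.continuous.integral_pos_of_hasCompactSupport_nonneg_nonzero hf₀c
      (fun x => (hf₀r (mem_range_self x)).1) (x := T / 2) (by rw [hf₀1]; exact one_ne_zero)
  set l₀ := fun t => (∫ t, f₀ t)⁻¹ * f₀ t with hl₀
  have hl₀t : IsTimeTest T l₀ :=
    ⟨contDiff_const.mul hf₀d, hf₀c.mul_left, (tsupport_mul_subset_right).trans hf₀s⟩
  have hl₀1 : ∫ t, l₀ t = 1 := by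
    rw [hl₀, integral_const_mul, inv_mul_cancel₀ hI.ne']
  set c := ∫ t, l₀ t * g t
  have hcl : LocallyIntegrableOn (fun t => g t - c) (Ioo 0 T) volume :=
    hgl.sub (locallyIntegrableOn_const c)
  -- Du Bois-Reymond: subtracting the multiple of `l₀` that makes the integral vanish, a test
  -- function `φ` becomes `k`, the derivative of a test function `L`. Hence `∫ k g = 0`, that is, `∫
  -- φ (g - c) = 0`.
  have hzero := isOpen_Ioo.ae_eq_zero_of_integral_contDiff_smul_eq_zero hcl
    fun φ hφ hφc hφs => by
      set k := fun t => φ t - (∫ t, φ t) * l₀ t with hk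
      have hφi : Integrable φ volume := hφ.continuous.integrable_of_hasCompactSupport hφc
      have hli : Integrable l₀ volume := hl₀t.continuous.integrable_of_hasCompactSupport hl₀t.compact
      have hkd : ContDiff ℝ ∞ k := hφ.sub (contDiff_const.mul hl₀t.smooth)
      have hkt : IsTimeTest T k := by
        refine ⟨hkd, hφc.sub (hl₀t.compact.mul_left), ?_⟩
        refine (tsupport_sub φ (fun t => (∫ t, φ t) * l₀ t)).trans (union_subset hφs ?_)
        exact (tsupport_mul_subset_right).trans hl₀t.support
      have hk0 : ∫ t, k t = 0 := by
        rw [hk, integral_sub hφi (hli.const_mul _), integral_const_mul, hl₀1, mul_one, sub_self]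
      obtain ⟨s, hs, t, ht, hst, hz⟩ := hkt.exists_Icc hT
      set L := fun x => ∫ τ in s..x, k τ with hL
      have hLd : ∀ x, HasDerivAt L (k x) x := fun x =>
        hkd.continuous.integral_hasStrictDerivAt s x |>.hasDerivAt
      have hLz : ∀ x, x ∉ Icc s t → L x = 0 := fun x hx => by
        by_cases hxs : x < s
        · refine intervalIntegral.integral_zero_ae (ae_of_all _ fun τ hτ => (hz τ fun h => ?_).1)
          rw [uIoc_of_ge hxs.le] at hτ
          exact absurd hτ.2 (not_le.2 h.1)
        · have hxt : t < x := not_le.1 fun h => hx ⟨not_lt.1 hxs, h⟩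
          rw [← hk0]
          refine (integral_eq_intervalIntegral (not_lt.1 hxs) fun τ hτ => (hz τ fun h => hτ ?_).1).symm
          exact ⟨h.1, h.2.trans hxt⟩
      have hts : tsupport L ⊆ Icc s t := closure_minimal (fun x hx => by
        by_contra h
        exact hx (hLz x h)) isClosed_Icc
      have hLt : IsTimeTest T L := by
        refine ⟨?_, isCompact_Icc.of_isClosed_subset (isClosed_tsupport L) hts,
          hts.trans fun x hx => ⟨hs.1.trans_le hx.1, hx.2.trans_lt ht.2⟩⟩
        rw [contDiff_infty_iff_deriv, funext fun x => (hLd x).deriv]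
        exact ⟨fun x => (hLd x).differentiableAt, hkd⟩
      have h1 := hder L hLt
      have h2 : deriv L = k := funext fun x => (hLd x).deriv
      rw [h2] at h1
      have e : ∀ t, k t * g t = φ t * g t - (∫ t, φ t) * (l₀ t * g t) := fun t => by
        simp only [hk]; ring
      simp_rw [e] at h1
      have i1 := hint hgl hφ.continuous hφc hφs
      have i2 := hint hgl hl₀t.continuous hl₀t.compact hl₀t.support
      rw [integral_sub i1 (i2.const_mul _), integral_const_mul] at h1
      simp_rw [smul_eq_mul, mul_sub]
      rw [integral_sub i1 (hφi.mul_const _), integral_mul_const]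
      exact h1
  refine ⟨hii, c, ?_⟩
  rw [ae_restrict_iff' measurableSet_Ioo]
  filter_upwards [hzero] with t ht hts
  have := ht hts
  simp only [hg, hA] at this
  linarith

end WeakDeriv

end InhomEuler


namespace InhomEuler

open Filter Topology Metric
open scoped ENNReal NNReal

/-! ### Strong convergence of operators on `L²` -/

section L2Limits

variable {N : ℕ} {F G : Type*} [NormedAddCommGroup F] [NormedAddCommGroup G]

lemma tendsto_l2_of_bounded_support {H : ℕ → Space N → F} {M R : ℝ}
    (hm : ∀ n, AEStronglyMeasurable (H n) volume) (hM : ∀ n x, ‖H n x‖ ≤ M)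
    (hR : ∀ n x, R < ‖x‖ → H n x = 0)
    (hlim : ∀ᵐ x, Tendsto (fun n => H n x) atTop (𝓝 0)) :
    Tendsto (fun n => l2 (H n)) atTop (𝓝 0) := by
  have hM0 : 0 ≤ M := (norm_nonneg _).trans (hM 0 0)
  have hb : ∀ n x, ‖H n x‖ ≤ (closedBall (0 : Space N) R).indicator (fun _ => M) x := fun n x => by
    by_cases hx : x ∈ closedBall (0 : Space N) R
    · rw [indicator_of_mem hx]; exact hM n x
    · rw [indicator_of_notMem hx, hR n x (by simpa using hx), norm_zero]
  have hi : MemLp ((closedBall (0 : Space N) R).indicator fun _ => M) 2 volume :=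
    memLp_indicator_const 2 measurableSet_closedBall _ (Or.inr measure_closedBall_lt_top.ne)
  have hmem : ∀ n, MemLp (H n) 2 volume := fun n =>
    hi.mono (hm n) (ae_of_all _ fun x => (hb n x).trans (le_abs_self _))
  have h1 : Tendsto (fun n => ∫ x, ‖H n x‖ ^ 2) atTop (𝓝 (∫ _ : Space N, (0 : ℝ))) := by
    refine tendsto_integral_of_dominated_convergence
      (fun x => ‖(closedBall (0 : Space N) R).indicator (fun _ => M) x‖ ^ 2)
      (fun n => ((hm n).norm.pow 2)) (integrable_norm_sq hi)
      (fun n => ae_of_all _ fun x => ?_) ?_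
    · rw [Real.norm_of_nonneg (by positivity)]
      exact pow_le_pow_left₀ (norm_nonneg _) ((hb n x).trans (le_abs_self _)) 2
    · filter_upwards [hlim] with x hx
      simpa using (hx.norm).pow 2
  rw [integral_zero] at h1
  have h2 : ∀ n, l2 (H n) = √(∫ x, ‖H n x‖ ^ 2) := fun n => by
    rw [← l2_sq (hmem n), Real.sqrt_sq (l2_nonneg _)]
  simp_rw [h2]
  simpa using h1.sqrt

/-- Strong convergence to zero of bounded linear operators follows from convergence on continuous
functions with compact support. -/
lemma tendsto_l2_of_dense [NormedSpace ℝ F] [NormedSpace ℝ G]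
    (E : ℕ → (Space N → F) → Space N → G) {C : ℝ} (hC : 0 ≤ C)
    (hmem : ∀ n f, MemLp f 2 volume → MemLp (E n f) 2 volume ∧ l2 (E n f) ≤ C * l2 f)
    (hadd : ∀ n f g, MemLp f 2 volume → MemLp g 2 volume →
      ∀ x, E n f x = E n g x + E n (f - g) x)
    (hcs : ∀ k, Continuous k → HasCompactSupport k → Tendsto (fun n => l2 (E n k)) atTop (𝓝 0))
    {f : Space N → F} (hf : MemLp f 2 volume) : Tendsto (fun n => l2 (E n f)) atTop (𝓝 0) := by
  rw [Metric.tendsto_atTop]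
  intro δ hδ
  obtain ⟨k, hkc, hkd, hk, hkm⟩ := hf.exists_hasCompactSupport_eLpNorm_sub_le (by simp)
    (ε := ENNReal.ofReal (δ / (2 * (C + 1)))) (by simp; positivity)
  have hfk : l2 (f - k) ≤ δ / (2 * (C + 1)) := by
    have := ENNReal.toReal_mono ENNReal.ofReal_ne_top hkd
    rwa [ENNReal.toReal_ofReal (by positivity)] at this
  obtain ⟨n₀, hn₀⟩ := Metric.tendsto_atTop.1 (hcs k hk hkc) (δ / 2) (by positivity)
  refine ⟨n₀, fun n hn => ?_⟩
  have h1 := hn₀ n hn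
  rw [dist_zero_right, Real.norm_of_nonneg (l2_nonneg _)] at h1 ⊢
  have h2 : E n f = E n k + E n (f - k) := funext fun x => hadd n f k hf hkm x
  have h3 := hmem n _ (hf.sub hkm)
  calc l2 (E n f) ≤ l2 (E n k) + l2 (E n (f - k)) := by
        rw [h2]; exact l2_add_le (hmem n k hkm).1 h3.1
    _ ≤ l2 (E n k) + C * (δ / (2 * (C + 1))) := by
        gcongr
        exact h3.2.trans (by gcongr)
    _ < δ / 2 + δ / 2 := by
        refine add_lt_add_of_lt_of_le h1 ?_
        rw [mul_div_assoc', div_le_div_iff₀ (by positivity) (by positivity)]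
        nlinarith
    _ = δ := by ring

variable [NormedSpace ℝ F] [CompleteSpace F]

/-- By uniform boundedness on `L²` it is enough to treat continuous functions with compact support,
where convergence holds almost everywhere within a fixed ball and with a fixed bound. -/
lemma tendsto_l2_kconv_sub {f : Space N → F} (hf : MemLp f 2 volume) :
    Tendsto (fun n => l2 fun x => kconv (moll (epsSeq n)) f x - f x) atTop (𝓝 0) := by
  have hcont : ∀ n {g : Space N → F}, LocallyIntegrable g volume →
      Continuous (kconv (moll (epsSeq n)) g) := fun n g hg =>
    (contDiff_kconv (moll_contDiff _) (moll_hasCompactSupport (epsSeq_pos n)) hg).continuous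
  refine tendsto_l2_of_dense (fun n f x => kconv (moll (epsSeq n)) f x - f x)
    (C := mollC N * ballVol N + 1) (by have := mollC_pos N; have := ballVol_pos N; positivity)
    (fun n f hf => ?_) (fun n f g hf hg x => ?_) (fun k hk hkc => ?_) hf
  · have h := l2_kconv_le (epsSeq_pos n) hf
    refine ⟨h.1.sub hf, (l2_sub_le h.1 hf).trans ?_⟩
    linarith [h.2]
  · have i1 := integrable_kconv (moll_contDiff _).continuous
      (moll_hasCompactSupport (epsSeq_pos n)) (hf.locallyIntegrable (by norm_num)) x
    have i2 := integrable_kconv (moll_contDiff _).continuous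
      (moll_hasCompactSupport (epsSeq_pos n)) (hg.locallyIntegrable (by norm_num)) x
    have : kconv (moll (epsSeq n)) (f - g) x
        = kconv (moll (epsSeq n)) f x - kconv (moll (epsSeq n)) g x := by
      unfold kconv
      rw [← integral_sub i1 i2]
      simp_rw [Pi.sub_apply, smul_sub]
    simp only [this, Pi.sub_apply]
    abel
  · obtain ⟨M, hM⟩ := hkc.exists_bound_of_continuous hk
    obtain ⟨R, hR⟩ := hkc.isCompact.isBounded.subset_closedBall (0 : Space N)
    have hkl : LocallyIntegrable k volume := hk.locallyIntegrable
    have hz : ∀ x, R < ‖x‖ → k x = 0 := fun x hx => image_eq_zero_of_notMem_tsupport fun h => by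
      have := hR h
      rw [mem_closedBall, dist_zero_right] at this
      linarith
    refine tendsto_l2_of_bounded_support (M := M + M) (R := R + 1)
      (fun n => ((hcont n hkl).sub hk).aestronglyMeasurable) (fun n x => ?_) (fun n x hx => ?_) ?_
    · exact (norm_sub_le _ _).trans (add_le_add
        (norm_kconv_moll_le (epsSeq_pos n) (ae_of_all _ hM) x) (hM x))
    · have : kconv (moll (epsSeq n)) k x = 0 := by
        refine integral_eq_zero_of_ae (ae_of_all _ fun y => ?_)
        rcases le_or_gt ‖y‖ R with hy | hy
        · simp only
          rw [moll_eq_zero (epsSeq_pos n), zero_smul]; rfl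
          have := norm_sub_norm_le x y
          have := epsSeq_le_one n
          linarith
        · simp [hz y hy]
      rw [this, hz x (by linarith), sub_zero]
    · filter_upwards [ae_tendsto_kconv_moll hkl] with x hx
      simpa using hx.sub_const (k x)

end L2Limits

/-! ### Weighted `L²` pairings and their limits -/

section L2Pairing

variable {N : ℕ} {H : Type*} [NormedAddCommGroup H] [InnerProductSpace ℝ H]

lemma integrable_mul_inner {a : Space N → ℝ} {f g : Space N → H} {M : ℝ}
    (hf : MemLp f 2 volume) (hg : MemLp g 2 volume) (ha : AEStronglyMeasurable a volume)
    (hM : ∀ᵐ x, |a x| ≤ M) : Integrable (fun x => a x * inner ℝ (f x) (g x)) volume := by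
  have hi : Integrable (fun x => (inner ℝ (f x) (g x) : ℝ)) volume := by
    refine (integrable_norm_mul_norm hf hg).mono (hf.1.inner hg.1) (ae_of_all _ fun x => ?_)
    rw [norm_mul, norm_norm, norm_norm]
    exact norm_inner_le_norm _ _
  exact hi.bdd_mul ha hM

lemma abs_integral_mul_inner_le {a : Space N → ℝ} {f g : Space N → H} {M : ℝ} (hM0 : 0 ≤ M)
    (hf : MemLp f 2 volume) (hg : MemLp g 2 volume)
    (hM : ∀ᵐ x, |a x| ≤ M) : |∫ x, a x * inner ℝ (f x) (g x)| ≤ M * (l2 f * l2 g) := by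
  calc |∫ x, a x * inner ℝ (f x) (g x)| ≤ ∫ x, M * (‖f x‖ * ‖g x‖) := by
        rw [← Real.norm_eq_abs]
        refine norm_integral_le_of_norm_le ((integrable_norm_mul_norm hf hg).const_mul M) ?_
        filter_upwards [hM] with x hx
        rw [norm_mul]
        exact mul_le_mul hx (norm_inner_le_norm _ _) (norm_nonneg _) hM0
    _ ≤ _ := by
        rw [integral_const_mul]
        exact mul_le_mul_of_nonneg_left (integral_norm_mul_norm_le hf hg) hM0

/-- Since the weights are uniformly bounded, `f n` and `g n` can be replaced by their strong `L²`
limits at vanishing cost. Then dominated convergence needs only almost everywhere convergence of the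
weights, which is what is available for the mollified density. -/
lemma tendsto_integral_mul_inner {a : ℕ → Space N → ℝ} {a₀ : Space N → ℝ} {f g : ℕ → Space N → H}
    {f₀ g₀ : Space N → H} {M : ℝ} (hM0 : 0 ≤ M)
    (ha : ∀ n, AEStronglyMeasurable (a n) volume)
    (hM : ∀ n, ∀ᵐ x, |a n x| ≤ M) (hlim : ∀ᵐ x, Tendsto (fun n => a n x) atTop (𝓝 (a₀ x)))
    (hf : ∀ n, MemLp (f n) 2 volume) (hg : ∀ n, MemLp (g n) 2 volume)
    (hf₀ : MemLp f₀ 2 volume) (hg₀ : MemLp g₀ 2 volume)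
    (hfl : Tendsto (fun n => l2 fun x => f n x - f₀ x) atTop (𝓝 0))
    (hgl : Tendsto (fun n => l2 fun x => g n x - g₀ x) atTop (𝓝 0)) :
    Tendsto (fun n => ∫ x, a n x * inner ℝ (f n x) (g n x)) atTop
      (𝓝 (∫ x, a₀ x * inner ℝ (f₀ x) (g₀ x))) := by
  have h0 : Tendsto (fun n => ∫ x, a n x * inner ℝ (f₀ x) (g₀ x)) atTop
      (𝓝 (∫ x, a₀ x * inner ℝ (f₀ x) (g₀ x))) := by
    refine tendsto_integral_of_dominated_convergence (fun x => M * (‖f₀ x‖ * ‖g₀ x‖))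
      (fun n => (ha n).mul (hf₀.1.inner hg₀.1)) ((integrable_norm_mul_norm hf₀ hg₀).const_mul M)
      (fun n => ?_) ?_
    · filter_upwards [hM n] with x hx
      rw [norm_mul]
      exact mul_le_mul hx (norm_inner_le_norm _ _) (norm_nonneg _) hM0
    · filter_upwards [hlim] with x hx
      exact hx.mul_const _
  have h1 : Tendsto (fun n => M * (l2 (fun x => f n x - f₀ x) *
      (l2 (fun x => g n x - g₀ x) + l2 g₀)) + M * (l2 f₀ * l2 (fun x => g n x - g₀ x))) atTop
      (𝓝 (M * (0 * (0 + l2 g₀)) + M * (l2 f₀ * 0))) :=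
    ((hfl.mul (hgl.add_const _)).const_mul M).add ((hgl.const_mul _).const_mul M)
  have h2 : Tendsto (fun n => (∫ x, a n x * inner ℝ (f n x) (g n x))
      - ∫ x, a n x * inner ℝ (f₀ x) (g₀ x)) atTop (𝓝 0) := by
    refine squeeze_zero_norm (fun n => ?_) (by simpa using h1)
    have e : ∀ x, a n x * inner ℝ (f n x) (g n x) - a n x * inner ℝ (f₀ x) (g₀ x)
        = a n x * inner ℝ (f n x - f₀ x) (g n x) + a n x * inner ℝ (f₀ x) (g n x - g₀ x) :=
      fun x => by rw [inner_sub_left, inner_sub_right]; ring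
    have hd : MemLp (fun x => f n x - f₀ x) 2 volume := (hf n).sub hf₀
    have hd' : MemLp (fun x => g n x - g₀ x) 2 volume := (hg n).sub hg₀
    rw [← integral_sub (integrable_mul_inner (hf n) (hg n) (ha n) (hM n))
      (integrable_mul_inner hf₀ hg₀ (ha n) (hM n))]
    simp_rw [e]
    rw [integral_add (integrable_mul_inner hd (hg n) (ha n) (hM n))
      (integrable_mul_inner hf₀ hd' (ha n) (hM n))]
    refine (norm_add_le _ _).trans (add_le_add ?_ ?_)
    · refine (abs_integral_mul_inner_le hM0 hd (hg n) (hM n)).trans ?_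
      have h3 : l2 (g n) ≤ l2 (fun x => g n x - g₀ x) + l2 g₀ := by
        refine le_of_eq_of_le (l2_congr (ae_of_all _ fun x => ?_)) (l2_add_le hd' hg₀)
        simp
      exact mul_le_mul_of_nonneg_left (mul_le_mul_of_nonneg_left h3 (l2_nonneg _)) hM0
    · exact abs_integral_mul_inner_le hM0 hf₀ hd' (hM n)
  simpa using h2.add h0

end L2Pairing

end InhomEuler


namespace InhomEuler

open Filter Topology Metric
open scoped ENNReal NNReal

/-! ### Commutators of mollification with transport -/

section Commutator

variable {N : ℕ} {F : Type*} [NormedAddCommGroup F] [NormedSpace ℝ F]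

/-- The mollification of `div (σ U)`. -/
noncomputable def transOp (ε : ℝ) (U : Space N → Space N) (σ : Space N → F) (x : Space N) : F :=
  ∫ y, fderiv ℝ (moll ε) (x - y) (U y) • σ y

/-- The commutator of mollification and transport by `U`. -/
noncomputable def commOp (ε : ℝ) (U : Space N → Space N) (σ : Space N → F) (x : Space N) : F :=
  ∫ y, fderiv ℝ (moll ε) (x - y) (U y - U x) • σ y

variable {ε : ℝ} {U : Space N → Space N} {σ : Space N → F} {K : ℝ≥0}

lemma continuous_fderiv_moll (ε : ℝ) : Continuous (fderiv ℝ (moll ε : Space N → ℝ)) :=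
  (moll_contDiff ε).continuous_fderiv (by simp)

lemma hasCompactSupport_fderiv_moll_sub (hε : 0 < ε) (V : Space N → Space N) (x : Space N) :
    HasCompactSupport fun y => fderiv ℝ (moll ε) (x - y) (V y) := by
  have h : HasCompactSupport fun y => fderiv ℝ (moll ε) (x - y) :=
    ((moll_hasCompactSupport hε).fderiv ℝ).comp_homeomorph (Homeomorph.subLeft x)
  refine h.mono fun y hy => ?_
  rw [Function.mem_support] at hy ⊢
  intro h0
  exact hy (by rw [h0]; rfl)

lemma integrable_fderiv_moll_smul (hε : 0 < ε) {V : Space N → Space N} (hV : Continuous V)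
    (hσ : LocallyIntegrable σ volume) (x : Space N) :
    Integrable (fun y => fderiv ℝ (moll ε) (x - y) (V y) • σ y) volume := by
  refine hσ.integrable_smul_left_of_hasCompactSupport
    (g := fun y => fderiv ℝ (moll ε) (x - y) (V y)) ?_ (hasCompactSupport_fderiv_moll_sub hε V x)
  exact ((continuous_fderiv_moll ε).comp (continuous_const.sub continuous_id)).clm_apply hV

/-- Splitting `U y = U x + (U y - U x)`: the frozen velocity `U x` differentiates the mollification
of `σ`, the increment gives the commutator. -/
lemma transOp_eq (hε : 0 < ε) (hU : Continuous U) (hσ : LocallyIntegrable σ volume)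
    [CompleteSpace F] (x : Space N) :
    transOp ε U σ x = fderiv ℝ (kconv (moll ε) σ) x (U x) + commOp ε U σ x := by
  rw [fderiv_kconv (moll_contDiff ε) (moll_hasCompactSupport hε) hσ, transOp, commOp,
    ← integral_add (integrable_fderiv_moll_smul hε (V := fun _ => U x) continuous_const hσ x)
      (integrable_fderiv_moll_smul hε (V := fun y => U y - U x) (hU.sub continuous_const) hσ x)]
  refine integral_congr_ae (ae_of_all _ fun y => ?_)
  simp only
  rw [← add_smul, ← map_add, add_sub_cancel]

/-- The Lipschitz bound on `U y - U x` supplies the factor `‖x - y‖` that tames the gradient of the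
mollifier; no derivative of `σ` is needed and the bound does not degenerate as `ε → 0`. -/
lemma norm_commOp_le (hε : 0 < ε) (hU : LipschitzWith K U) (hσ : LocallyIntegrable σ volume)
    (x : Space N) : ‖commOp ε U σ x‖ ≤ K * mollC N * ∫ y, ballKer ε (x - y) * ‖σ y‖ := by
  have hn : LocallyIntegrable (fun y => ‖σ y‖) volume := by
    simpa using locallyIntegrable_norm_sub hσ 0
  rw [← integral_const_mul]
  refine norm_integral_le_of_norm_le ((integrable_ballKer_mul hn ε x).const_mul _)
    (ae_of_all _ fun y => ?_)
  rw [norm_smul, ← mul_assoc]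
  gcongr
  calc ‖fderiv ℝ (moll ε) (x - y) (U y - U x)‖
      ≤ ‖fderiv ℝ (moll ε) (x - y)‖ * ‖U y - U x‖ := ContinuousLinearMap.le_opNorm _ _
    _ ≤ ‖fderiv ℝ (moll ε) (x - y)‖ * (K * ‖x - y‖) := by
        gcongr
        rw [← dist_eq_norm, ← dist_eq_norm, dist_comm]
        exact hU.dist_le_mul x y
    _ = K * (‖fderiv ℝ (moll ε) (x - y)‖ * ‖x - y‖) := by ring
    _ ≤ K * (mollC N * ballKer ε (x - y)) := 
        mul_le_mul_of_nonneg_left (fderiv_moll_le hε _) K.2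
    _ = _ := by ring

lemma fderiv_moll_sub (ε : ℝ) (x y v : Space N) :
    fderiv ℝ (fun y => moll ε (x - y)) y v = -fderiv ℝ (moll ε) (x - y) v := by
  have h1 : DifferentiableAt ℝ (moll ε : Space N → ℝ) (x - y) :=
    ((moll_contDiff ε).differentiable (by simp)).differentiableAt
  have h2 : HasFDerivAt (fun y : Space N => moll ε (x - y)) _ y :=
    h1.hasFDerivAt.comp y ((hasFDerivAt_id y).const_sub x)
  rw [h2.fderiv]
  simp

lemma moll_sub_locallyLipschitz (ε : ℝ) (x : Space N) :
    LocallyLipschitz fun y => moll ε (x - y) :=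
  (((moll_contDiff ε).comp (contDiff_const.sub contDiff_id)).of_le
    (by simp : (1 : WithTop ℕ∞) ≤ _)).locallyLipschitz (𝕂 := ℝ)

lemma moll_sub_hasCompactSupport (hε : 0 < ε) (x : Space N) :
    HasCompactSupport fun y => moll ε (x - y) :=
  (moll_hasCompactSupport hε).comp_homeomorph (Homeomorph.subLeft x)

lemma integral_fderiv_moll_eq_zero (hε : 0 < ε) (hU : LipDivFree U K) (x : Space N) :
    ∫ y, fderiv ℝ (moll ε) (x - y) (U y) = 0 := by
  have h := integral_fderiv_apply_eq_zero (moll_sub_locallyLipschitz ε x)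
    (moll_sub_hasCompactSupport hε x) hU
  simp_rw [fderiv_moll_sub, integral_neg, neg_eq_zero] at h
  exact h

/-- The kernel of the commutator has integral zero in `y`, because both `U` and the constant field
`U x` are divergence free. Subtracting `a = σ x` then makes the commutator vanish in the limit at
Lebesgue points. -/
lemma commOp_eq_sub [CompleteSpace F] (hε : 0 < ε) (hU : LipDivFree U K)
    (hσ : LocallyIntegrable σ volume)
    (x : Space N) (a : F) : commOp ε U σ x = commOp ε U (fun y => σ y - a) x := by
  have hc : ∀ {V : Space N → Space N}, Continuous V →
      Integrable (fun y => fderiv ℝ (moll ε) (x - y) (V y)) volume := fun {V} hV => by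
    have := integrable_fderiv_moll_smul hε hV (σ := fun _ => (1 : ℝ)) (locallyIntegrable_const _) x
    simpa using this
  have hV : Continuous fun y => U y - U x := hU.continuous.sub continuous_const
  have h0 : ∫ y, fderiv ℝ (moll ε) (x - y) (U y - U x) = 0 := by
    simp_rw [map_sub]
    rw [integral_sub (hc hU.continuous) (hc continuous_const), integral_fderiv_moll_eq_zero hε hU,
      integral_fderiv_moll_eq_zero hε (LipDivFree.const (U x)), sub_zero]
  unfold commOp
  simp_rw [smul_sub]
  rw [integral_sub (integrable_fderiv_moll_smul hε hV hσ x)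
    (integrable_fderiv_moll_smul hε hV (locallyIntegrable_const a) x), integral_smul_const, h0,
    zero_smul, sub_zero]

lemma norm_commOp_sub_le [CompleteSpace F] (hε : 0 < ε) (hU : LipDivFree U K)
    (hσ : LocallyIntegrable σ volume) (x : Space N) :
    ‖commOp ε U σ x‖ ≤ K * mollC N * ∫ y, ballKer ε (x - y) * ‖σ y - σ x‖ := by
  rw [commOp_eq_sub hε hU hσ x (σ x)]
  exact norm_commOp_le hε hU.lip (hσ.sub (locallyIntegrable_const _)) x

lemma ae_tendsto_commOp [CompleteSpace F] (hU : LipDivFree U K)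
    (hσ : LocallyIntegrable σ volume) :
    ∀ᵐ x, Tendsto (fun n => commOp (epsSeq n) U σ x) atTop (𝓝 0) := by
  filter_upwards [ae_tendsto_ballKer hσ] with x hx
  refine squeeze_zero_norm (fun n => norm_commOp_sub_le (epsSeq_pos n) hU hσ x) ?_
  simpa using hx.const_mul (K * mollC N)

lemma aestronglyMeasurable_commOp (hU : Continuous U) (hσ : LocallyIntegrable σ volume) :
    AEStronglyMeasurable (commOp ε U σ) volume := by
  have h1 : Continuous fun p : Space N × Space N => fderiv ℝ (moll ε) (p.1 - p.2) (U p.2 - U p.1) :=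
    ((continuous_fderiv_moll ε).comp (continuous_fst.sub continuous_snd)).clm_apply
      ((hU.comp continuous_snd).sub (hU.comp continuous_fst))
  have h2 : AEStronglyMeasurable (fun p : Space N × Space N =>
      fderiv ℝ (moll ε) (p.1 - p.2) (U p.2 - U p.1) • σ p.2) (volume.prod volume) :=
    h1.aestronglyMeasurable.smul hσ.aestronglyMeasurable.comp_snd
  exact h2.integral_prod_right'

lemma integral_ballKer_sub (hε : 0 < ε) (x : Space N) :
    ∫ y, ballKer ε (x - y) = ballVol N := by
  rw [integral_sub_left_eq_self (fun y => ballKer ε y) volume x,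
    integral_eq_lintegral_of_nonneg_ae (ae_of_all _ (ballKer_nonneg hε))
      (measurable_ballKer ε).aestronglyMeasurable, lintegral_ballKer hε]
  rfl

lemma norm_commOp_le_of_bounded (hε : 0 < ε) (hU : LipschitzWith K U)
    (hσ : LocallyIntegrable σ volume) {M : ℝ} (hM : ∀ᵐ x, ‖σ x‖ ≤ M) (x : Space N) :
    ‖commOp ε U σ x‖ ≤ K * mollC N * (ballVol N * M) := by
  refine (norm_commOp_le hε hU hσ x).trans (mul_le_mul_of_nonneg_left ?_
    (mul_nonneg K.2 (mollC_pos N).le))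
  have hn : LocallyIntegrable (fun y => ‖σ y‖) volume := by
    simpa using locallyIntegrable_norm_sub hσ 0
  rw [← integral_ballKer_sub hε x, ← integral_mul_const]
  refine integral_mono_ae (integrable_ballKer_mul hn ε x)
    (integrable_ballKer_mul (locallyIntegrable_const M) ε x) ?_
  filter_upwards [hM] with y hy
  exact mul_le_mul_of_nonneg_left hy (ballKer_nonneg hε _)

lemma l2_commOp_le (hε : 0 < ε) (hU : LipschitzWith K U) (hσ : MemLp σ 2 volume) :
    MemLp (commOp ε U σ) 2 volume ∧
      l2 (commOp ε U σ) ≤ K * mollC N * ballVol N * l2 σ := by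
  have hl := hσ.locallyIntegrable (by norm_num)
  exact l2_le_of_le_ballKer hε (mul_nonneg K.2 (mollC_pos N).le) hσ
    (aestronglyMeasurable_commOp hU.continuous hl) (ae_of_all _ fun x => norm_commOp_le hε hU hl x)

/-- The `L²` bound is uniform in the scale, so continuous functions with compact support suffice;
for these the commutators are bounded, supported in one ball, and converge almost everywhere. -/
lemma tendsto_l2_commOp [CompleteSpace F] (hU : LipDivFree U K) (hσ : MemLp σ 2 volume) :
    Tendsto (fun n => l2 (commOp (epsSeq n) U σ)) atTop (𝓝 0) := by
  refine tendsto_l2_of_dense (fun n σ => commOp (epsSeq n) U σ) (C := K * mollC N * ballVol N)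
    (mul_nonneg (mul_nonneg K.2 (mollC_pos N).le) (ballVol_pos N).le)
    (fun n f hf => l2_commOp_le (epsSeq_pos n) hU.lip hf) (fun n f g hf hg x => ?_)
    (fun k hk hkc => ?_) hσ
  · have hV : Continuous fun y => U y - U x := hU.continuous.sub continuous_const
    have h1 := hg.locallyIntegrable (μ := (volume : Measure (Space N))) (by norm_num)
    have h2 := (hf.sub hg).locallyIntegrable (μ := (volume : Measure (Space N))) (by norm_num)
    unfold commOp
    rw [← integral_add (integrable_fderiv_moll_smul (epsSeq_pos n) hV h1 x)
      (integrable_fderiv_moll_smul (epsSeq_pos n) hV h2 x)]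
    simp_rw [← smul_add, Pi.sub_apply, add_sub_cancel]
  · obtain ⟨M, hM⟩ := hkc.exists_bound_of_continuous hk
    obtain ⟨R, hR⟩ := hkc.isCompact.isBounded.subset_closedBall (0 : Space N)
    have hkl : LocallyIntegrable k volume := hk.locallyIntegrable
    have hz : ∀ x, R < ‖x‖ → k x = 0 := fun x hx => image_eq_zero_of_notMem_tsupport fun h => by
      have := hR h
      rw [mem_closedBall, dist_zero_right] at this
      linarith
    refine tendsto_l2_of_bounded_support (R := R + 1)
      (fun n => aestronglyMeasurable_commOp hU.continuous hkl)
      (fun n x => norm_commOp_le_of_bounded (epsSeq_pos n) hU.lip hkl (ae_of_all _ hM) x)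
      (fun n x hx => ?_) (ae_tendsto_commOp hU hkl)
    rw [← norm_le_zero_iff]
    refine (norm_commOp_le (epsSeq_pos n) hU.lip hkl x).trans_eq ?_
    rw [integral_eq_zero_of_ae, mul_zero]
    refine ae_of_all _ fun y => ?_
    rcases le_or_gt ‖y‖ R with hy | hy
    · simp only
      rw [ballKer_of_lt, zero_mul]; rfl
      have := norm_sub_norm_le x y
      have := epsSeq_le_one n
      linarith
    · simp [hz y hy]

/-- For Lipschitz functions the mollified transport term is the mollification of `U · ∇σ`. -/
lemma transOp_of_lipschitz {H : Type*} [NormedAddCommGroup H] [InnerProductSpace ℝ H]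
    [FiniteDimensional ℝ H] (hε : 0 < ε) (hU : LipDivFree U K) {σ : Space N → H} {L : ℝ≥0}
    (hσ : LipschitzWith L σ) (x : Space N) :
    transOp ε U σ x = kconv (moll ε) (fun y => fderiv ℝ σ y (U y)) x := by
  have := FiniteDimensional.complete ℝ H
  have hσl : LocallyIntegrable σ volume := hσ.continuous.locallyIntegrable
  have hgl : LocallyIntegrable (fun y => fderiv ℝ σ y (U y)) volume := by
    refine LocallyIntegrable.mono (f := fun y => (L : ℝ) * ‖U y‖)
      (continuous_const.mul hU.continuous.norm).locallyIntegrable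
      (aestronglyMeasurable_fderiv_apply σ hU.continuous) (ae_of_all _ fun y => ?_)
    rw [Real.norm_of_nonneg (by positivity)]
    exact (ContinuousLinearMap.le_opNorm _ _).trans
      (mul_le_mul_of_nonneg_right (norm_fderiv_le_of_lip hσ y) (norm_nonneg _))
  have i1 := integrable_fderiv_moll_smul hε hU.continuous hσl x
  have i2 := integrable_kconv (moll_contDiff ε).continuous (moll_hasCompactSupport hε) hgl x
  refine ext_inner_left ℝ fun v => ?_
  unfold transOp kconv
  rw [← integral_inner i1 v, ← integral_inner i2 v, ← sub_eq_zero,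
    ← integral_sub (i1.const_inner v) (i2.const_inner v)]
  -- The function to be integrated along the divergence-free `U` is the mollifier times a component
  -- of `σ`; its product rule moves the derivative from one factor to the other.
  have ha : LocallyLipschitz fun y => moll ε (x - y) * inner ℝ v (σ y) :=
    LocallyLipschitz.mul_real (moll_sub_locallyLipschitz ε x)
      (LocallyLipschitz.inner_real (LocallyLipschitz.const v) hσ.locallyLipschitz)
  have hac : HasCompactSupport fun y => moll ε (x - y) * inner ℝ v (σ y) :=
    (moll_sub_hasCompactSupport hε x).mul_right
  rw [← neg_eq_zero, ← integral_neg, ← integral_fderiv_apply_eq_zero ha hac hU]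
  refine integral_congr_ae ?_
  filter_upwards [hσ.ae_differentiableAt] with y hy
  have hm : DifferentiableAt ℝ (fun y : Space N => moll ε (x - y)) y :=
    (((moll_contDiff ε).comp (contDiff_const.sub contDiff_id)).differentiable
      (by simp)).differentiableAt
  have hi : DifferentiableAt ℝ (fun y => (inner ℝ v (σ y) : ℝ)) y := (differentiableAt_const v).inner ℝ hy
  have h1 : fderiv ℝ (fun y => (inner ℝ v (σ y) : ℝ)) y (U y) = inner ℝ v (fderiv ℝ σ y (U y)) := by
    rw [fderiv_inner_apply ℝ (differentiableAt_const v) hy]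
    simp
  have h2 := fderiv_fun_mul hm hi
  rw [h2]
  simp only [add_apply, smul_apply, smul_eq_mul, h1, fderiv_moll_sub, inner_smul_right]
  ring

end Commutator

end InhomEuler


namespace InhomEuler

open Filter Topology Metric
open scoped ENNReal NNReal

/-! ### The mollified energy at a fixed time -/

section StaticEnergy

variable {N : ℕ} {H : Type*} [NormedAddCommGroup H] [InnerProductSpace ℝ H]
  [FiniteDimensional ℝ H]

/-- The truncated and mollified rate of change of `∫ ρ |w|²` when `ρ` is transported by `U` and
`∂ₜ w + U · ∇w = G`. -/
noncomputable def energyRate (ε R : ℝ) (U : Space N → Space N) (ρ : Space N → ℝ)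
    (w G : Space N → H) : ℝ :=
  ∫ x, cut R x * (-transOp ε U ρ x * ‖kconv (moll ε) w x‖ ^ 2 +
    2 * kconv (moll ε) ρ x *
      inner ℝ (kconv (moll ε) w x) (kconv (moll ε) G x - transOp ε U w x))

variable {U : Space N → Space N} {K : ℝ≥0} {ρ : Space N → ℝ} {w G : Space N → H} {M : ℝ}

lemma abs_fderiv_cut_apply_le (hU : LipDivFree U K) {R : ℝ} (hR : 0 < R) (x : Space N) :
    |fderiv ℝ (cut R) x (U x)| ≤ cutC N * (‖U 0‖ / R + 2 * K) :=
  ((fderiv ℝ (cut R) x).le_opNorm _).trans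
    (norm_fderiv_cut_mul_le hR K.2 (norm_nonneg _) hU.norm_le x)

lemma integral_linear_comb {a b c d e : Space N → ℝ} (ha : Integrable a volume)
    (hb : Integrable b volume) (hc : Integrable c volume) (hd : Integrable d volume)
    (he : Integrable e volume) :
    ∫ x, (a x - b x + 2 * c x - 2 * d x - e x)
      = (∫ x, a x) - (∫ x, b x) + 2 * (∫ x, c x) - 2 * (∫ x, d x) - ∫ x, e x := by
  have j1 : Integrable (fun x => a x - b x) volume := ha.sub hb
  have j2 : Integrable (fun x => a x - b x + 2 * c x) volume := j1.add (hc.const_mul 2)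
  have j3 : Integrable (fun x => a x - b x + 2 * c x - 2 * d x) volume := j2.sub (hd.const_mul 2)
  rw [integral_sub j3 he, integral_sub j2 (hd.const_mul 2), integral_add j1 (hc.const_mul 2),
    integral_sub ha hb, integral_const_mul, integral_const_mul]

/-- The transport terms without commutators are the derivative along `U` of `m |z|²`, with `m` and
`z` the mollified density and field. Multiplied by the cutoff they integrate to zero up to the term
in which the cutoff is differentiated. There remain that term, the two commutators, and the source.
-/
lemma energyRate_eq (hU : LipDivFree U K) (hρ : LocallyIntegrable ρ volume)
    (hM : ∀ᵐ x, ‖ρ x‖ ≤ M) (hw : MemLp w 2 volume) (hG : MemLp G 2 volume) {ε R : ℝ} (hε : 0 < ε)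
    (hR : 0 < R) :
    energyRate ε R U ρ w G =
      (∫ x, (kconv (moll ε) ρ x * fderiv ℝ (cut R) x (U x)) *
        inner ℝ (kconv (moll ε) w x) (kconv (moll ε) w x))
      - (∫ x, (cut R x * commOp ε U ρ x) *
        inner ℝ (kconv (moll ε) w x) (kconv (moll ε) w x))
      + 2 * (∫ x, (cut R x * kconv (moll ε) ρ x) *
        inner ℝ (kconv (moll ε) w x) (kconv (moll ε) G x))
      - 2 * (∫ x, (cut R x * kconv (moll ε) ρ x) *
        inner ℝ (kconv (moll ε) w x) (commOp ε U w x)) := by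
  have := FiniteDimensional.complete ℝ H
  have hwl := hw.locallyIntegrable (by norm_num)
  have hη := moll_contDiff (N := N) ε
  have hηc := moll_hasCompactSupport (N := N) hε
  set m := kconv (moll ε) ρ
  set z := kconv (moll ε) w
  have hm : ContDiff ℝ ∞ m := contDiff_kconv hη hηc hρ
  have hω : ContDiff ℝ ∞ z := contDiff_kconv hη hηc hwl
  have hωm : MemLp z 2 volume := (l2_kconv_le hε hw).1
  have hGm : MemLp (kconv (moll ε) G) 2 volume := (l2_kconv_le hε hG).1
  have hcm : MemLp (commOp ε U w) 2 volume := (l2_commOp_le hε hU.lip hw).1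
  have hmb : ∀ x, |m x| ≤ M := norm_kconv_moll_le hε hM
  have hM0 : 0 ≤ M := (abs_nonneg _).trans (hmb 0)
  have hc1 : ∀ x : Space N, |cut R x| ≤ 1 := fun x => by
    rw [abs_of_nonneg (cut_nonneg R x)]; exact cut_le_one R x
  have hcs := (cut_contDiff (N := N) R)
  have i1 : Integrable (fun x => (m x * fderiv ℝ (cut R) x (U x)) *
      inner ℝ (z x) (z x)) volume := by
    refine integrable_mul_inner (M := M * (cutC N * (‖U 0‖ / R + 2 * K))) hωm hωm
      (hm.continuous.aestronglyMeasurable.mul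
        (aestronglyMeasurable_fderiv_apply _ hU.continuous)) (ae_of_all _ fun x => ?_)
    rw [abs_mul]
    exact mul_le_mul (hmb x) (abs_fderiv_cut_apply_le hU hR x) (abs_nonneg _) hM0
  have i2 : Integrable (fun x => (cut R x * commOp ε U ρ x) * inner ℝ (z x) (z x)) volume := by
    refine integrable_mul_inner (M := 1 * (K * mollC N * (ballVol N * M))) hωm hωm
      (hcs.continuous.aestronglyMeasurable.mul (aestronglyMeasurable_commOp hU.continuous hρ))
      (ae_of_all _ fun x => ?_)
    rw [abs_mul]
    exact mul_le_mul (hc1 x) (norm_commOp_le_of_bounded hε hU.lip hρ hM x) (abs_nonneg _)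
      zero_le_one
  have hcm1 : ∀ x, |cut R x * m x| ≤ 1 * M := fun x => by
    rw [abs_mul]; exact mul_le_mul (hc1 x) (hmb x) (abs_nonneg _) zero_le_one
  have i3 : Integrable (fun x => (cut R x * m x) * inner ℝ (z x) (kconv (moll ε) G x)) volume :=
    integrable_mul_inner hωm hGm (hcs.continuous.mul hm.continuous).aestronglyMeasurable
      (ae_of_all _ hcm1)
  have i4 : Integrable (fun x => (cut R x * m x) * inner ℝ (z x) (commOp ε U w x)) volume :=
    integrable_mul_inner hωm hcm (hcs.continuous.mul hm.continuous).aestronglyMeasurable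
      (ae_of_all _ hcm1)
  have had : ContDiff ℝ ∞ fun x => cut R x * (m x * inner ℝ (z x) (z x)) :=
    hcs.mul (hm.mul (hω.inner ℝ hω))
  have hal : LocallyLipschitz fun x => cut R x * (m x * inner ℝ (z x) (z x)) :=
    (had.of_le (by simp : (1 : WithTop ℕ∞) ≤ _)).locallyLipschitz (𝕂 := ℝ)
  have hac : HasCompactSupport fun x => cut R x * (m x * inner ℝ (z x) (z x)) :=
    (cut_hasCompactSupport hR).mul_right
  have h0 := integral_fderiv_apply_eq_zero hal hac hU
  have i0 := integrable_fderiv_apply hal hac hU.continuous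
  have hdf : ∀ x v, fderiv ℝ (fun x => cut R x * (m x * inner ℝ (z x) (z x))) x v
      = fderiv ℝ (cut R) x v * (m x * inner ℝ (z x) (z x))
        + cut R x * (fderiv ℝ m x v * inner ℝ (z x) (z x)
        + m x * (2 * inner ℝ (z x) (fderiv ℝ z x v))) := fun x v => by
    have d1 : DifferentiableAt ℝ (cut R) x := (hcs.differentiable (by simp)).differentiableAt
    have d2 : DifferentiableAt ℝ m x := (hm.differentiable (by simp)).differentiableAt
    have d3 : DifferentiableAt ℝ z x := (hω.differentiable (by simp)).differentiableAt
    have d4 : DifferentiableAt ℝ (fun x => (inner ℝ (z x) (z x) : ℝ)) x := d3.inner ℝ d3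
    rw [fderiv_fun_mul d1 (d2.fun_mul d4), fderiv_fun_mul d2 d4]
    simp only [add_apply, smul_apply, smul_eq_mul, fderiv_inner_apply ℝ d3 d3]
    rw [real_inner_comm (z x) (fderiv ℝ z x v)]
    ring
  have key : ∀ x, cut R x * (-transOp ε U ρ x * ‖z x‖ ^ 2 +
      2 * m x * inner ℝ (z x) (kconv (moll ε) G x - transOp ε U w x))
      = (m x * fderiv ℝ (cut R) x (U x)) * inner ℝ (z x) (z x)
      - (cut R x * commOp ε U ρ x) * inner ℝ (z x) (z x)
      + 2 * ((cut R x * m x) * inner ℝ (z x) (kconv (moll ε) G x))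
      - 2 * ((cut R x * m x) * inner ℝ (z x) (commOp ε U w x))
      - fderiv ℝ (fun x => cut R x * (m x * inner ℝ (z x) (z x))) x (U x) := fun x => by
    rw [hdf, transOp_eq hε hU.continuous hρ, transOp_eq hε hU.continuous hwl,
      ← real_inner_self_eq_norm_sq, inner_sub_right, inner_add_right]
    ring
  refine (integral_congr_ae (ae_of_all _ key)).trans ?_
  rw [integral_linear_comb i1 i2 i3 i4 i0, h0, sub_zero]

/-- The constant in the uniform bound for `energyRate`. -/
noncomputable def energyC (N : ℕ) : ℝ :=
  (mollC N * ballVol N) ^ 2 * (2 * cutC N + mollC N * ballVol N + 2)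
    + 2 * (mollC N * ballVol N) ^ 2

lemma energyC_nonneg (N : ℕ) : 0 ≤ energyC N := by
  have := mollC_pos N
  have := ballVol_pos N
  have := cutC_pos N
  unfold energyC
  positivity

/-- The bound is independent of `ε` and of `R ≥ 1`; it is the majorant for dominated convergence in
time. It involves `U` only through `‖U 0‖` and `K`, since on the support of the gradient of the
cutoff linear growth is offset by `1 / R`. -/
lemma abs_energyRate_le (hU : LipDivFree U K) (hρ : LocallyIntegrable ρ volume)
    (hM : ∀ᵐ x, ‖ρ x‖ ≤ M) (hw : MemLp w 2 volume) (hG : MemLp G 2 volume) {ε R : ℝ} (hε : 0 < ε)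
    (hR : 1 ≤ R) :
    |energyRate ε R U ρ w G| ≤ energyC N * M * (((‖U 0‖ + K) * l2 w + l2 G) * l2 w) := by
  have := FiniteDimensional.complete ℝ H
  have hR0 : 0 < R := one_pos.trans_le hR
  have hωm := l2_kconv_le hε hw
  have hGm := l2_kconv_le hε hG
  have hcm := l2_commOp_le hε hU.lip hw
  have hmb : ∀ x, |kconv (moll ε) ρ x| ≤ M := norm_kconv_moll_le hε hM
  have hM0 : 0 ≤ M := (abs_nonneg _).trans (hmb 0)
  have hc1 : ∀ x : Space N, |cut R x| ≤ 1 := fun x => by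
    rw [abs_of_nonneg (cut_nonneg R x)]; exact cut_le_one R x
  have hcm1 : ∀ x, |cut R x * kconv (moll ε) ρ x| ≤ M := fun x => by
    rw [abs_mul, ← one_mul M]; exact mul_le_mul (hc1 x) (hmb x) (abs_nonneg _) zero_le_one
  have hm0 := (mollC_pos N).le
  have hb0 := (ballVol_pos N).le
  have hk0 := (cutC_pos N).le
  have hK : (0 : ℝ) ≤ K := K.2
  set A := mollC N * ballVol N with hA
  have hA0 : 0 ≤ A := mul_nonneg hm0 hb0
  have hlw := l2_nonneg w
  have hlG := l2_nonneg G
  have b1 := abs_integral_mul_inner_le (a := fun x => kconv (moll ε) ρ x * fderiv ℝ (cut R) x (U x))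
    (M := M * (cutC N * (‖U 0‖ + 2 * K))) (by positivity) hωm.1 hωm.1 (ae_of_all _ fun x => by
      rw [abs_mul]
      refine mul_le_mul (hmb x) ((abs_fderiv_cut_apply_le hU hR0 x).trans ?_) (abs_nonneg _) hM0
      gcongr
      exact div_le_self (norm_nonneg _) hR)
  have b2 := abs_integral_mul_inner_le (a := fun x => cut R x * commOp ε U ρ x)
    (M := 1 * (K * mollC N * (ballVol N * M))) (by positivity) hωm.1 hωm.1 (ae_of_all _ fun x => by
      rw [abs_mul]
      exact mul_le_mul (hc1 x) (norm_commOp_le_of_bounded hε hU.lip hρ hM x) (abs_nonneg _)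
        zero_le_one)
  have b3 := abs_integral_mul_inner_le hM0 hωm.1 hGm.1 (ae_of_all _ hcm1)
  have b4 := abs_integral_mul_inner_le hM0 hωm.1 hcm.1 (ae_of_all _ hcm1)
  have e1 : l2 (kconv (moll ε) w) * l2 (kconv (moll ε) w) ≤ (A * l2 w) * (A * l2 w) :=
    mul_le_mul hωm.2 hωm.2 (l2_nonneg _) (by positivity)
  have e3 : l2 (kconv (moll ε) w) * l2 (kconv (moll ε) G) ≤ (A * l2 w) * (A * l2 G) :=
    mul_le_mul hωm.2 hGm.2 (l2_nonneg _) (by positivity)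
  have e4 : l2 (kconv (moll ε) w) * l2 (commOp ε U w)
      ≤ (A * l2 w) * (K * mollC N * ballVol N * l2 w) :=
    mul_le_mul hωm.2 hcm.2 (l2_nonneg _) (by positivity)
  have c1 := b1.trans (mul_le_mul_of_nonneg_left e1 (by positivity))
  have c2 := b2.trans (mul_le_mul_of_nonneg_left e1 (by positivity))
  have c3 := b3.trans (mul_le_mul_of_nonneg_left e3 hM0)
  have c4 := b4.trans (mul_le_mul_of_nonneg_left e4 hM0)
  rw [energyRate_eq hU hρ hM hw hG hε hR0]
  have hfin : M * (cutC N * (‖U 0‖ + 2 * K)) * (A * l2 w * (A * l2 w))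
      + 1 * (K * mollC N * (ballVol N * M)) * (A * l2 w * (A * l2 w))
      + 2 * (M * (A * l2 w * (A * l2 G)))
      + 2 * (M * (A * l2 w * (K * mollC N * ballVol N * l2 w)))
      ≤ energyC N * M * (((‖U 0‖ + K) * l2 w + l2 G) * l2 w) := by
    have hE : energyC N = A ^ 2 * (2 * cutC N + A + 2) + 2 * A ^ 2 := rfl
    have hK' : K * mollC N * ballVol N = K * A := by rw [hA]; ring
    have hK'' : K * mollC N * (ballVol N * M) = K * A * M := by rw [hA]; ring
    rw [hE, hK', hK'', ← sub_nonneg]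
    -- The slack in the chosen constant is a sum of products of nonnegative quantities.
    have : (A ^ 2 * (2 * cutC N + A + 2) + 2 * A ^ 2) * M *
          (((‖U 0‖ + K) * l2 w + l2 G) * l2 w)
        - (M * (cutC N * (‖U 0‖ + 2 * K)) * (A * l2 w * (A * l2 w))
          + 1 * (K * A * M) * (A * l2 w * (A * l2 w))
          + 2 * (M * (A * l2 w * (A * l2 G)))
          + 2 * (M * (A * l2 w * (K * A * l2 w))))
        = M * A ^ 2 * l2 w * (‖U 0‖ * l2 w * (cutC N + A + 4) + 2 * K * l2 w
          + l2 G * (2 * cutC N + A + 2)) := by ring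
    rw [this]
    positivity
  refine le_trans ?_ hfin
  rw [abs_le] at c1 c2 c3 c4 ⊢
  constructor <;> linarith [c1.1, c1.2, c2.1, c2.2, c3.1, c3.2, c4.1, c4.2]

lemma tendsto_cut_mul_kconv (hρ : LocallyIntegrable ρ volume) : ∀ᵐ x, Tendsto
    (fun n : ℕ => cut ((n : ℝ) + 1) x * kconv (moll (epsSeq n)) ρ x) atTop (𝓝 (ρ x)) := by
  filter_upwards [ae_tendsto_kconv_moll hρ] with x hx
  simpa using (tendsto_cut x).mul hx

lemma tendsto_fderiv_cut (x v : Space N) :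
    Tendsto (fun n : ℕ => fderiv ℝ (cut ((n : ℝ) + 1)) x v) atTop (𝓝 0) := by
  refine tendsto_const_nhds.congr' ?_
  filter_upwards [eventually_ge_atTop ⌈‖x‖⌉₊] with n hn
  rw [fderiv_cut_eq_zero_of_gt (by positivity)]
  · rfl
  · have := Nat.ceil_le.1 hn
    linarith

/-- Of the four terms of `energyRate_eq` only the source survives: the weights with the gradient of
the cutoff and with the density commutator tend to zero almost everywhere while staying bounded, and
the commutator with `w` tends to zero in `L²`. -/
lemma tendsto_energyRate (hU : LipDivFree U K) (hρ : LocallyIntegrable ρ volume)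
    (hM : ∀ᵐ x, ‖ρ x‖ ≤ M) (hw : MemLp w 2 volume) (hG : MemLp G 2 volume) :
    Tendsto (fun n : ℕ => energyRate (epsSeq n) ((n : ℝ) + 1) U ρ w G) atTop
      (𝓝 (2 * ∫ x, ρ x * inner ℝ (w x) (G x))) := by
  have := FiniteDimensional.complete ℝ H
  have hRp : ∀ n : ℕ, (0 : ℝ) < n + 1 := fun n => by positivity
  have hR1 : ∀ n : ℕ, (1 : ℝ) ≤ n + 1 := fun n => by
    have : (0 : ℝ) ≤ n := by positivity
    linarith
  simp_rw [fun n : ℕ => energyRate_eq hU hρ hM hw hG (epsSeq_pos n) (hRp n)]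
  have hωm := fun n => l2_kconv_le (epsSeq_pos n) hw
  have hGm := fun n => l2_kconv_le (epsSeq_pos n) hG
  have hcm := fun n => l2_commOp_le (epsSeq_pos n) hU.lip hw
  have hmb : ∀ n x, |kconv (moll (epsSeq n)) ρ x| ≤ M :=
    fun n => norm_kconv_moll_le (epsSeq_pos n) hM
  have hM0 : 0 ≤ M := (abs_nonneg _).trans (hmb 0 0)
  have hm0 := (mollC_pos N).le
  have hb0 := (ballVol_pos N).le
  have hk0 := (cutC_pos N).le
  have hK : (0 : ℝ) ≤ K := K.2
  have hc1 : ∀ R (x : Space N), |cut R x| ≤ 1 := fun R x => by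
    rw [abs_of_nonneg (cut_nonneg R x)]; exact cut_le_one R x
  have hmm : ∀ n, AEStronglyMeasurable (kconv (moll (epsSeq n)) ρ) volume := fun n =>
    (contDiff_kconv (moll_contDiff _) (moll_hasCompactSupport (epsSeq_pos n))
      hρ).continuous.aestronglyMeasurable
  have hcm1 : ∀ (n : ℕ) x, |cut ((n : ℝ) + 1) x * kconv (moll (epsSeq n)) ρ x| ≤ M := fun n x => by
    rw [abs_mul, ← one_mul M]; exact mul_le_mul (hc1 _ x) (hmb n x) (abs_nonneg _) zero_le_one
  have hcut : ∀ n : ℕ, AEStronglyMeasurable (cut ((n : ℝ) + 1) : Space N → ℝ) volume := fun n =>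
    (cut_contDiff _).continuous.aestronglyMeasurable
  have lw := tendsto_l2_kconv_sub hw
  have lG := tendsto_l2_kconv_sub hG
  have lc : Tendsto (fun n => l2 fun x => commOp (epsSeq n) U w x - 0) atTop (𝓝 0) := by
    simpa using tendsto_l2_commOp hU hw
  have t1 := tendsto_integral_mul_inner (a₀ := fun _ => 0)
    (a := fun n x => kconv (moll (epsSeq n)) ρ x * fderiv ℝ (cut ((n : ℝ) + 1)) x (U x))
    (M := M * (cutC N * (‖U 0‖ + 2 * K))) (by positivity)
    (fun n => (hmm n).mul (aestronglyMeasurable_fderiv_apply _ hU.continuous))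
    (fun n => ae_of_all _ fun x => by
      rw [abs_mul]
      refine mul_le_mul (hmb n x) ((abs_fderiv_cut_apply_le hU (hRp n) x).trans ?_) (abs_nonneg _) hM0
      gcongr
      exact div_le_self (norm_nonneg _) (hR1 n))
    (by
      filter_upwards [ae_tendsto_kconv_moll hρ] with x hx
      simpa using hx.mul (tendsto_fderiv_cut x (U x)))
    (fun n => (hωm n).1) (fun n => (hωm n).1) hw hw lw lw
  have t2 := tendsto_integral_mul_inner (a₀ := fun _ => 0)
    (a := fun n x => cut ((n : ℝ) + 1) x * commOp (epsSeq n) U ρ x)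
    (M := 1 * (K * mollC N * (ballVol N * M))) (by positivity)
    (fun n => (hcut n).mul (aestronglyMeasurable_commOp hU.continuous hρ))
    (fun n => ae_of_all _ fun x => by
      rw [abs_mul]
      exact mul_le_mul (hc1 _ x) (norm_commOp_le_of_bounded (epsSeq_pos n) hU.lip hρ hM x)
        (abs_nonneg _) zero_le_one)
    (by
      filter_upwards [ae_tendsto_commOp hU hρ] with x hx
      simpa using (tendsto_cut x).mul hx)
    (fun n => (hωm n).1) (fun n => (hωm n).1) hw hw lw lw
  have t3 := tendsto_integral_mul_inner hM0 (fun n => (hcut n).mul (hmm n))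
    (fun n => ae_of_all _ (hcm1 n)) (tendsto_cut_mul_kconv hρ)
    (fun n => (hωm n).1) (fun n => (hGm n).1) hw hG lw lG
  have t4 := tendsto_integral_mul_inner hM0 (fun n => (hcut n).mul (hmm n))
    (fun n => ae_of_all _ (hcm1 n)) (tendsto_cut_mul_kconv hρ)
    (fun n => (hωm n).1) (fun n => (hcm n).1) hw (MemLp.zero (p := 2) (ε := H)) lw lc
  have := ((t1.sub t2).add (t3.const_mul 2)).sub (t4.const_mul 2)
  simpa using this

lemma tendsto_energy (hρ : LocallyIntegrable ρ volume) (hM : ∀ᵐ x, ‖ρ x‖ ≤ M)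
    (hw : MemLp w 2 volume) :
    Tendsto (fun n : ℕ => ∫ x, cut ((n : ℝ) + 1) x *
      (kconv (moll (epsSeq n)) ρ x * ‖kconv (moll (epsSeq n)) w x‖ ^ 2)) atTop
      (𝓝 (∫ x, ρ x * ‖w x‖ ^ 2)) := by
  have := FiniteDimensional.complete ℝ H
  have hmb : ∀ n x, |kconv (moll (epsSeq n)) ρ x| ≤ M :=
    fun n => norm_kconv_moll_le (epsSeq_pos n) hM
  have hM0 : 0 ≤ M := (abs_nonneg _).trans (hmb 0 0)
  have t3 := tendsto_integral_mul_inner hM0 (fun n : ℕ =>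
      ((cut_contDiff ((n : ℝ) + 1)).continuous.aestronglyMeasurable.mul
      (contDiff_kconv (moll_contDiff _) (moll_hasCompactSupport (epsSeq_pos n))
      hρ).continuous.aestronglyMeasurable))
    (fun n => ae_of_all _ fun x => by
      rw [Pi.mul_apply, abs_mul, ← one_mul M, abs_of_nonneg (cut_nonneg _ x)]
      exact mul_le_mul (cut_le_one _ x) (hmb n x) (abs_nonneg _) zero_le_one)
    (tendsto_cut_mul_kconv hρ)
    (fun n => (l2_kconv_le (epsSeq_pos n) hw).1) (fun n => (l2_kconv_le (epsSeq_pos n) hw).1)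
    hw hw (tendsto_l2_kconv_sub hw) (tendsto_l2_kconv_sub hw)
  simp_rw [real_inner_self_eq_norm_sq, Pi.mul_apply, mul_assoc] at t3
  exact t3

lemma abs_energy_le (hM : ∀ᵐ x, ‖ρ x‖ ≤ M)
    (hw : MemLp w 2 volume) {ε : ℝ} (hε : 0 < ε) (R : ℝ) :
    |∫ x, cut R x * (kconv (moll ε) ρ x * ‖kconv (moll ε) w x‖ ^ 2)|
      ≤ M * ((mollC N * ballVol N * l2 w) * (mollC N * ballVol N * l2 w)) := by
  have := FiniteDimensional.complete ℝ H
  have hmb : ∀ x, |kconv (moll ε) ρ x| ≤ M := norm_kconv_moll_le hε hM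
  have hM0 : 0 ≤ M := (abs_nonneg _).trans (hmb 0)
  have h := l2_kconv_le hε hw
  have hb := abs_integral_mul_inner_le (a := fun x => cut R x * kconv (moll ε) ρ x) hM0 h.1 h.1
    (ae_of_all _ fun x => by
      rw [abs_mul, ← one_mul M, abs_of_nonneg (cut_nonneg _ x)]
      exact mul_le_mul (cut_le_one _ x) (hmb x) (abs_nonneg _) zero_le_one)
  simp_rw [real_inner_self_eq_norm_sq, mul_assoc] at hb
  refine hb.trans (mul_le_mul_of_nonneg_left ?_ hM0)
  exact mul_le_mul h.2 h.2 (l2_nonneg _) ((l2_nonneg _).trans h.2)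

lemma kconv_moll_one {ε : ℝ} (hε : 0 < ε) (x : Space N) :
    kconv (moll ε) (fun _ => (1 : ℝ)) x = 1 := by
  simp [kconv, integral_moll_sub hε x]

/-- The constant density `1` is transported by every divergence-free field, so the plain `L²` norm
of `δρ` is a special case of the weighted energy. -/
lemma transOp_one {ε : ℝ} (hε : 0 < ε) (hU : LipDivFree U K) (x : Space N) :
    transOp ε U (fun _ => (1 : ℝ)) x = 0 := by
  simp [transOp, integral_fderiv_moll_eq_zero hε hU x]

end StaticEnergy

end InhomEuler


namespace InhomEuler

open Filter Topology Metric
open scoped ENNReal NNReal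

/-! ### Space-time measurability and testing with products -/

section Slab

variable {N : ℕ} {T : ℝ} {F : Type*} [NormedAddCommGroup F] {f : ℝ → Space N → F}

/-- Lebesgue measure on the time interval `(0,T)`. -/
noncomputable abbrev timeMeasure (T : ℝ) : Measure ℝ := volume.restrict (Ioo 0 T)

lemma restrict_slab : (volume : Measure (ℝ × Space N)).restrict (slab N T)
    = (timeMeasure T).prod volume := by
  rw [slab, Measure.volume_eq_prod, ← Measure.prod_restrict, Measure.restrict_univ]

lemma LocInt.aestronglyMeasurable (hf : LocInt T f) :
    AEStronglyMeasurable (Function.uncurry f) ((timeMeasure T).prod volume) := by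
  rw [← restrict_slab]
  exact LocallyIntegrableOn.aestronglyMeasurable hf

lemma LocInt.integrableOn (hf : LocInt T f) {k : Set ℝ} (hk : IsCompact k) (hkT : k ⊆ Ioo 0 T)
    {c : Set (Space N)} (hc : IsCompact c) :
    Integrable (Function.uncurry f) ((volume.restrict k).prod (volume.restrict c)) := by
  have h := LocallyIntegrableOn.integrableOn_compact_subset hf
    (show k ×ˢ c ⊆ slab N T from prod_mono hkT (subset_univ _)) (hk.prod hc)
  rwa [IntegrableOn, Measure.volume_eq_prod, ← Measure.prod_restrict] at h

/-- Local integrability on the slab says nothing near `t = 0` and `t = T`; a countable exhaustion of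
`(0,T)` by compact intervals recovers almost every time. -/
lemma ae_timeMeasure_of_compact (hT : 0 < T) {p : ℝ → Prop}
    (h : ∀ k : Set ℝ, IsCompact k → k ⊆ Ioo 0 T → ∀ᵐ t ∂(volume.restrict k), p t) :
    ∀ᵐ t ∂(timeMeasure T), p t := by
  have h1 : ∀ j : ℕ, ∀ᵐ t ∂volume, t ∈ Icc (T / (j + 2)) (T - T / (j + 2)) → p t := fun j => by
    rw [← ae_restrict_iff' measurableSet_Icc]
    have hp : 0 < T / ((j : ℝ) + 2) := by positivity
    exact h _ isCompact_Icc fun t ht => ⟨by linarith [ht.1], by linarith [ht.2]⟩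
  rw [ae_restrict_iff' measurableSet_Ioo]
  filter_upwards [ae_all_iff.2 h1] with t ht htT
  have hm : 0 < min t (T - t) := lt_min htT.1 (by linarith [htT.2])
  obtain ⟨j, hj⟩ := exists_nat_gt (T / min t (T - t))
  have hj2 : T / ((j : ℝ) + 2) ≤ min t (T - t) := by
    rw [div_le_iff₀ (by positivity)]
    rw [div_lt_iff₀ hm] at hj
    nlinarith
  exact ht j ⟨hj2.trans (min_le_left _ _), by linarith [hj2.trans (min_le_right _ _)]⟩

lemma LocInt.ae_locallyIntegrable (hf : LocInt T f) (hT : 0 < T) :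
    ∀ᵐ t ∂(timeMeasure T), LocallyIntegrable (f t) volume := by
  refine ae_timeMeasure_of_compact hT fun k hk hkT => ?_
  have h1 : ∀ j : ℕ, ∀ᵐ t ∂(volume.restrict k), IntegrableOn (f t) (closedBall 0 (j : ℝ)) volume :=
    fun j => (hf.integrableOn hk hkT (isCompact_closedBall (0 : Space N) j)).prod_right_ae
  filter_upwards [ae_all_iff.2 h1] with t ht
  rw [locallyIntegrable_iff]
  intro c hc
  obtain ⟨R, hR⟩ := hc.isBounded.subset_closedBall (0 : Space N)
  obtain ⟨j, hj⟩ := exists_nat_ge R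
  exact (ht j).mono_set (hR.trans (closedBall_subset_closedBall hj))

lemma LocInt.locallyIntegrableOn_integral (hf : LocInt T f) (R : ℝ) :
    LocallyIntegrableOn (fun t => ∫ y in closedBall (0 : Space N) R, ‖f t y‖) (Ioo 0 T) volume := by
  rw [locallyIntegrableOn_iff isOpen_Ioo.isLocallyClosed]
  intro k hkT hk
  exact (hf.integrableOn hk hkT (isCompact_closedBall (0 : Space N) R)).integral_norm_prod_left

lemma locallyIntegrableOn_of_le {G : Type*} [NormedAddCommGroup G] {g : ℝ → ℝ} {h : ℝ → G}
    (hg : LocallyIntegrableOn g (Ioo 0 T) volume) (hh : AEStronglyMeasurable h (timeMeasure T))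
    (hle : ∀ᵐ t ∂(timeMeasure T), ‖h t‖ ≤ g t) : LocallyIntegrableOn h (Ioo 0 T) volume := by
  rw [locallyIntegrableOn_iff isOpen_Ioo.isLocallyClosed] at hg ⊢
  intro k hkT hk
  refine (hg k hkT hk).mono' (hh.mono_measure (Measure.restrict_mono hkT le_rfl)) ?_
  exact ae_mono (Measure.restrict_mono hkT le_rfl) hle

variable [NormedSpace ℝ F]

/-- Measurability in `(t,x)` of convolutions in `x`. -/
lemma aestronglyMeasurable_conv {G : Type*} [NormedAddCommGroup G] [NormedSpace ℝ G]
    {A : Space N → F →L[ℝ] G} (hA : Continuous A)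
    (hf : AEStronglyMeasurable (Function.uncurry f) ((timeMeasure T).prod volume)) :
    AEStronglyMeasurable (fun z : ℝ × Space N => ∫ y, A (z.2 - y) (f z.1 y))
      ((timeMeasure T).prod volume) := by
  -- `f` is measurable only up to null sets, so composing it with the projection that forgets `x`
  -- requires that null sets pull back to null sets.
  have hq : Measure.QuasiMeasurePreserving (fun p : (ℝ × Space N) × Space N => (p.1.1, p.2))
      (((timeMeasure T).prod volume).prod volume) ((timeMeasure T).prod volume) := by
    have hmeas : Measurable fun p : (ℝ × Space N) × Space N => (p.1.1, p.2) :=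
      (measurable_fst.comp measurable_fst).prodMk measurable_snd
    refine ⟨hmeas, Measure.AbsolutelyContinuous.mk fun s hs h0 => ?_⟩
    rw [Measure.map_apply hmeas hs, Measure.measure_prod_null (hmeas hs)]
    exact Measure.quasiMeasurePreserving_fst.ae ((Measure.measure_prod_null hs).1 h0)
  have h2 := hf.comp_quasiMeasurePreserving hq
  have h3 : Continuous fun p : (ℝ × Space N) × Space N => A (p.1.2 - p.2) :=
    hA.comp ((continuous_snd.comp continuous_fst).sub continuous_snd)
  have h4 : AEStronglyMeasurable (fun p : (ℝ × Space N) × Space N => A (p.1.2 - p.2) (f p.1.1 p.2))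
      (((timeMeasure T).prod volume).prod volume) :=
    isBoundedBilinearMap_apply.continuous.comp_aestronglyMeasurable
      (h3.aestronglyMeasurable.prodMk h2)
  exact h4.integral_prod_right'

lemma aestronglyMeasurable_pairing {a : Space N → F →L[ℝ] ℝ} (ha : Continuous a)
    (hf : AEStronglyMeasurable (Function.uncurry f) ((timeMeasure T).prod volume)) :
    AEStronglyMeasurable (fun t => ∫ y, a y (f t y)) (timeMeasure T) := by
  have h4 : AEStronglyMeasurable (fun p : ℝ × Space N => a p.2 (f p.1 p.2))
      ((timeMeasure T).prod volume) :=
    isBoundedBilinearMap_apply.continuous.comp_aestronglyMeasurable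
      ((ha.comp continuous_snd).aestronglyMeasurable.prodMk hf)
  exact h4.integral_prod_right'

lemma LocInt.pairing_locallyIntegrableOn (hf : LocInt T f) {a : Space N → F →L[ℝ] ℝ}
    (hT : 0 < T) (ha : Continuous a) (hc : HasCompactSupport a) :
    LocallyIntegrableOn (fun t => ∫ y, a y (f t y)) (Ioo 0 T) volume := by
  obtain ⟨B, hB⟩ := hc.exists_bound_of_continuous ha
  obtain ⟨R, hR⟩ := hc.isCompact.isBounded.subset_closedBall (0 : Space N)
  refine locallyIntegrableOn_of_le ((hf.locallyIntegrableOn_integral R).continuousOn_mul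
    (continuousOn_const (c := B)) isOpen_Ioo.isLocallyClosed)
    (aestronglyMeasurable_pairing ha hf.aestronglyMeasurable) ?_
  filter_upwards [hf.ae_locallyIntegrable hT] with t ht
  have hi := (ht.integrableOn_isCompact (isCompact_closedBall (0 : Space N) R)).norm.const_mul B
  rw [← integral_const_mul,
    ← setIntegral_eq_integral_of_forall_compl_eq_zero (s := closedBall (0 : Space N) R)
    fun y hy => by rw [image_eq_zero_of_notMem_tsupport fun h => hy (hR h)]; rfl]
  refine norm_integral_le_of_norm_le hi (ae_of_all _ fun y => ?_)
  exact ((a y).le_opNorm _).trans (mul_le_mul_of_nonneg_right (hB y) (norm_nonneg _))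

lemma LocInt.integrable_smul_pairing {G : Type*} [NormedAddCommGroup G] [NormedSpace ℝ G]
    (hf : LocInt T f) {a : Space N → F →L[ℝ] G}
    (ha : Continuous a) (hc : HasCompactSupport a) {l : ℝ → ℝ} (hl : Continuous l)
    (hlc : HasCompactSupport l) (hls : tsupport l ⊆ Ioo 0 T) :
    Integrable (fun z : ℝ × Space N => l z.1 • a z.2 (f z.1 z.2)) volume := by
  obtain ⟨B, hB⟩ := hc.exists_bound_of_continuous ha
  obtain ⟨L, hL⟩ := hlc.exists_bound_of_continuous hl
  have hL0 : 0 ≤ L := (norm_nonneg _).trans (hL 0)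
  have h1 := LocallyIntegrableOn.integrableOn_compact_subset hf
    (show tsupport l ×ˢ tsupport a ⊆ slab N T from prod_mono hls (subset_univ _))
    (hlc.isCompact.prod hc.isCompact)
  have h2 : IntegrableOn (fun z : ℝ × Space N => l z.1 • a z.2 (f z.1 z.2))
      (tsupport l ×ˢ tsupport a) volume := by
    refine Integrable.mono' (h1.norm.const_mul (L * B)) ?_ (ae_of_all _ fun z => ?_)
    · exact (hl.comp continuous_fst).aestronglyMeasurable.smul
        (isBoundedBilinearMap_apply.continuous.comp_aestronglyMeasurable
          ((ha.comp continuous_snd).aestronglyMeasurable.prodMk h1.1))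
    · rw [norm_smul, mul_assoc]
      exact mul_le_mul (hL _) (((a z.2).le_opNorm _).trans
        (mul_le_mul_of_nonneg_right (hB _) (norm_nonneg _))) (norm_nonneg _) hL0
  refine (integrableOn_iff_integrable_of_support_subset fun z hz => ?_).1 h2
  rw [Function.mem_support] at hz
  refine ⟨by_contra fun h => hz ?_, by_contra fun h => hz ?_⟩
  · rw [image_eq_zero_of_notMem_tsupport h, zero_smul]
  · rw [image_eq_zero_of_notMem_tsupport h]; simp

lemma LocInt.integrable_mul_pairing (hf : LocInt T f) {a : Space N → F →L[ℝ] ℝ}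
    (ha : Continuous a) (hc : HasCompactSupport a) {l : ℝ → ℝ} (hl : Continuous l)
    (hlc : HasCompactSupport l) (hls : tsupport l ⊆ Ioo 0 T) :
    Integrable (fun z : ℝ × Space N => l z.1 * a z.2 (f z.1 z.2)) volume :=
  hf.integrable_smul_pairing ha hc hl hlc hls

lemma LocInt.integral_mul_pairing (hf : LocInt T f) {a : Space N → F →L[ℝ] ℝ}
    (ha : Continuous a) (hc : HasCompactSupport a) {l : ℝ → ℝ} (hl : Continuous l)
    (hlc : HasCompactSupport l) (hls : tsupport l ⊆ Ioo 0 T) :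
    ∫ z : ℝ × Space N, l z.1 * a z.2 (f z.1 z.2) = ∫ t, l t * ∫ y, a y (f t y) := by
  have h := hf.integrable_mul_pairing ha hc hl hlc hls
  rw [Measure.volume_eq_prod] at h ⊢
  rw [integral_prod _ h]
  simp_rw [integral_const_mul]

lemma isTestFunction_mul {l : ℝ → ℝ} (hl : IsTimeTest T l) {η : Space N → ℝ}
    (hη : ContDiff ℝ ∞ η) (hc : HasCompactSupport η) :
    IsTestFunction T fun z : ℝ × Space N => l z.1 * η z.2 := by
  have hs : ∀ z : ℝ × Space N, z ∉ tsupport l ×ˢ tsupport η → l z.1 * η z.2 = 0 := fun z hz => by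
    rw [mem_prod, not_and_or] at hz
    rcases hz with h | h <;> rw [image_eq_zero_of_notMem_tsupport h] <;> simp
  have hK : IsCompact (tsupport l ×ˢ tsupport η) := hl.compact.isCompact.prod hc.isCompact
  refine ⟨(hl.smooth.comp contDiff_fst).mul (hη.comp contDiff_snd), HasCompactSupport.intro hK hs,
    (closure_minimal (fun z hz => ?_) hK.isClosed).trans (prod_mono hl.support (subset_univ _))⟩
  by_contra h
  exact hz (hs z h)

lemma fderiv_mul_prod {l : ℝ → ℝ} (hl : IsTimeTest T l) {η : Space N → ℝ}
    (hη : ContDiff ℝ ∞ η) (z : ℝ × Space N) (s : ℝ) (v : Space N) :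
    fderiv ℝ (fun z : ℝ × Space N => l z.1 * η z.2) z (s, v)
      = deriv l z.1 * s * η z.2 + l z.1 * fderiv ℝ η z.2 v := by
  have h1 : DifferentiableAt ℝ l z.1 := (hl.smooth.differentiable (by simp)).differentiableAt
  have h2 : DifferentiableAt ℝ η z.2 := (hη.differentiable (by simp)).differentiableAt
  have h3 : HasFDerivAt (fun z : ℝ × Space N => l z.1) _ z :=
    h1.hasFDerivAt.comp z hasFDerivAt_fst
  have h4 : HasFDerivAt (fun z : ℝ × Space N => η z.2) _ z :=
    h2.hasFDerivAt.comp z hasFDerivAt_snd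
  rw [(h3.fun_mul h4).fderiv]
  simp
  ring

lemma IsTimeTest.tsupport_deriv_subset {l : ℝ → ℝ} (hl : IsTimeTest T l) :
    tsupport (deriv l) ⊆ Ioo 0 T := (_root_.tsupport_deriv_subset).trans hl.support

/-- The mollified density at a fixed point has a weak time derivative. -/
lemma hasWeakDeriv_density (hT : 0 < T) {ρ : ℝ → Space N → ℝ} {u : ℝ → Space N → Space N}
    (hρ : LocInt T ρ) (hm : LocInt T fun t x => ρ t x • u t x)
    (htr : ∀ φ : ℝ × Space N → ℝ, IsTestFunction T φ →
      ∫ z, ρ z.1 z.2 * fderiv ℝ φ z (1, u z.1 z.2) = 0) {ε : ℝ} (hε : 0 < ε) (x : Space N) :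
    HasWeakDeriv T (fun t => kconv (moll ε) (ρ t) x)
      (fun t => -∫ y, fderiv ℝ (moll ε) (x - y) (ρ t y • u t y)) := by
  set a₁ : Space N → ℝ →L[ℝ] ℝ := fun y => moll ε (x - y) • ContinuousLinearMap.id ℝ ℝ with ha₁
  set a₂ : Space N → Space N →L[ℝ] ℝ := fun y => fderiv ℝ (moll ε) (x - y) with ha₂
  have hη : ContDiff ℝ ∞ fun y : Space N => moll ε (x - y) :=
    (moll_contDiff ε).comp (contDiff_const.sub contDiff_id)
  have hηc := moll_sub_hasCompactSupport hε x
  have c1 : Continuous a₁ := hη.continuous.smul continuous_const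
  have s1 : HasCompactSupport a₁ := hηc.smul_right
  have c2 : Continuous a₂ := (continuous_fderiv_moll ε).comp (continuous_const.sub continuous_id)
  have s2 : HasCompactSupport a₂ :=
    ((moll_hasCompactSupport hε).fderiv ℝ).comp_homeomorph (Homeomorph.subLeft x)
  have e1 : ∀ t, kconv (moll ε) (ρ t) x = ∫ y, a₁ y (ρ t y) := fun t => rfl
  refine hasWeakDeriv_of_integral_eq hT (hρ.pairing_locallyIntegrableOn hT c1 s1)
    (hm.pairing_locallyIntegrableOn hT c2 s2).neg fun l hl => ?_
  -- The weak transport equation is tested with `l(t)` times the mollifier centred at `x`.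
  have h := htr _ (isTestFunction_mul hl hη hηc)
  have e : ∀ z : ℝ × Space N, ρ z.1 z.2 *
      fderiv ℝ (fun z : ℝ × Space N => l z.1 * moll ε (x - z.2)) z (1, u z.1 z.2)
      = deriv l z.1 * a₁ z.2 (ρ z.1 z.2) - l z.1 * a₂ z.2 (ρ z.1 z.2 • u z.1 z.2) := fun z => by
    rw [fderiv_mul_prod hl hη, fderiv_moll_sub]
    simp [ha₁, ha₂]
    ring
  simp_rw [e] at h
  rw [integral_sub (hρ.integrable_mul_pairing c1 s1 hl.continuous_deriv hl.compact.deriv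
      hl.tsupport_deriv_subset)
    (hm.integrable_mul_pairing c2 s2 hl.continuous hl.compact hl.support),
    hρ.integral_mul_pairing c1 s1 hl.continuous_deriv hl.compact.deriv hl.tsupport_deriv_subset,
    hm.integral_mul_pairing c2 s2 hl.continuous hl.compact hl.support, sub_eq_zero] at h
  simp_rw [mul_neg, integral_neg, neg_neg]
  exact h

/-- The mollified velocity at a fixed point has a weak time derivative. -/
lemma HasWeakTimeDeriv.hasWeakDeriv (hT : 0 < T) {u ut : ℝ → Space N → Space N}
    (hu : HasWeakTimeDeriv T u ut) {ε : ℝ} (hε : 0 < ε) (x v : Space N) :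
    HasWeakDeriv T (fun t => ∫ y, moll ε (x - y) * inner ℝ v (u t y))
      (fun t => ∫ y, moll ε (x - y) * inner ℝ v (ut t y)) := by
  set a : Space N → Space N →L[ℝ] ℝ := fun y => moll ε (x - y) • innerSL ℝ v with ha
  have hη : ContDiff ℝ ∞ fun y : Space N => moll ε (x - y) :=
    (moll_contDiff ε).comp (contDiff_const.sub contDiff_id)
  have hηc := moll_sub_hasCompactSupport hε x
  have c1 : Continuous a := hη.continuous.smul continuous_const
  have s1 : HasCompactSupport a := hηc.smul_right
  refine hasWeakDeriv_of_integral_eq hT (hu.locInt.pairing_locallyIntegrableOn hT c1 s1)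
    (hu.locInt_deriv.pairing_locallyIntegrableOn hT c1 s1) fun l hl => ?_
  refine (hu.locInt.integral_mul_pairing c1 s1 hl.continuous_deriv hl.compact.deriv
    hl.tsupport_deriv_subset).symm.trans (Eq.trans ?_ (congrArg Neg.neg
    (hu.locInt_deriv.integral_mul_pairing c1 s1 hl.continuous hl.compact hl.support)))
  -- The weak time derivative is a vector identity; pairing with `v` under the integral gives the
  -- scalar one.
  have key : ∀ {k : ℝ → ℝ} {f : ℝ → Space N → Space N}, LocInt T f → Continuous k →
      HasCompactSupport k → tsupport k ⊆ Ioo 0 T →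
      ∫ z : ℝ × Space N, k z.1 * a z.2 (f z.1 z.2)
        = inner ℝ v (∫ z : ℝ × Space N, (k z.1 * moll ε (x - z.2)) • f z.1 z.2) :=
    fun {k f} hf hk hkc hks => by
      have i := hf.integrable_smul_pairing (G := Space N)
        (a := fun y => moll ε (x - y) • ContinuousLinearMap.id ℝ (Space N))
        (hη.continuous.smul continuous_const) hηc.smul_right hk hkc hks
      have i' : Integrable (fun z : ℝ × Space N => (k z.1 * moll ε (x - z.2)) • f z.1 z.2)
          volume := i.congr (ae_of_all _ fun z => by simp [mul_smul])
      rw [← integral_inner i' v]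
      refine integral_congr_ae (ae_of_all _ fun z => ?_)
      simp only [ha, smul_apply, innerSL_apply_apply, inner_smul_right, smul_eq_mul]
      ring
  rw [key hu.locInt hl.continuous_deriv hl.compact.deriv hl.tsupport_deriv_subset,
    key hu.locInt_deriv hl.continuous hl.compact hl.support, ← inner_neg_right,
    ← hu.integral_eq _ (isTestFunction_mul hl hη hηc)]
  congr 1
  refine integral_congr_ae (ae_of_all _ fun z => ?_)
  simp only
  rw [fderiv_mul_prod hl hη]
  simp

end Slab

end InhomEuler


namespace InhomEuler

open Filter Topology Metric
open scoped ENNReal NNReal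

/-! ### Calculus of weak time derivatives -/

section WeakDerivAlgebra

variable {T : ℝ} {a a' b b' : ℝ → ℝ}

lemma HasWeakDeriv.add (ha : HasWeakDeriv T a a') (hb : HasWeakDeriv T b b') :
    HasWeakDeriv T (fun t => a t + b t) (fun t => a' t + b' t) := by
  obtain ⟨c, hc⟩ := ha.ae_eq
  obtain ⟨d, hd⟩ := hb.ae_eq
  refine ⟨fun s hs t ht => (ha.intervalIntegrable s hs t ht).add (hb.intervalIntegrable s hs t ht),
    c + d, ?_⟩
  filter_upwards [hc, hd, ae_restrict_mem measurableSet_Ioo] with t h1 h2 ht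
  rw [h1, h2, intervalIntegral.integral_add (ha.intervalIntegrable _ (half_mem ht) t ht)
    (hb.intervalIntegrable _ (half_mem ht) t ht)]
  ring

lemma HasWeakDeriv.zero (T : ℝ) (c : ℝ) : HasWeakDeriv T (fun _ => c) (fun _ => 0) :=
  ⟨fun _ _ _ _ => intervalIntegrable_const, c, ae_of_all _ fun t => by simp⟩

lemma HasWeakDeriv.sum {ι : Type*} (s : Finset ι) {a a' : ι → ℝ → ℝ}
    (h : ∀ i ∈ s, HasWeakDeriv T (a i) (a' i)) :
    HasWeakDeriv T (fun t => ∑ i ∈ s, a i t) (fun t => ∑ i ∈ s, a' i t) := by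
  classical
  induction s using Finset.induction_on with
  | empty => simpa using HasWeakDeriv.zero T 0
  | insert i s hi ih =>
    simp_rw [Finset.sum_insert hi]
    exact (h i (Finset.mem_insert_self i s)).add
      (ih fun j hj => h j (Finset.mem_insert_of_mem hj))

/-- In an orthonormal basis `‖z‖ ^ 2` is a sum of squares of components, and the product rule for
scalar weak derivatives applies to each. -/
lemma HasWeakDeriv.mul_norm_sq {H : Type*} [NormedAddCommGroup H] [InnerProductSpace ℝ H]
    [FiniteDimensional ℝ H] (hT : 0 < T) {m k : ℝ → ℝ} {z zt : ℝ → H} (hm : HasWeakDeriv T m k)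
    (hz : ∀ v, HasWeakDeriv T (fun t => inner ℝ v (z t)) (fun t => inner ℝ v (zt t))) :
    HasWeakDeriv T (fun t => m t * ‖z t‖ ^ 2)
      (fun t => k t * ‖z t‖ ^ 2 + 2 * m t * inner ℝ (z t) (zt t)) := by
  set e := stdOrthonormalBasis ℝ H
  have h := hm.mul (HasWeakDeriv.sum Finset.univ fun i _ => (hz (e i)).mul (hz (e i)) hT) hT
  have e1 : ∀ x y : H, (inner ℝ x y : ℝ) = ∑ i, inner ℝ (e i) x * inner ℝ (e i) y := fun x y => by
    rw [← e.sum_inner_mul_inner x y]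
    simp_rw [real_inner_comm x]
  convert h using 2 with t t
  · rw [← real_inner_self_eq_norm_sq, e1]
  · rw [← real_inner_self_eq_norm_sq, e1, e1, Finset.sum_add_distrib, mul_assoc, mul_left_comm,
      two_mul]
    simp_rw [mul_comm (inner ℝ (e _) (zt t))]

end WeakDerivAlgebra

/-! ### Interchanging time with space integrals and limits -/

section TimeIntegrals

variable {N : ℕ} {T : ℝ}

lemma integral_time_eq {f : ℝ → ℝ} {l : ℝ → ℝ} (hls : tsupport l ⊆ Ioo 0 T) :
    ∫ t, l t * f t = ∫ t, l t * f t ∂(timeMeasure T) := by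
  refine (setIntegral_eq_integral_of_forall_compl_eq_zero fun t ht => ?_).symm
  rw [image_eq_zero_of_notMem_tsupport fun h => ht (hls h), zero_mul]

lemma integrable_time_mul {g : ℝ → ℝ} (hg : LocallyIntegrableOn g (Ioo 0 T) volume) {l : ℝ → ℝ}
    (hl : Continuous l) (hlc : HasCompactSupport l) (hls : tsupport l ⊆ Ioo 0 T) :
    Integrable (fun t => l t * g t) (timeMeasure T) := by
  have h1 : IntegrableOn (fun t => l t * g t) (tsupport l) volume :=
    (hg.integrableOn_compact_subset hls hlc).continuousOn_mul hl.continuousOn hlc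
  refine ((integrableOn_iff_integrable_of_support_subset fun x hx => ?_).1 h1).integrableOn
  exact subset_tsupport _ fun h0 => hx (by simp [h0])

/-- Fubini, justified by a bound `γ t` uniform in `x` over the support of the cutoff. It reduces the
weak time derivative of a spatial integral to that of the integrand at each fixed `x`. -/
lemma integral_cut_swap {g : ℝ → Space N → ℝ} {γ : ℝ → ℝ} {R : ℝ} (hR : 0 < R)
    (hg : AEStronglyMeasurable (Function.uncurry g) ((timeMeasure T).prod volume))
    (hγ : LocallyIntegrableOn γ (Ioo 0 T) volume)
    (hle : ∀ᵐ t ∂(timeMeasure T), ∀ x ∈ closedBall (0 : Space N) (2 * R), |g t x| ≤ γ t)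
    {l : ℝ → ℝ} (hl : Continuous l) (hlc : HasCompactSupport l) (hls : tsupport l ⊆ Ioo 0 T) :
    ∫ t, l t * ∫ x, cut R x * g t x = ∫ x, cut R x * ∫ t, l t * g t x := by
  have hint : Integrable (fun p : ℝ × Space N => l p.1 * (cut R p.2 * g p.1 p.2))
      ((timeMeasure T).prod volume) := by
    have h1 : Integrable (fun t => l t * γ t) (timeMeasure T) := integrable_time_mul hγ hl hlc hls
    have h2 : Integrable (cut R : Space N → ℝ) volume :=
      (cut_contDiff R).continuous.integrable_of_hasCompactSupport (cut_hasCompactSupport hR)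
    refine (h1.mul_prod h2).mono ?_ ?_
    · exact (hl.comp continuous_fst).aestronglyMeasurable.mul
        (((cut_contDiff R).continuous.comp continuous_snd).aestronglyMeasurable.mul hg)
    · have h3 := Measure.quasiMeasurePreserving_fst (μ := timeMeasure T)
        (ν := (volume : Measure (Space N))).ae hle
      filter_upwards [h3] with p hp
      by_cases hx : p.2 ∈ closedBall (0 : Space N) (2 * R)
      · have := (hp p.2 hx).trans (le_abs_self _)
        simp only [norm_mul, Real.norm_eq_abs]
        calc |l p.1| * (|cut R p.2| * |g p.1 p.2|) ≤ |l p.1| * (|cut R p.2| * |γ p.1|) := by gcongr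
          _ = _ := by ring
      · rw [cut_eq_zero hR (by simpa using (not_le.1 fun h => hx (by simpa using h)).le)]
        simp
  rw [integral_time_eq hls]
  simp_rw [fun x : Space N => integral_time_eq (f := fun t => g t x) hls, ← integral_const_mul]
  rw [integral_integral_swap hint]
  refine integral_congr_ae (ae_of_all _ fun x => ?_)
  refine integral_congr_ae (ae_of_all _ fun t => ?_)
  simp only
  ring

/-- The distributional identity passes to the limit by dominated convergence, and the majorants make
the limits locally integrable, so the limit identity is again a weak derivative. -/
lemma hasWeakDeriv_of_tendsto (hT : 0 < T) {E S β : ℝ → ℝ} {En Sn : ℕ → ℝ → ℝ} {C : ℝ}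
    (hE : ∀ n, AEStronglyMeasurable (En n) (timeMeasure T))
    (hS : ∀ n, AEStronglyMeasurable (Sn n) (timeMeasure T))
    (heq : ∀ n l, IsTimeTest T l → ∫ t, deriv l t * En n t = -∫ t, l t * Sn n t)
    (hβ : LocallyIntegrableOn β (Ioo 0 T) volume)
    (hEb : ∀ᵐ t ∂(timeMeasure T), ∀ n, |En n t| ≤ C)
    (hSb : ∀ᵐ t ∂(timeMeasure T), ∀ n, |Sn n t| ≤ β t)
    (hEl : ∀ᵐ t ∂(timeMeasure T), Tendsto (fun n => En n t) atTop (𝓝 (E t)))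
    (hSl : ∀ᵐ t ∂(timeMeasure T), Tendsto (fun n => Sn n t) atTop (𝓝 (S t))) :
    HasWeakDeriv T E S := by
  have hC : LocallyIntegrableOn (fun _ : ℝ => C) (Ioo 0 T) volume := locallyIntegrableOn_const _
  have hlim : ∀ {f : ℕ → ℝ → ℝ} {f₀ γ : ℝ → ℝ} {l : ℝ → ℝ},
      (∀ n, AEStronglyMeasurable (f n) (timeMeasure T)) →
      LocallyIntegrableOn γ (Ioo 0 T) volume →
      (∀ᵐ t ∂(timeMeasure T), ∀ n, |f n t| ≤ γ t) →
      (∀ᵐ t ∂(timeMeasure T), Tendsto (fun n => f n t) atTop (𝓝 (f₀ t))) →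
      Continuous l → HasCompactSupport l → tsupport l ⊆ Ioo 0 T →
      Tendsto (fun n => ∫ t, l t * f n t) atTop (𝓝 (∫ t, l t * f₀ t)) := by
    intro f f₀ γ l hf hγ hb ht hl hlc hls
    rw [integral_time_eq hls]
    simp_rw [fun n => integral_time_eq (f := f n) hls]
    refine tendsto_integral_of_dominated_convergence (fun t => ‖l t * γ t‖)
      (fun n => hl.aestronglyMeasurable.mul (hf n)) (integrable_time_mul hγ hl hlc hls).norm
      (fun n => ?_) ?_
    · filter_upwards [hb] with t h
      rw [norm_mul, norm_mul]
      exact mul_le_mul_of_nonneg_left ((h n).trans (le_abs_self _)) (norm_nonneg _)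
    · filter_upwards [ht] with t h
      exact h.const_mul _
  refine hasWeakDeriv_of_integral_eq hT
    (locallyIntegrableOn_of_le hC (aestronglyMeasurable_of_tendsto_ae _ hE hEl) ?_)
    (locallyIntegrableOn_of_le hβ (aestronglyMeasurable_of_tendsto_ae _ hS hSl) ?_) fun l hl => ?_
  · filter_upwards [hEb, hEl] with t h1 h2
    exact le_of_tendsto h2.norm (Eventually.of_forall h1)
  · filter_upwards [hSb, hSl] with t h1 h2
    exact le_of_tendsto h2.norm (Eventually.of_forall h1)
  · refine tendsto_nhds_unique (hlim hE hC hEb hEl hl.continuous_deriv hl.compact.deriv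
      hl.tsupport_deriv_subset) ?_
    simp_rw [fun n => heq n l hl]
    exact (hlim hS hβ hSb hSl hl.continuous hl.compact hl.support).neg

end TimeIntegrals

/-! ### Pointwise bounds at a fixed scale -/

section PointwiseBounds

variable {N : ℕ} {F : Type*} [NormedAddCommGroup F] [NormedSpace ℝ F]

/-- Cauchy–Schwarz and translation invariance. The constant depends on the scale, which is harmless:
bounds of this kind serve only to justify Fubini at a fixed scale. -/
lemma exists_integral_ballKer_le (N : ℕ) {ε : ℝ} (hε : 0 < ε) : ∃ B : ℝ, 0 ≤ B ∧
    ∀ {F : Type*} [NormedAddCommGroup F] {f : Space N → F}, MemLp f 2 volume → ∀ x,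
      ∫ y, ballKer ε (x - y) * ‖f y‖ ≤ B * l2 f := by
  have hm : MemLp (ballKer ε : Space N → ℝ) 2 volume :=
    memLp_indicator_const 2 measurableSet_closedBall _ (Or.inr measure_closedBall_lt_top.ne)
  refine ⟨l2 (ballKer ε : Space N → ℝ), l2_nonneg _, fun {F} _ {f} hf x => ?_⟩
  have hp := Measure.measurePreserving_sub_left (volume : Measure (Space N)) x
  have hmx : MemLp (fun y => ballKer ε (x - y)) 2 volume := hm.comp_measurePreserving hp
  have he : l2 (fun y => ballKer ε (x - y)) = l2 (ballKer ε : Space N → ℝ) := by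
    unfold l2
    congr 1
    exact eLpNorm_comp_measurePreserving hm.1 hp
  rw [← he]
  refine le_trans (integral_mono_of_nonneg ?_ (integrable_norm_mul_norm hmx hf) ?_)
    (integral_norm_mul_norm_le hmx hf)
  · refine ae_of_all _ fun y => ?_
    exact mul_nonneg (ballKer_nonneg hε _) (norm_nonneg _)
  · exact ae_of_all _ fun y => mul_le_mul_of_nonneg_right (le_abs_self _) (norm_nonneg _)

lemma integral_ballKer_le_of_bounded {ε : ℝ} (hε : 0 < ε) {σ : Space N → F}
    (hσ : LocallyIntegrable σ volume) {M : ℝ} (hM : ∀ᵐ x, ‖σ x‖ ≤ M) (x : Space N) :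
    ∫ y, ballKer ε (x - y) * ‖σ y‖ ≤ ballVol N * M := by
  have hn : LocallyIntegrable (fun y => ‖σ y‖) volume := by
    simpa using locallyIntegrable_norm_sub hσ 0
  rw [← integral_ballKer_sub hε x, ← integral_mul_const]
  refine integral_mono_ae (integrable_ballKer_mul hn ε x)
    (integrable_ballKer_mul (locallyIntegrable_const M) ε x) ?_
  filter_upwards [hM] with y hy
  exact mul_le_mul_of_nonneg_left hy (ballKer_nonneg hε _)

/-- The mollifier at `x` reaches only points `y` with `‖y‖ ≤ R + ε`, where `‖U y‖` is at most a
multiple of `‖U 0‖ + K`. The constant is chosen before `σ` and `U`, so it serves all times at once.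
-/
lemma exists_transOp_le {ε : ℝ} (hε : 0 < ε) {R : ℝ} (hR : 0 < R) : ∃ D : ℝ, 0 ≤ D ∧
    ∀ {F : Type*} [NormedAddCommGroup F] [NormedSpace ℝ F] {σ : Space N → F}
      {U : Space N → Space N} {K : ℝ≥0},
      LocallyIntegrable σ volume → LipschitzWith K U → ∀ x ∈ closedBall (0 : Space N) R,
      ‖transOp ε U σ x‖ ≤ D * (‖U 0‖ + K) * ∫ y, ballKer ε (x - y) * ‖σ y‖ := by
  obtain ⟨B, hB⟩ := ((moll_hasCompactSupport (N := N) hε).fderiv ℝ).exists_bound_of_continuous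
    (continuous_fderiv_moll ε)
  have hB0 : 0 ≤ B := (norm_nonneg _).trans (hB 0)
  refine ⟨B * ε ^ N * (1 + R + ε), by positivity, fun {F} _ _ {σ U K} hσ hU x hx => ?_⟩
  have hn : LocallyIntegrable (fun y => ‖σ y‖) volume := by
    simpa using locallyIntegrable_norm_sub hσ 0
  rw [← integral_const_mul]
  refine norm_integral_le_of_norm_le ((integrable_ballKer_mul hn ε x).const_mul _)
    (ae_of_all _ fun y => ?_)
  rw [norm_smul, ← mul_assoc]
  refine mul_le_mul_of_nonneg_right ?_ (norm_nonneg _)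
  refine (ContinuousLinearMap.le_opNorm _ _).trans ?_
  rcases le_or_gt ‖x - y‖ ε with h | h
  · rw [ballKer_of_le h]
    have hy : ‖y‖ ≤ R + ε := by
      have h1 := norm_sub_norm_le y x
      rw [norm_sub_rev] at h1
      have h2 : ‖x‖ ≤ R := by simpa using hx
      linarith
    have hUy : ‖U y‖ ≤ ‖U 0‖ + K * ‖y‖ := by
      have h := hU.dist_le_mul y 0
      rw [dist_zero_right, dist_eq_norm] at h
      have := norm_le_norm_add_norm_sub' (U y) (U 0)
      linarith
    have hK : (0 : ℝ) ≤ K := K.2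
    have hU' : ‖U y‖ ≤ (1 + R + ε) * (‖U 0‖ + K) := by
      have := norm_nonneg (U 0)
      nlinarith [mul_le_mul_of_nonneg_left hy hK, mul_nonneg hR.le this, mul_nonneg hε.le this]
    calc ‖fderiv ℝ (moll ε) (x - y)‖ * ‖U y‖ ≤ B * ((1 + R + ε) * (‖U 0‖ + K)) :=
          mul_le_mul (hB _) hU' (norm_nonneg _) hB0
      _ = B * ε ^ N * (1 + R + ε) * (‖U 0‖ + K) * (ε⁻¹) ^ N := by
          have : ε ^ N * (ε⁻¹) ^ N = 1 := by rw [← mul_pow, mul_inv_cancel₀ hε.ne', one_pow]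
          linear_combination -(B * (1 + R + ε) * (‖U 0‖ + K)) * this
  · have h0 := fderiv_moll_le hε (x - y)
    rw [ballKer_of_lt h, mul_zero] at h0 ⊢
    have h1 : ‖fderiv ℝ (moll ε) (x - y)‖ = 0 := by
      by_contra hne
      have := mul_pos (lt_of_le_of_ne (norm_nonneg _) (Ne.symm hne)) (hε.trans h)
      linarith
    rw [h1, zero_mul]

end PointwiseBounds

end InhomEuler


namespace InhomEuler

open Filter Topology Metric
open scoped ENNReal NNReal

/-! ### The energy identity -/

section WeakEnergy

variable {N : ℕ} {T : ℝ} {H : Type*} [NormedAddCommGroup H] [InnerProductSpace ℝ H]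
  [FiniteDimensional ℝ H]

/-- At a fixed time, `ρ` is bounded by `M` and transported by a divergence-free Lipschitz field `U`,
`w` is bounded in `L²` by `Z`, and `∂ₜ w + U · ∇w = G`; `k` and `zt` are the resulting time
derivatives of the mollified density and of the mollification of `w`. -/
structure EnergyState (M Z β : ℝ) (ρ : Space N → ℝ) (w G : Space N → H) (U : Space N → Space N)
    (K : ℝ≥0) (k : ℕ → Space N → ℝ) (zt : ℕ → Space N → H) : Prop where
  field : LipDivFree U K
  locInt_density : LocallyIntegrable ρ volume
  density_le : ∀ᵐ x, ‖ρ x‖ ≤ M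
  memLp : MemLp w 2 volume
  l2_le : l2 w ≤ Z
  memLp_source : MemLp G 2 volume
  field_le : ‖U 0‖ + K ≤ β
  source_le : l2 G ≤ β
  density_eq : ∀ n x, k n x = -transOp (epsSeq n) U ρ x
  velocity_eq : ∀ n x, zt n x = kconv (moll (epsSeq n)) G x - transOp (epsSeq n) U w x

/-- Supplies the bound, uniform over the cutoff region and linear in `β`, that Fubini requires at
each scale. The constants depend on `n` and `R` but not on the time slice. -/
lemma exists_bound_energyState (N : ℕ) (H : Type*) [NormedAddCommGroup H] [InnerProductSpace ℝ H]
    [FiniteDimensional ℝ H] (M Z : ℝ) (n : ℕ) {R : ℝ} (hR : 0 < R) :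
    ∃ C Z', ∀ {β : ℝ} {ρ : Space N → ℝ} {w G : Space N → H} {U : Space N → Space N} {K : ℝ≥0}
      {k : ℕ → Space N → ℝ} {zt : ℕ → Space N → H}, EnergyState M Z β ρ w G U K k zt →
      ∀ x ∈ closedBall (0 : Space N) R, ‖kconv (moll (epsSeq n)) w x‖ ≤ Z' ∧
        |k n x| ≤ C * β ∧ ‖zt n x‖ ≤ C * β := by
  have := FiniteDimensional.complete ℝ H
  have hε := epsSeq_pos n
  obtain ⟨B, hB0, hB⟩ := exists_integral_ballKer_le N hε
  obtain ⟨D, hD0, hD⟩ := exists_transOp_le (N := N) hε hR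
  obtain ⟨D', hD0', hD'⟩ := exists_transOp_le (N := N) hε hR
  have hm0 := (mollC_pos N).le
  have hb0 := (ballVol_pos N).le
  refine ⟨D * (ballVol N * |M|) + mollC N * B + D' * (B * |Z|), mollC N * (B * |Z|),
    fun {β ρ w G U K k zt} h x hx => ?_⟩
  have hwl := h.memLp.locallyIntegrable (by norm_num)
  have hGl := h.memLp_source.locallyIntegrable (by norm_num)
  have hK0 : 0 ≤ ‖U 0‖ + K := by positivity
  have hβ0 : 0 ≤ β := hK0.trans h.field_le
  have hw := (hB h.memLp x).trans (mul_le_mul_of_nonneg_left (h.l2_le.trans (le_abs_self Z)) hB0)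
  have hG := (hB h.memLp_source x).trans (mul_le_mul_of_nonneg_left h.source_le hB0)
  have hρ := integral_ballKer_le_of_bounded hε h.locInt_density
    (h.density_le.mono fun y hy => hy.trans (le_abs_self M)) x
  have t1 := hD h.locInt_density h.field.lip x hx
  have t2 := hD' hwl h.field.lip x hx
  have c1 : ‖kconv (moll (epsSeq n)) w x‖ ≤ mollC N * (B * |Z|) := by
    have := norm_kconv_moll_sub_le hε hwl x 0
    simp only [sub_zero] at this
    exact this.trans (mul_le_mul_of_nonneg_left hw hm0)
  have c2 : ‖kconv (moll (epsSeq n)) G x‖ ≤ mollC N * (B * β) := by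
    have := norm_kconv_moll_sub_le hε hGl x 0
    simp only [sub_zero] at this
    exact this.trans (mul_le_mul_of_nonneg_left hG hm0)
  have t1' : ‖transOp (epsSeq n) U ρ x‖ ≤ D * β * (ballVol N * |M|) :=
    t1.trans (mul_le_mul (mul_le_mul_of_nonneg_left h.field_le hD0) hρ
      (integral_nonneg fun y => mul_nonneg (ballKer_nonneg hε _) (norm_nonneg _)) (by positivity))
  have t2' : ‖transOp (epsSeq n) U w x‖ ≤ D' * β * (B * |Z|) :=
    t2.trans (mul_le_mul (mul_le_mul_of_nonneg_left h.field_le hD0') hw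
      (integral_nonneg fun y => mul_nonneg (ballKer_nonneg hε _) (norm_nonneg _)) (by positivity))
  have p1 : 0 ≤ mollC N * B * β := by positivity
  have p2 : 0 ≤ D' * (B * |Z|) * β := by positivity
  have p3 : 0 ≤ D * (ballVol N * |M|) * β := by positivity
  refine ⟨c1, ?_, ?_⟩
  · rw [h.density_eq, abs_neg]
    refine t1'.trans ?_
    nlinarith
  · rw [h.velocity_eq]
    refine (norm_sub_le _ _).trans ((add_le_add c2 t2').trans ?_)
    nlinarith

lemma aestronglyMeasurable_kconv {F : Type*} [NormedAddCommGroup F] [NormedSpace ℝ F]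
    {f : ℝ → Space N → F}
    (hf : AEStronglyMeasurable (Function.uncurry f) ((timeMeasure T).prod volume)) (ε : ℝ) :
    AEStronglyMeasurable (fun p : ℝ × Space N => kconv (moll ε) (f p.1) p.2)
      ((timeMeasure T).prod volume) :=
  aestronglyMeasurable_conv (A := fun y => moll ε y • ContinuousLinearMap.id ℝ F)
    ((moll_contDiff ε).continuous.smul continuous_const) hf

/-- Energy identity for a transported density and an `L²` field. -/
theorem hasWeakDeriv_energy (hT : 0 < T) {ρ : ℝ → Space N → ℝ} {w G : ℝ → Space N → H}
    {k : ℕ → ℝ → Space N → ℝ} {zt : ℕ → ℝ → Space N → H}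
    (hρm : AEStronglyMeasurable (Function.uncurry ρ) ((timeMeasure T).prod volume))
    (hwm : AEStronglyMeasurable (Function.uncurry w) ((timeMeasure T).prod volume))
    (hkm : ∀ n, AEStronglyMeasurable (Function.uncurry (k n)) ((timeMeasure T).prod volume))
    (hztm : ∀ n, AEStronglyMeasurable (Function.uncurry (zt n)) ((timeMeasure T).prod volume))
    (hρd : ∀ n x, HasWeakDeriv T (fun t => kconv (moll (epsSeq n)) (ρ t) x) (fun t => k n t x))
    (hwd : ∀ n x v, HasWeakDeriv T (fun t => inner ℝ v (kconv (moll (epsSeq n)) (w t) x))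
      (fun t => inner ℝ v (zt n t x)))
    {M Z : ℝ} {β : ℝ → ℝ} (hβ : LocallyIntegrableOn β (Ioo 0 T) volume)
    (h : ∀ᵐ t ∂(timeMeasure T), ∃ U K, EnergyState M Z (β t) (ρ t) (w t) (G t) U K
      (fun n => k n t) (fun n => zt n t)) :
    HasWeakDeriv T (fun t => ∫ x, ρ t x * ‖w t x‖ ^ 2)
      (fun t => 2 * ∫ x, ρ t x * inner ℝ (w t x) (G t x)) := by
  have := FiniteDimensional.complete ℝ H
  have hρcm := fun n => aestronglyMeasurable_kconv hρm (epsSeq n)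
  have hwcm := fun n => aestronglyMeasurable_kconv hwm (epsSeq n)
  have hEm : ∀ n, AEStronglyMeasurable (fun p : ℝ × Space N => kconv (moll (epsSeq n)) (ρ p.1) p.2 *
      ‖kconv (moll (epsSeq n)) (w p.1) p.2‖ ^ 2) ((timeMeasure T).prod volume) := fun n =>
    (hρcm n).mul ((hwcm n).norm.pow 2)
  have hSm : ∀ n, AEStronglyMeasurable (fun p : ℝ × Space N =>
      k n p.1 p.2 * ‖kconv (moll (epsSeq n)) (w p.1) p.2‖ ^ 2 +
      2 * kconv (moll (epsSeq n)) (ρ p.1) p.2 *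
        inner ℝ (kconv (moll (epsSeq n)) (w p.1) p.2) (zt n p.1 p.2))
      ((timeMeasure T).prod volume) := fun n =>
    ((hkm n).mul ((hwcm n).norm.pow 2)).add (((hρcm n).const_mul 2).mul
      ((hwcm n).inner (𝕜 := ℝ) (hztm n)))
  have hcutm : ∀ n : ℕ, AEStronglyMeasurable (fun p : ℝ × Space N => cut ((n : ℝ) + 1) p.2)
      ((timeMeasure T).prod volume) := fun n =>
    ((cut_contDiff _).continuous.comp continuous_snd).aestronglyMeasurable
  have hRp : ∀ n : ℕ, (0 : ℝ) < n + 1 := fun n => by positivity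
  have hR1 : ∀ n : ℕ, (1 : ℝ) ≤ n + 1 := fun n => by
    have : (0 : ℝ) ≤ n := by positivity
    linarith
  have hrate : ∀ {t : ℝ} {U K}, EnergyState M Z (β t) (ρ t) (w t) (G t) U K
      (fun n => k n t) (fun n => zt n t) → ∀ n : ℕ,
      ∫ x, cut ((n : ℝ) + 1) x * (k n t x * ‖kconv (moll (epsSeq n)) (w t) x‖ ^ 2 +
        2 * kconv (moll (epsSeq n)) (ρ t) x *
        inner ℝ (kconv (moll (epsSeq n)) (w t) x) (zt n t x))
      = energyRate (epsSeq n) ((n : ℝ) + 1) U (ρ t) (w t) (G t) := fun {t U K} ht n => by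
    unfold energyRate
    simp_rw [ht.density_eq, ht.velocity_eq]
  have hmb : ∀ {t : ℝ} {U K}, EnergyState M Z (β t) (ρ t) (w t) (G t) U K
      (fun n => k n t) (fun n => zt n t) → ∀ (n : ℕ) x, |kconv (moll (epsSeq n)) (ρ t) x| ≤ M :=
    fun {t U K} ht n => norm_kconv_moll_le (epsSeq_pos n) ht.density_le
  have hm0 := (mollC_pos N).le
  have hb0 := (ballVol_pos N).le
  have hZ0 : ∀ {t : ℝ} {U K}, EnergyState M Z (β t) (ρ t) (w t) (G t) U K
      (fun n => k n t) (fun n => zt n t) → 0 ≤ Z := fun ht => (l2_nonneg _).trans ht.l2_le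
  refine hasWeakDeriv_of_tendsto hT
    (En := fun n t => ∫ x, cut ((n : ℝ) + 1) x * (kconv (moll (epsSeq n)) (ρ t) x *
      ‖kconv (moll (epsSeq n)) (w t) x‖ ^ 2))
    (Sn := fun n t => ∫ x, cut ((n : ℝ) + 1) x *
      (k n t x * ‖kconv (moll (epsSeq n)) (w t) x‖ ^ 2 +
        2 * kconv (moll (epsSeq n)) (ρ t) x *
        inner ℝ (kconv (moll (epsSeq n)) (w t) x) (zt n t x)))
    (C := M * ((mollC N * ballVol N * Z) * (mollC N * ballVol N * Z)))
    -- The factor `(Z + 1) * Z` is what `abs_energyRate_le` gives after `l2 w ≤ Z`, `‖U 0‖ + K ≤ β`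
    -- and `l2 G ≤ β`.
    (β := fun t => energyC N * M * ((Z + 1) * Z) * β t)
    (fun n => ((hcutm n).mul (hEm n)).integral_prod_right')
    (fun n => ((hcutm n).mul (hSm n)).integral_prod_right') (fun n l hl => ?_)
    (hβ.continuousOn_mul continuousOn_const isOpen_Ioo.isLocallyClosed) ?_ ?_ ?_ ?_
  · obtain ⟨C, Z', hC⟩ := exists_bound_energyState N H M Z n (R := 2 * ((n : ℝ) + 1))
      (by have := hRp n; positivity)
    have s1 := integral_cut_swap (g := fun t x => kconv (moll (epsSeq n)) (ρ t) x *
      ‖kconv (moll (epsSeq n)) (w t) x‖ ^ 2) (hRp n) (hEm n) (γ := fun _ => |M| * Z' ^ 2)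
      (locallyIntegrableOn_const _) (by
        filter_upwards [h] with t ⟨U, K, ht⟩ x hx
        rw [abs_mul, abs_of_nonneg (sq_nonneg ‖kconv (moll (epsSeq n)) (w t) x‖)]
        exact mul_le_mul ((hmb ht n x).trans (le_abs_self M))
          (pow_le_pow_left₀ (norm_nonneg _) (hC ht x hx).1 2) (sq_nonneg _) (abs_nonneg _))
      hl.continuous_deriv hl.compact.deriv hl.tsupport_deriv_subset
    have s2 := integral_cut_swap (g := fun t x => k n t x * ‖kconv (moll (epsSeq n)) (w t) x‖ ^ 2 +
      2 * kconv (moll (epsSeq n)) (ρ t) x *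
        inner ℝ (kconv (moll (epsSeq n)) (w t) x) (zt n t x)) (hRp n) (hSm n) (γ := fun t => (C * Z' ^ 2 + 2 * |M| * Z' * C) * β t)
      (hβ.continuousOn_mul continuousOn_const isOpen_Ioo.isLocallyClosed) (by
        filter_upwards [h] with t ⟨U, K, ht⟩ x hx
        obtain ⟨b1, b2, b3⟩ := hC ht x hx
        have hZ' : 0 ≤ Z' := (norm_nonneg _).trans b1
        have hCβ : 0 ≤ C * β t := (abs_nonneg _).trans b2
        calc _ ≤ |k n t x| * ‖kconv (moll (epsSeq n)) (w t) x‖ ^ 2 +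
              2 * |kconv (moll (epsSeq n)) (ρ t) x| *
              (‖kconv (moll (epsSeq n)) (w t) x‖ * ‖zt n t x‖) := by
                refine (abs_add_le _ _).trans (add_le_add ?_ ?_)
                · rw [abs_mul, abs_of_nonneg (sq_nonneg ‖kconv (moll (epsSeq n)) (w t) x‖)]
                · rw [abs_mul, abs_mul, abs_two]
                  exact mul_le_mul_of_nonneg_left (abs_real_inner_le_norm _ _) (by positivity)
          _ ≤ C * β t * Z' ^ 2 + 2 * |M| * (Z' * (C * β t)) := by
                gcongr ?_ * ?_ ^ 2 + 2 * ?_ * (?_ * ?_)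
                exact (hmb ht n x).trans (le_abs_self M)
          _ = _ := by ring)
      hl.continuous hl.compact hl.support
    -- Once the time integral is innermost, `x` is fixed and the product rule applies to the
    -- mollified density and field as functions of time alone.
    rw [s1, s2, ← integral_neg]
    refine integral_congr_ae (ae_of_all _ fun x => ?_)
    simp only
    rw [((hρd n x).mul_norm_sq hT (hwd n x)).integral_eq hT hl, mul_neg]
  · filter_upwards [h] with t ⟨U, K, ht⟩ n
    refine (abs_energy_le ht.density_le ht.memLp (epsSeq_pos n) _).trans ?_
    have hM0 : 0 ≤ M := (abs_nonneg _).trans (hmb ht n 0)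
    have := l2_nonneg (w t)
    have := ht.l2_le
    have := hZ0 ht
    gcongr
  · filter_upwards [h] with t ⟨U, K, ht⟩ n
    rw [hrate ht]
    refine (abs_energyRate_le ht.field ht.locInt_density ht.density_le ht.memLp ht.memLp_source
      (epsSeq_pos n) (hR1 n)).trans ?_
    have hM0 : 0 ≤ M := (abs_nonneg _).trans (hmb ht n 0)
    have := energyC_nonneg N
    have h1 := l2_nonneg (w t)
    have h2 := ht.l2_le
    have h3 := ht.field_le
    have h4 := ht.source_le
    have h5 := l2_nonneg (G t)
    have h6 : 0 ≤ ‖U 0‖ + K := by positivity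
    rw [mul_assoc (energyC N * M)]
    refine mul_le_mul_of_nonneg_left ?_ (by positivity)
    calc ((‖U 0‖ + K) * l2 (w t) + l2 (G t)) * l2 (w t)
        ≤ (β t * Z + β t) * Z := by
          have := h6.trans h3
          have := hZ0 ht
          gcongr
      _ = _ := by ring
  · filter_upwards [h] with t ⟨U, K, ht⟩
    exact tendsto_energy ht.locInt_density ht.density_le ht.memLp
  · filter_upwards [h] with t ⟨U, K, ht⟩
    simp_rw [hrate ht]
    exact tendsto_energyRate ht.field ht.locInt_density ht.density_le ht.memLp ht.memLp_source

end WeakEnergy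

end InhomEuler


namespace InhomEuler

open Filter Topology Metric
open scoped ENNReal NNReal

/-! ### The two solutions at a fixed time -/

section Slice

variable {N : ℕ}

lemma HasWeakFDeriv.sub {F : Type*} [NormedAddCommGroup F] [NormedSpace ℝ F]
    {f g : Space N → F} {Df Dg : Space N → Space N →L[ℝ] F} (hf : HasWeakFDeriv f Df)
    (hg : HasWeakFDeriv g Dg) : HasWeakFDeriv (fun x => f x - g x) (fun x => Df x - Dg x) := by
  refine ⟨hf.locInt.sub hg.locInt, hf.locInt_deriv.sub hg.locInt_deriv, fun φ hφ hc v => ?_⟩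
  have hd : Continuous fun x => fderiv ℝ φ x v :=
    (hφ.continuous_fderiv (by simp)).clm_apply continuous_const
  have hdc : HasCompactSupport fun x => fderiv ℝ φ x v := hc.fderiv_apply (𝕜 := ℝ) v
  have i1 : ∀ {f : Space N → F}, LocallyIntegrable f volume →
      Integrable (fun x => fderiv ℝ φ x v • f x) volume := fun hf =>
    hf.integrable_smul_left_of_hasCompactSupport hd hdc
  have i2 : ∀ {D : Space N → Space N →L[ℝ] F}, LocallyIntegrable D volume →
      Integrable (fun x => φ x • D x v) volume := fun hD =>
    (ContinuousLinearMap.apply ℝ F v).integrable_comp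
      (hD.integrable_smul_left_of_hasCompactSupport hφ.continuous hc)
  simp_rw [sub_apply, smul_sub]
  rw [integral_sub (i1 hf.locInt) (i1 hg.locInt),
    integral_sub (i2 hf.locInt_deriv) (i2 hg.locInt_deriv), hf.integral_eq φ hφ hc v,
    hg.integral_eq φ hφ hc v]
  abel

/-- The state of two solutions at a fixed time; `a₁`, `a₂` are the time derivatives of `u₁`, `u₂`
and `b` bounds the Lipschitz norms. -/
structure Slice (lo hi b : ℝ) (ρ₁ ρ₂ : Space N → ℝ) (u₁ u₂ a₁ a₂ P₁ P₂ R₂ : Space N → Space N)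
    (Du₁ Du₂ : Space N → Space N →L[ℝ] Space N) : Prop where
  lo_pos : 0 < lo
  bounds : ∀ᵐ x, lo ≤ ρ₁ x ∧ ρ₁ x ≤ hi ∧ lo ≤ ρ₂ x ∧ ρ₂ x ≤ hi
  weak₁ : HasWeakFDeriv u₁ Du₁
  weak₂ : HasWeakFDeriv u₂ Du₂
  weakDensity : HasWeakGradient ρ₂ R₂
  pressure₁ : ∃ p, HasWeakGradient p P₁
  pressure₂ : ∃ p, HasWeakGradient p P₂
  div₁ : ∀ᵐ x, divOf (Du₁ x) = 0
  div₂ : ∀ᵐ x, divOf (Du₂ x) = 0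
  momentum₁ : ∀ᵐ x, ρ₁ x • (a₁ x + Du₁ x (u₁ x)) + P₁ x = 0
  momentum₂ : ∀ᵐ x, ρ₂ x • (a₂ x + Du₂ x (u₂ x)) + P₂ x = 0
  Du₁_le : ∀ᵐ x, ‖Du₁ x‖ ≤ b
  Du₂_le : ∀ᵐ x, ‖Du₂ x‖ ≤ b
  R₂_le : ∀ᵐ x, ‖R₂ x‖ ≤ b
  P₂_le : ∀ᵐ x, ‖P₂ x‖ ≤ b
  memLp_density : MemLp (fun x => ρ₁ x - ρ₂ x) 2 volume
  memLp_velocity : MemLp (fun x => u₁ x - u₂ x) 2 volume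
  memLp_accel : MemLp (fun x => a₁ x - a₂ x) 2 volume
  locInt_density : LocallyIntegrable ρ₁ volume
  locInt_P₁ : LocallyIntegrable P₁ volume
  locInt_P₂ : LocallyIntegrable P₂ volume

namespace Slice

variable {lo hi b : ℝ} {ρ₁ ρ₂ : Space N → ℝ} {u₁ u₂ a₁ a₂ P₁ P₂ R₂ : Space N → Space N}
    {Du₁ Du₂ : Space N → Space N →L[ℝ] Space N}

lemma nonneg (h : Slice lo hi b ρ₁ ρ₂ u₁ u₂ a₁ a₂ P₁ P₂ R₂ Du₁ Du₂) : 0 ≤ b := by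
  obtain ⟨x, hx⟩ := h.P₂_le.exists
  exact (norm_nonneg _).trans hx

lemma hi_pos (h : Slice lo hi b ρ₁ ρ₂ u₁ u₂ a₁ a₂ P₁ P₂ R₂ Du₁ Du₂) : 0 < hi := by
  obtain ⟨x, hx⟩ := h.bounds.exists
  exact h.lo_pos.trans_le (hx.1.trans hx.2.1)

/-- The material derivative of the velocity difference along `u₁`. -/
def source (u₁ a₁ a₂ : Space N → Space N) (Du₁ Du₂ : Space N → Space N →L[ℝ] Space N)
    (x : Space N) : Space N := a₁ x - a₂ x + (Du₁ x - Du₂ x) (u₁ x)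

/-- Velocities with bounded weak gradients have Lipschitz representatives. The constant of `W` is
never used quantitatively: the bound in `memLp_pressure` involves only that of `U`. -/
lemma exists_velocity (h : Slice lo hi b ρ₁ ρ₂ u₁ u₂ a₁ a₂ P₁ P₂ R₂ Du₁ Du₂) :
    ∃ U W, LipDivFree U b.toNNReal ∧ LipDivFree W (b.toNNReal + b.toNNReal) ∧ u₁ =ᵐ[volume] U ∧
      (fun x => u₁ x - u₂ x) =ᵐ[volume] W ∧
      (fun x => Du₁ x - Du₂ x) =ᵐ[volume] fderiv ℝ W := by
  have hb : b = (b.toNNReal : ℝ) := (Real.coe_toNNReal _ h.nonneg).symm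
  obtain ⟨U, hU, hU1, hU2⟩ := h.weak₁.exists_lipschitzWith (L := b.toNNReal)
    (h.Du₁_le.mono fun x hx => hx.trans_eq hb)
  obtain ⟨V, hV, hV1, hV2⟩ := h.weak₂.exists_lipschitzWith (L := b.toNNReal)
    (h.Du₂_le.mono fun x hx => hx.trans_eq hb)
  have hD : (fun x => Du₁ x - Du₂ x) =ᵐ[volume] fderiv ℝ fun x => U x - V x := by
    filter_upwards [hU2, hV2, hU.ae_differentiableAt, hV.ae_differentiableAt] with x h1 h2 h3 h4
    rw [fderiv_fun_sub h3 h4, h1, h2]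
  refine ⟨U, fun x => U x - V x, ⟨hU, ?_⟩, ⟨hU.sub hV, ?_⟩, hU1, hU1.sub hV1, hD⟩
  · filter_upwards [h.div₁, hU2] with x h1 h2
    rwa [← h2]
  · filter_upwards [h.div₁, h.div₂, hD] with x h1 h2 h3
    rw [← h3]
    have : divOf (Du₁ x - Du₂ x) = divOf (Du₁ x) - divOf (Du₂ x) := by
      simp [divOf, Finset.sum_sub_distrib]
    rw [this, h1, h2, sub_zero]

lemma exists_density (h : Slice lo hi b ρ₁ ρ₂ u₁ u₂ a₁ a₂ P₁ P₂ R₂ Du₁ Du₂) :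
    ∃ r, LipschitzWith b.toNNReal r ∧ ρ₂ =ᵐ[volume] r ∧
      ∀ᵐ x, ∀ v, inner ℝ (R₂ x) v = fderiv ℝ r x v := by
  have hb : b = (b.toNNReal : ℝ) := (Real.coe_toNNReal _ h.nonneg).symm
  obtain ⟨r, hr, hr1, hr2⟩ := HasWeakFDeriv.exists_lipschitzWith h.weakDensity (L := b.toNNReal)
    (h.R₂_le.mono fun x hx => by rw [innerSL_apply_norm]; exact hx.trans_eq hb)
  refine ⟨r, hr, hr1, hr2.mono fun x hx v => ?_⟩
  rw [← hx, innerSL_apply_apply]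

/-- The right hand side of the momentum equation for the difference, without the pressure. -/
noncomputable def forcing (ρ₁ ρ₂ : Space N → ℝ) (u₁ u₂ P₂ : Space N → Space N)
    (Du₂ : Space N → Space N →L[ℝ] Space N) (x : Space N) : Space N :=
  ((ρ₁ x - ρ₂ x) / ρ₂ x) • P₂ x - ρ₁ x • Du₂ x (u₁ x - u₂ x)

/-- In the difference of the two equations the acceleration `a₂ + Du₂ u₂` of the second solution
gets the factor `ρ₂ - ρ₁`, and is replaced by `-P₂ / ρ₂`. The convection splits as `(Du₁ - Du₂) u₁ +
Du₂ (u₁ - u₂)`, so that the first part is transport by `u₁`. -/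
lemma ae_momentum (h : Slice lo hi b ρ₁ ρ₂ u₁ u₂ a₁ a₂ P₁ P₂ R₂ Du₁ Du₂) :
    ∀ᵐ x, ρ₁ x • source u₁ a₁ a₂ Du₁ Du₂ x
      = forcing ρ₁ ρ₂ u₁ u₂ P₂ Du₂ x - (P₁ x - P₂ x) := by
  filter_upwards [h.momentum₁, h.momentum₂, h.bounds] with x h1 h2 h3
  have hpos : 0 < ρ₂ x := h.lo_pos.trans_le h3.2.2.1
  have e1 : P₁ x = -(ρ₁ x • (a₁ x + Du₁ x (u₁ x))) := (neg_eq_of_add_eq_zero_right h1).symm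
  have e2 : P₂ x = -(ρ₂ x • (a₂ x + Du₂ x (u₂ x))) := (neg_eq_of_add_eq_zero_right h2).symm
  have e3 : ((ρ₁ x - ρ₂ x) / ρ₂ x) • P₂ x = (ρ₂ x - ρ₁ x) • (a₂ x + Du₂ x (u₂ x)) := by
    rw [e2, smul_neg, smul_smul, div_mul_cancel₀ _ hpos.ne', ← neg_smul, neg_sub]
  rw [source, forcing, e3, e1, e2, map_sub, sub_apply]
  module

lemma memLp_forcing (h : Slice lo hi b ρ₁ ρ₂ u₁ u₂ a₁ a₂ P₁ P₂ R₂ Du₁ Du₂) :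
    MemLp (forcing ρ₁ ρ₂ u₁ u₂ P₂ Du₂) 2 volume ∧ l2 (forcing ρ₁ ρ₂ u₁ u₂ P₂ Du₂)
      ≤ b / lo * l2 (fun x => ρ₁ x - ρ₂ x) + hi * b * l2 (fun x => u₁ x - u₂ x) := by
  have hb := h.nonneg
  have hlo := h.lo_pos
  have hhi := h.hi_pos
  have m1 : AEStronglyMeasurable (fun x => ((ρ₁ x - ρ₂ x) / ρ₂ x) • P₂ x) volume :=
    ((h.memLp_density.1.aemeasurable.div
      h.weakDensity.locInt.aestronglyMeasurable.aemeasurable).aestronglyMeasurable).smul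
      h.locInt_P₂.aestronglyMeasurable
  have m2 : AEStronglyMeasurable (fun x => ρ₁ x • Du₂ x (u₁ x - u₂ x)) volume :=
    h.locInt_density.aestronglyMeasurable.smul
      (isBoundedBilinearMap_apply.continuous.comp_aestronglyMeasurable
        (h.weak₂.locInt_deriv.aestronglyMeasurable.prodMk h.memLp_velocity.1))
  have b1 : ∀ᵐ x, ‖((ρ₁ x - ρ₂ x) / ρ₂ x) • P₂ x‖ ≤ b / lo * ‖ρ₁ x - ρ₂ x‖ := by
    filter_upwards [h.P₂_le, h.bounds] with x h1 h2
    rw [norm_smul, norm_div, Real.norm_of_nonneg (hlo.le.trans h2.2.2.1)]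
    calc ‖ρ₁ x - ρ₂ x‖ / ρ₂ x * ‖P₂ x‖ ≤ ‖ρ₁ x - ρ₂ x‖ / lo * b := by
          gcongr
          exact h2.2.2.1
      _ = _ := by ring
  have b2 : ∀ᵐ x, ‖ρ₁ x • Du₂ x (u₁ x - u₂ x)‖ ≤ hi * b * ‖u₁ x - u₂ x‖ := by
    filter_upwards [h.Du₂_le, h.bounds] with x h1 h2
    rw [norm_smul, Real.norm_of_nonneg (hlo.le.trans h2.1), mul_assoc]
    exact mul_le_mul h2.2.1 (((Du₂ x).le_opNorm _).trans
      (mul_le_mul_of_nonneg_right h1 (norm_nonneg _))) (norm_nonneg _) hhi.le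
  have l1 := memLp_two_of_le_mul h.memLp_density m1 b1
  have l2' := memLp_two_of_le_mul h.memLp_velocity m2 b2
  exact ⟨l1.sub l2', (l2_sub_le l1 l2').trans (add_le_add
    (l2_le_mul (by positivity) h.memLp_density b1)
    (l2_le_mul (by positivity) h.memLp_velocity b2))⟩

lemma memLp_inv_smul (h : Slice lo hi b ρ₁ ρ₂ u₁ u₂ a₁ a₂ P₁ P₂ R₂ Du₁ Du₂)
    {f : Space N → Space N} (hf : MemLp f 2 volume) :
    MemLp (fun x => (ρ₁ x)⁻¹ • f x) 2 volume ∧ l2 (fun x => (ρ₁ x)⁻¹ • f x) ≤ lo⁻¹ * l2 f := by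
  have hlo := h.lo_pos
  have b1 : ∀ᵐ x, ‖(ρ₁ x)⁻¹ • f x‖ ≤ lo⁻¹ * ‖f x‖ := by
    filter_upwards [h.bounds] with x h2
    rw [norm_smul, norm_inv, Real.norm_of_nonneg (hlo.le.trans h2.1)]
    gcongr
    exact h2.1
  have m1 : AEStronglyMeasurable (fun x => (ρ₁ x)⁻¹ • f x) volume :=
    (h.locInt_density.aestronglyMeasurable.aemeasurable.inv.aestronglyMeasurable).smul hf.1
  exact ⟨memLp_two_of_le_mul hf m1 b1, l2_le_mul (by positivity) hf b1⟩

/-- Application of `memLp_pressure` with `U = u₁`, `W = u₁ - u₂` and `F` equal to `ρ₁⁻¹` times the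
forcing minus the difference of the time derivatives. The last term requires the `L²` regularity of
`∂ₜδu`; the resulting bound is needed only for integrability. -/
lemma memLp_pressure_diff (h : Slice lo hi b ρ₁ ρ₂ u₁ u₂ a₁ a₂ P₁ P₂ R₂ Du₁ Du₂) :
    MemLp (fun x => P₁ x - P₂ x) 2 volume ∧ l2 (fun x => P₁ x - P₂ x) ≤
      hi * (lo⁻¹ * l2 (forcing ρ₁ ρ₂ u₁ u₂ P₂ Du₂) + l2 (fun x => a₁ x - a₂ x)
        + b * (1 + 8 * cutC N) * l2 (fun x => u₁ x - u₂ x)) := by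
  obtain ⟨U, W, hU, hW, hU1, hW1, hW2⟩ := h.exists_velocity
  obtain ⟨p₁, hp₁⟩ := h.pressure₁
  obtain ⟨p₂, hp₂⟩ := h.pressure₂
  have hp : HasWeakGradient (fun x => p₁ x - p₂ x) (fun x => P₁ x - P₂ x) := by
    have := HasWeakFDeriv.sub hp₁ hp₂
    unfold HasWeakGradient
    simp_rw [map_sub]
    exact this
  have hf := h.memLp_inv_smul h.memLp_forcing.1
  have hF := hf.1.sub h.memLp_accel
  have hlW : l2 (fun x => u₁ x - u₂ x) = l2 W := l2_congr hW1
  have key := memLp_pressure hU hW ((memLp_congr_ae hW1).1 h.memLp_velocity) h.lo_pos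
    (h.bounds.mono fun x hx => ⟨hx.1, hx.2.1⟩) hp (h.locInt_P₁.sub h.locInt_P₂) hF (by
      filter_upwards [h.ae_momentum, h.bounds, hU1, hW2] with x h1 h2 h3 h4
      have hpos : ρ₁ x ≠ 0 := (h.lo_pos.trans_le h2.1).ne'
      rw [← h4, ← h3, Pi.sub_apply, smul_sub, smul_sub, smul_smul, mul_inv_cancel₀ hpos, one_smul]
      rw [source, smul_add] at h1
      rw [eq_sub_iff_add_eq] at h1
      rw [← h1]
      abel)
  refine ⟨key.1, key.2.trans (mul_le_mul_of_nonneg_left ?_ h.hi_pos.le)⟩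
  rw [hlW, Real.coe_toNNReal _ h.nonneg]
  gcongr
  exact (l2_sub_le hf.1 h.memLp_accel).trans (by gcongr; exact hf.2)

lemma memLp_source (h : Slice lo hi b ρ₁ ρ₂ u₁ u₂ a₁ a₂ P₁ P₂ R₂ Du₁ Du₂) :
    MemLp (source u₁ a₁ a₂ Du₁ Du₂) 2 volume ∧ l2 (source u₁ a₁ a₂ Du₁ Du₂) ≤
      lo⁻¹ * (l2 (forcing ρ₁ ρ₂ u₁ u₂ P₂ Du₂) + l2 (fun x => P₁ x - P₂ x)) := by
  have h1 := h.memLp_forcing.1.sub h.memLp_pressure_diff.1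
  have h2 := h.memLp_inv_smul h1
  have he : source u₁ a₁ a₂ Du₁ Du₂ =ᵐ[volume]
      fun x => (ρ₁ x)⁻¹ • (forcing ρ₁ ρ₂ u₁ u₂ P₂ Du₂ - fun x => P₁ x - P₂ x) x := by
    filter_upwards [h.ae_momentum, h.bounds] with x h3 h4
    have hpos : ρ₁ x ≠ 0 := (h.lo_pos.trans_le h4.1).ne'
    rw [Pi.sub_apply, ← h3, smul_smul, inv_mul_cancel₀ hpos, one_smul]
  refine ⟨(memLp_congr_ae he).2 h2.1, (l2_congr he).trans_le (h2.2.trans ?_)⟩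
  exact mul_le_mul_of_nonneg_left (l2_sub_le h.memLp_forcing.1 h.memLp_pressure_diff.1)
    (inv_nonneg.2 h.lo_pos.le)

/-- The rate of change of the kinetic energy of the velocity difference: the pressure drops out. -/
lemma integral_source (hN : 0 < N) (h : Slice lo hi b ρ₁ ρ₂ u₁ u₂ a₁ a₂ P₁ P₂ R₂ Du₁ Du₂) :
    ∫ x, ρ₁ x * inner ℝ (u₁ x - u₂ x) (source u₁ a₁ a₂ Du₁ Du₂ x)
      = ∫ x, (1 : ℝ) * inner ℝ (u₁ x - u₂ x) (forcing ρ₁ ρ₂ u₁ u₂ P₂ Du₂ x) := by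
  obtain ⟨U, W, hU, hW, hU1, hW1, hW2⟩ := h.exists_velocity
  obtain ⟨p₁, hp₁⟩ := h.pressure₁
  obtain ⟨p₂, hp₂⟩ := h.pressure₂
  have hp : HasWeakGradient (fun x => p₁ x - p₂ x) (fun x => P₁ x - P₂ x) := by
    have := HasWeakFDeriv.sub hp₁ hp₂
    unfold HasWeakGradient
    simp_rw [map_sub]
    exact this
  have hWm := (memLp_congr_ae hW1).1 h.memLp_velocity
  have h0 := integral_inner_gradient_eq_zero hN hW hWm hp h.memLp_pressure_diff.1
  have h1 : ∫ x, (1 : ℝ) * inner ℝ (u₁ x - u₂ x) (P₁ x - P₂ x) = 0 := by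
    rw [← h0]
    refine integral_congr_ae ?_
    filter_upwards [hW1] with x hx
    rw [one_mul, hx, real_inner_comm]
  have hone : ∀ᵐ x : Space N, |(1 : ℝ)| ≤ 1 := ae_of_all _ fun x => by simp
  have i1 := integrable_mul_inner h.memLp_velocity h.memLp_forcing.1
    (aestronglyMeasurable_const (b := (1 : ℝ))) hone
  have i2 := integrable_mul_inner h.memLp_velocity h.memLp_pressure_diff.1
    (aestronglyMeasurable_const (b := (1 : ℝ))) hone
  rw [← sub_zero (∫ x, (1 : ℝ) * inner ℝ (u₁ x - u₂ x) (forcing ρ₁ ρ₂ u₁ u₂ P₂ Du₂ x)), ← h1,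
    ← integral_sub i1 i2]
  refine integral_congr_ae ?_
  filter_upwards [h.ae_momentum] with x hx
  rw [← mul_sub, ← inner_sub_right, ← hx, inner_smul_right, one_mul]

lemma abs_integral_source_le (hN : 0 < N)
    (h : Slice lo hi b ρ₁ ρ₂ u₁ u₂ a₁ a₂ P₁ P₂ R₂ Du₁ Du₂) :
    |∫ x, ρ₁ x * inner ℝ (u₁ x - u₂ x) (source u₁ a₁ a₂ Du₁ Du₂ x)|
      ≤ l2 (fun x => u₁ x - u₂ x) *
        (b / lo * l2 (fun x => ρ₁ x - ρ₂ x) + hi * b * l2 (fun x => u₁ x - u₂ x)) := by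
  rw [h.integral_source hN]
  refine (abs_integral_mul_inner_le zero_le_one h.memLp_velocity h.memLp_forcing.1
    (ae_of_all _ fun x => by simp)).trans ?_
  rw [one_mul]
  exact mul_le_mul_of_nonneg_left h.memLp_forcing.2 (l2_nonneg _)

/-- The right hand side of the transport equation for the density difference. -/
noncomputable def densitySource (u₁ u₂ R₂ : Space N → Space N) (x : Space N) : ℝ :=
  -inner ℝ (R₂ x) (u₁ x - u₂ x)

lemma memLp_densitySource (h : Slice lo hi b ρ₁ ρ₂ u₁ u₂ a₁ a₂ P₁ P₂ R₂ Du₁ Du₂) :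
    MemLp (densitySource u₁ u₂ R₂) 2 volume ∧
      l2 (densitySource u₁ u₂ R₂) ≤ b * l2 (fun x => u₁ x - u₂ x) := by
  obtain ⟨r, hr, hr1, hr2⟩ := h.exists_density
  have hm : AEStronglyMeasurable (densitySource u₁ u₂ R₂) volume := by
    have h1 : AEStronglyMeasurable (fun x => -(innerSL ℝ (R₂ x) (u₁ x - u₂ x) : ℝ)) volume :=
      (isBoundedBilinearMap_apply.continuous.comp_aestronglyMeasurable
        (h.weakDensity.locInt_deriv.aestronglyMeasurable.prodMk h.memLp_velocity.1)).neg
    exact h1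
  have hb : ∀ᵐ x, ‖densitySource u₁ u₂ R₂ x‖ ≤ b * ‖u₁ x - u₂ x‖ := by
    filter_upwards [h.R₂_le] with x hx
    rw [densitySource, norm_neg]
    exact (norm_inner_le_norm _ _).trans (mul_le_mul_of_nonneg_right hx (norm_nonneg _))
  exact ⟨memLp_two_of_le_mul h.memLp_velocity hm hb, l2_le_mul h.nonneg h.memLp_velocity hb⟩

/-- The velocity at the origin is controlled by its mean and the Lipschitz constant. -/
lemma norm_apply_zero_le {U : Space N → Space N} {K : ℝ≥0} (hU : LipschitzWith K U)
    {u : Space N → Space N} (hu : u =ᵐ[volume] U) :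
    ‖U 0‖ ≤ (ballVol N)⁻¹ * (∫ y in closedBall (0 : Space N) 1, ‖u y‖) + K := by
  have hV := ballVol_pos N
  have hi : IntegrableOn (fun y => ‖U y‖) (closedBall (0 : Space N) 1) volume :=
    hU.continuous.norm.locallyIntegrable.integrableOn_isCompact (isCompact_closedBall _ _)
  have h1 : ∫ y in closedBall (0 : Space N) 1, (‖U 0‖ - K)
      ≤ ∫ y in closedBall (0 : Space N) 1, ‖U y‖ := by
    refine setIntegral_mono_on (integrableOn_const measure_closedBall_lt_top.ne) hi
      measurableSet_closedBall fun y hy => ?_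
    have h2 := hU.dist_le_mul 0 y
    rw [dist_eq_norm, dist_comm, dist_zero_right] at h2
    have h3 : ‖y‖ ≤ 1 := by simpa using hy
    have h4 : (K : ℝ) * ‖y‖ ≤ K * 1 := mul_le_mul_of_nonneg_left h3 K.2
    have h5 := norm_sub_norm_le (U 0) (U y)
    linarith
  rw [setIntegral_const, smul_eq_mul] at h1
  have h6 : ∫ y in closedBall (0 : Space N) 1, ‖u y‖
      = ∫ y in closedBall (0 : Space N) 1, ‖U y‖ :=
    integral_congr_ae (ae_restrict_of_ae (hu.mono fun y hy => by simp only [hy]))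
  rw [h6]
  have h7 : (ballVol N)⁻¹ * (ballVol N * (‖U 0‖ - K))
      ≤ (ballVol N)⁻¹ * ∫ y in closedBall (0 : Space N) 1, ‖U y‖ :=
    mul_le_mul_of_nonneg_left h1 (inv_nonneg.2 hV.le)
  rw [← mul_assoc, inv_mul_cancel₀ hV.ne', one_mul] at h7
  linarith

/-- The fluxes satisfy `ρ₁ u₁ - ρ₂ u₂ = (ρ₁ - ρ₂) u₁ + ρ₂ (u₁ - u₂)`. The divergence of the first
product is transport of the difference by `u₁`; the second has divergence `∇ρ₂ · (u₁ - u₂)`, because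
`ρ₂` has a Lipschitz representative and `u₁ - u₂` is divergence free. -/
lemma energyState_density (h : Slice lo hi b ρ₁ ρ₂ u₁ u₂ a₁ a₂ P₁ P₂ R₂ Du₁ Du₂) {Z β : ℝ}
    (hZ : l2 (fun x => ρ₁ x - ρ₂ x) ≤ Z) {U W : Space N → Space N} {K : ℝ≥0}
    (hU : LipDivFree U b.toNNReal) (hW : LipDivFree W K) (hU1 : u₁ =ᵐ[volume] U)
    (hW1 : (fun x => u₁ x - u₂ x) =ᵐ[volume] W)
    (hβ : ‖U 0‖ + b.toNNReal ≤ β) (hβ' : b * l2 (fun x => u₁ x - u₂ x) ≤ β) :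
    EnergyState 1 Z β (fun _ => (1 : ℝ)) (fun x => ρ₁ x - ρ₂ x) (densitySource u₁ u₂ R₂) U
      b.toNNReal (fun _ _ => 0) (fun n x =>
        -(∫ y, fderiv ℝ (moll (epsSeq n)) (x - y) (ρ₁ y • u₁ y))
          - -∫ y, fderiv ℝ (moll (epsSeq n)) (x - y) (ρ₂ y • u₂ y)) where
  field := hU
  locInt_density := locallyIntegrable_const _
  density_le := ae_of_all _ fun x => by simp
  memLp := h.memLp_density
  l2_le := hZ
  memLp_source := h.memLp_densitySource.1
  field_le := hβ
  source_le := h.memLp_densitySource.2.trans hβ'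
  density_eq n x := by rw [transOp_one (epsSeq_pos n) hU, neg_zero]
  velocity_eq n x := by
    obtain ⟨r, hr, hr1, hr2⟩ := h.exists_density
    have hε := epsSeq_pos n
    have e1 : kconv (moll (epsSeq n)) (densitySource u₁ u₂ R₂) x = -transOp (epsSeq n) W r x := by
      rw [transOp_of_lipschitz hε hW hr, kconv, kconv, ← integral_neg]
      refine integral_congr_ae ?_
      filter_upwards [hr2, hW1] with y h1 h2
      rw [densitySource, h1, h2, smul_neg]
    have e2 : transOp (epsSeq n) U (fun x => ρ₁ x - ρ₂ x) x
        = (∫ y, fderiv ℝ (moll (epsSeq n)) (x - y) (ρ₁ y • u₁ y))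
          - ∫ y, fderiv ℝ (moll (epsSeq n)) (x - y) (ρ₂ y • U y) := by
      have i1 := integrable_fderiv_moll_smul hε hU.continuous h.locInt_density x
      have i2 := integrable_fderiv_moll_smul hε hU.continuous h.weakDensity.locInt x
      have : ∫ y, fderiv ℝ (moll (epsSeq n)) (x - y) (ρ₁ y • u₁ y)
          = ∫ y, fderiv ℝ (moll (epsSeq n)) (x - y) (U y) • ρ₁ y := by
        refine integral_congr_ae (hU1.mono fun y hy => ?_)
        simp only [hy, map_smul, smul_eq_mul]
        ring
      rw [this]
      simp_rw [map_smul, smul_eq_mul, mul_comm (ρ₂ _)]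
      simp only [smul_eq_mul] at i1 i2
      unfold transOp
      simp_rw [smul_eq_mul]
      rw [← integral_sub i1 i2]
      simp_rw [mul_sub]
    have e3 : transOp (epsSeq n) W r x
        = (∫ y, fderiv ℝ (moll (epsSeq n)) (x - y) (ρ₂ y • U y))
          - ∫ y, fderiv ℝ (moll (epsSeq n)) (x - y) (ρ₂ y • u₂ y) := by
      have i1 := integrable_fderiv_moll_smul hε hU.continuous h.weakDensity.locInt x
      have i2 := integrable_fderiv_moll_smul hε hW.continuous h.weakDensity.locInt x
      have e4 : ∫ y, fderiv ℝ (moll (epsSeq n)) (x - y) (ρ₂ y • u₂ y)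
          = (∫ y, fderiv ℝ (moll (epsSeq n)) (x - y) (U y) • ρ₂ y)
            - ∫ y, fderiv ℝ (moll (epsSeq n)) (x - y) (W y) • ρ₂ y := by
        rw [← integral_sub i1 i2]
        refine integral_congr_ae ?_
        filter_upwards [hU1, hW1] with y h1 h2
        have h3 : u₂ y = U y - W y := by rw [← h1, ← h2]; abel
        simp only [h3, map_smul, map_sub, smul_eq_mul]
        ring
      rw [e4]
      simp_rw [map_smul, smul_eq_mul, mul_comm (ρ₂ _)]
      rw [sub_sub_cancel]
      exact integral_congr_ae (hr1.mono fun y hy => by simp only [hy, smul_eq_mul])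
    rw [e1, e2, e3]
    ring

/-- `source` is the time derivative plus transport by `u₁`. The difference of velocities is
Lipschitz, so mollifying its transport in divergence form or in the form `U · ∇W` gives the same
result. -/
lemma energyState_velocity (h : Slice lo hi b ρ₁ ρ₂ u₁ u₂ a₁ a₂ P₁ P₂ R₂ Du₁ Du₂) {Z β : ℝ}
    (hZ : l2 (fun x => u₁ x - u₂ x) ≤ Z) {U W : Space N → Space N} {K : ℝ≥0}
    (hU : LipDivFree U b.toNNReal) (hW : LipDivFree W K) (hU1 : u₁ =ᵐ[volume] U)
    (hW1 : (fun x => u₁ x - u₂ x) =ᵐ[volume] W)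
    (hW2 : (fun x => Du₁ x - Du₂ x) =ᵐ[volume] fderiv ℝ W)
    (hβ : ‖U 0‖ + b.toNNReal ≤ β) (hβ' : l2 (source u₁ a₁ a₂ Du₁ Du₂) ≤ β) :
    EnergyState hi Z β ρ₁ (fun x => u₁ x - u₂ x) (source u₁ a₁ a₂ Du₁ Du₂) U
      b.toNNReal (fun n x => -∫ y, fderiv ℝ (moll (epsSeq n)) (x - y) (ρ₁ y • u₁ y))
      (fun n x => kconv (moll (epsSeq n)) (fun y => a₁ y - a₂ y) x) where
  field := hU
  locInt_density := h.locInt_density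
  density_le := h.bounds.mono fun x hx => by
    rw [Real.norm_of_nonneg (h.lo_pos.le.trans hx.1)]; exact hx.2.1
  memLp := h.memLp_velocity
  l2_le := hZ
  memLp_source := h.memLp_source.1
  field_le := hβ
  source_le := hβ'
  density_eq n x := by
    unfold transOp
    congr 1
    refine integral_congr_ae (hU1.mono fun y hy => ?_)
    simp only [hy, map_smul, smul_eq_mul]
    ring
  velocity_eq n x := by
    have hε := epsSeq_pos n
    have hηc := moll_hasCompactSupport (N := N) hε
    have hη := (moll_contDiff (N := N) (epsSeq n)).continuous
    have e1 : transOp (epsSeq n) U (fun x => u₁ x - u₂ x) x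
        = kconv (moll (epsSeq n)) (fun y => fderiv ℝ W y (U y)) x := by
      rw [← transOp_of_lipschitz hε hU hW.lip]
      exact integral_congr_ae (hW1.mono fun y hy => by simp only [hy])
    have hs := h.memLp_source.1.locallyIntegrable (by norm_num)
    have ha := h.memLp_accel.locallyIntegrable (by norm_num)
    have i1 := integrable_kconv hη hηc hs x
    have i2 := integrable_kconv hη hηc ha x
    have e2 : ∀ᵐ y, fderiv ℝ W y (U y) = source u₁ a₁ a₂ Du₁ Du₂ y - (a₁ y - a₂ y) := by
      filter_upwards [hU1, hW2] with y h1 h2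
      rw [source, ← h2, ← h1]
      abel
    have e3 : kconv (moll (epsSeq n)) (fun y => fderiv ℝ W y (U y)) x
        = kconv (moll (epsSeq n)) (source u₁ a₁ a₂ Du₁ Du₂) x
          - kconv (moll (epsSeq n)) (fun y => a₁ y - a₂ y) x := by
      unfold kconv
      rw [← integral_sub i1 i2]
      exact integral_congr_ae (e2.mono fun y hy => by simp only [hy, smul_sub])
    rw [e1, e3, sub_sub_cancel]

end Slice

end Slice

end InhomEuler


namespace InhomEuler

open Filter Topology Metric
open scoped ENNReal NNReal

/-! ### Modification and uniqueness of weak time derivatives -/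

section WeakDerivCongr

variable {T : ℝ} {a a' b b' : ℝ → ℝ}

lemma HasWeakDeriv.congr (ha : HasWeakDeriv T a a') (h : a =ᵐ[timeMeasure T] b)
    (h' : a' =ᵐ[timeMeasure T] b') : HasWeakDeriv T b b' := by
  obtain ⟨c, hc⟩ := ha.ae_eq
  have hu : ∀ s ∈ Ioo 0 T, ∀ t ∈ Ioo 0 T, a' =ᵐ[volume.restrict (uIoc s t)] b' :=
    fun s hs t ht => ae_mono (Measure.restrict_mono
      (uIoc_subset_uIcc.trans (uIcc_subset_Ioo hs ht)) le_rfl) h'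
  refine ⟨fun s hs t ht => (ha.intervalIntegrable s hs t ht).congr_ae (hu s hs t ht), c, ?_⟩
  filter_upwards [hc, h, ae_restrict_mem measurableSet_Ioo] with t h1 h2 ht
  rw [← h2, h1]
  congr 1
  refine intervalIntegral.integral_congr_ae ?_
  exact (ae_restrict_iff' measurableSet_uIoc).1 (hu _ (half_mem ht) t ht)

lemma HasWeakDeriv.sub (ha : HasWeakDeriv T a a') (hb : HasWeakDeriv T b b') :
    HasWeakDeriv T (fun t => a t - b t) (fun t => a' t - b' t) := by
  obtain ⟨c, hc⟩ := ha.ae_eq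
  obtain ⟨d, hd⟩ := hb.ae_eq
  refine ⟨fun s hs t ht => (ha.intervalIntegrable s hs t ht).sub (hb.intervalIntegrable s hs t ht),
    c - d, ?_⟩
  filter_upwards [hc, hd, ae_restrict_mem measurableSet_Ioo] with t h1 h2 ht
  rw [h1, h2, intervalIntegral.integral_sub (ha.intervalIntegrable _ (half_mem ht) t ht)
    (hb.intervalIntegrable _ (half_mem ht) t ht)]
  ring

lemma hasWeakDeriv_of_hasDerivAt (hd : ∀ t ∈ Ioo 0 T, HasDerivAt a (a' t) t)
    (hc : ContinuousOn a' (Ioo 0 T)) : HasWeakDeriv T a a' := by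
  have hi : ∀ s ∈ Ioo 0 T, ∀ t ∈ Ioo 0 T, IntervalIntegrable a' volume s t :=
    fun s hs t ht => (hc.mono (uIcc_subset_Ioo hs ht)).intervalIntegrable
  refine ⟨hi, a (T / 2), ?_⟩
  filter_upwards [ae_restrict_mem measurableSet_Ioo] with t ht
  rw [intervalIntegral.integral_eq_sub_of_hasDerivAt
    (fun x hx => hd x (uIcc_subset_Ioo (half_mem ht) ht hx)) (hi _ (half_mem ht) t ht)]
  ring

lemma HasWeakDeriv.locallyIntegrableOn (hT : 0 < T) (ha : HasWeakDeriv T a a') :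
    LocallyIntegrableOn a' (Ioo 0 T) volume := by
  rw [locallyIntegrableOn_iff isOpen_Ioo.isLocallyClosed]
  intro k hkT hk
  rcases k.eq_empty_or_nonempty with rfl | hne
  · simp
  obtain ⟨m, hm, hm'⟩ := hk.exists_isLeast hne
  obtain ⟨M, hM, hM'⟩ := hk.exists_isGreatest hne
  have h1 : m / 2 ∈ Ioo 0 T := ⟨by linarith [(hkT hm).1], by linarith [(hkT hm).1, (hkT hm).2]⟩
  have h2 := (intervalIntegrable_iff_integrableOn_Ioc_of_le
    (by linarith [(hkT hm).1, hm' hM])).1 (ha.intervalIntegrable _ h1 M (hkT hM))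
  exact h2.mono_set fun x hx => ⟨by linarith [(hkT hm).1, hm' hx], hM' hx⟩

lemma HasWeakDeriv.unique (hT : 0 < T) (ha : HasWeakDeriv T a a') (hb : HasWeakDeriv T a b') :
    a' =ᵐ[timeMeasure T] b' := by
  have h := isOpen_Ioo.ae_eq_zero_of_integral_contDiff_smul_eq_zero
    ((ha.locallyIntegrableOn hT).sub (hb.locallyIntegrableOn hT)) fun l hl hlc hls => by
      have i1 := (integrable_time_mul (ha.locallyIntegrableOn hT) hl.continuous hlc hls)
      have i2 := (integrable_time_mul (hb.locallyIntegrableOn hT) hl.continuous hlc hls)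
      have e1 := ha.integral_eq hT ⟨hl, hlc, hls⟩
      have e2 := hb.integral_eq hT ⟨hl, hlc, hls⟩
      rw [e1, neg_inj, integral_time_eq hls, integral_time_eq hls] at e2
      simp_rw [smul_eq_mul]
      rw [integral_time_eq hls]
      simp_rw [Pi.sub_apply, mul_sub]
      rw [integral_sub i1 i2, e2, sub_self]
  rw [EventuallyEq, ae_restrict_iff' measurableSet_Ioo]
  filter_upwards [h] with t ht hts
  exact sub_eq_zero.1 (ht hts)

end WeakDerivCongr

/-! ### Measurability of essential suprema in time -/

section EssSup

variable {N : ℕ} {T : ℝ} {F : Type*} [NormedAddCommGroup F]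

/-- The essential supremum at time `t` exceeds `c` exactly when the slice at `t` of the superlevel
set has positive measure, and measures of slices depend measurably on `t`. -/
lemma aemeasurable_eLpNorm_top {f : ℝ → Space N → F}
    (hf : AEStronglyMeasurable (Function.uncurry f) ((timeMeasure T).prod volume)) :
    AEMeasurable (fun t => eLpNorm (f t) ⊤ (volume : Measure (Space N))) (timeMeasure T) := by
  obtain ⟨g, hg, hfg⟩ := hf
  refine ⟨fun t => eLpNorm (fun x => g (t, x)) ⊤ volume, ?_, ?_⟩
  · refine measurable_of_Ioi fun c => ?_
    have h1 : MeasurableSet {p : ℝ × Space N | c < ‖g p‖ₑ} :=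
      measurableSet_lt measurable_const hg.enorm
    have h2 : (fun t => eLpNorm (fun x => g (t, x)) ⊤ (volume : Measure (Space N))) ⁻¹' Ioi c
        = (fun t => volume (Prod.mk t ⁻¹' {p : ℝ × Space N | c < ‖g p‖ₑ})) ⁻¹' {0}ᶜ := by
      ext t
      rw [mem_preimage, mem_preimage, mem_compl_iff, mem_singleton_iff, mem_Ioi,
        eLpNorm_exponent_top, ← not_le, not_iff_not]
      constructor
      · intro h
        have h3 : ∀ᵐ x : Space N, ‖g (t, x)‖ₑ ≤ c := by
          filter_upwards [enorm_ae_le_eLpNormEssSup (fun x => g (t, x)) volume] with x hx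
          exact hx.trans h
        rw [ae_iff] at h3
        simpa using h3
      · intro h
        refine essSup_le_of_ae_le c ?_
        rw [EventuallyLE, ae_iff]
        simpa using h
    rw [h2]
    exact measurable_measure_prodMk_left h1 (measurableSet_singleton _).compl
  · filter_upwards [Measure.ae_ae_of_ae_prod hfg] with t ht
    exact eLpNorm_congr_ae ht

lemma norm_le_toReal_of_eLpNorm_top_le {f : Space N → F} {c : ℝ≥0∞} (hc : c ≠ ⊤)
    (h : eLpNorm f ⊤ volume ≤ c) : ∀ᵐ x, ‖f x‖ ≤ c.toReal := by
  rw [eLpNorm_exponent_top] at h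
  filter_upwards [enorm_ae_le_eLpNormEssSup f volume] with x hx
  have := ENNReal.toReal_mono hc (hx.trans h)
  rwa [toReal_enorm] at this

end EssSup

/-! ### The weak time derivative agrees with the derivative in `L²` -/

section Identification

variable {N : ℕ} {F : Type*} [NormedAddCommGroup F] [NormedSpace ℝ F] [CompleteSpace F]

/-- Mollifications are continuous, so countably many scales and points determine a function. The
countability lets exceptional null sets of times be united. -/
lemma ae_eq_of_kconv_eq {f g : Space N → F} (hf : LocallyIntegrable f volume)
    (hg : LocallyIntegrable g volume)
    (h : ∀ n j, kconv (moll (epsSeq n)) f (TopologicalSpace.denseSeq (Space N) j)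
      = kconv (moll (epsSeq n)) g (TopologicalSpace.denseSeq (Space N) j)) : f =ᵐ[volume] g := by
  have hc : ∀ n {f : Space N → F}, LocallyIntegrable f volume →
      Continuous (kconv (moll (epsSeq n)) f) := fun n {f} hf =>
    (contDiff_kconv (moll_contDiff _) (moll_hasCompactSupport (epsSeq_pos n)) hf).continuous
  have h1 : ∀ n, kconv (moll (epsSeq n)) f = kconv (moll (epsSeq n)) g := fun n =>
    (TopologicalSpace.denseRange_denseSeq (Space N)).equalizer (hc n hf) (hc n hg) (funext fun j => h n j)
  filter_upwards [ae_tendsto_kconv_moll hf, ae_tendsto_kconv_moll hg] with x h2 h3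
  simp_rw [h1] at h2
  exact tendsto_nhds_unique h2 h3

variable {T : ℝ} {H : Type*} [NormedAddCommGroup H] [InnerProductSpace ℝ H]

lemma inner_kconv [CompleteSpace H] {f : Space N → H} (hf : LocallyIntegrable f volume)
    {ε : ℝ} (hε : 0 < ε)
    (x : Space N) (v : H) :
    inner ℝ v (kconv (moll ε) f x) = ∫ y, moll ε (x - y) * inner ℝ v (f y) := by
  have hi := integrable_kconv (moll_contDiff ε).continuous (moll_hasCompactSupport hε) hf x
  unfold kconv
  rw [← integral_inner hi v]
  simp_rw [inner_smul_right]

/-- A component of the mollification at a point is a continuous functional on `L²`, so it commutes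
with differentiation in time of an `L²`-valued curve. -/
lemma exists_inner_eq_kconv [CompleteSpace H] {ε : ℝ} (hε : 0 < ε) (x : Space N) (v : H) :
    ∃ κ : Lp H 2 (volume : Measure (Space N)), ∀ f : Lp H 2 (volume : Measure (Space N)),
      inner ℝ κ f = inner ℝ v (kconv (moll ε) f x) := by
  have hm : MemLp (fun y => moll ε (x - y) • v) 2 (volume : Measure (Space N)) := by
    have hc : Continuous fun y : Space N => moll ε (x - y) :=
      (moll_contDiff ε).continuous.comp (continuous_const.sub continuous_id)
    exact (hc.smul continuous_const).memLp_of_hasCompactSupport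
      (moll_sub_hasCompactSupport hε x).smul_right
  refine ⟨hm.toLp _, fun f => ?_⟩
  rw [L2.inner_def, inner_kconv ((Lp.memLp f).locallyIntegrable (by norm_num)) hε]
  refine integral_congr_ae (hm.coeFn_toLp.mono fun y hy => ?_)
  simp only [hy, inner_smul_left, RCLike.conj_to_real]

/-- The weak time derivative of a field in `C¹([0,T]; L²)` is its derivative in `L²`. -/
lemma ae_eq_deriv [FiniteDimensional ℝ H] (hT : 0 < T) {w wt : ℝ → Space N → H}
    {δ : ℝ → Lp H 2 (volume : Measure (Space N))}
    (hδ : ∀ᵐ t ∂(timeMeasure T), δ t =ᵐ[volume] w t) (hc : ContDiffOn ℝ 1 δ (Icc 0 T))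
    (hwt : ∀ᵐ t ∂(timeMeasure T), LocallyIntegrable (wt t) volume)
    (hw : ∀ n x v, HasWeakDeriv T (fun t => inner ℝ v (kconv (moll (epsSeq n)) (w t) x))
      (fun t => inner ℝ v (kconv (moll (epsSeq n)) (wt t) x))) :
    ∀ᵐ t ∂(timeMeasure T), wt t =ᵐ[volume]
      ((deriv δ t : Lp H 2 (volume : Measure (Space N))) : Space N → H) := by
  have := FiniteDimensional.complete ℝ H
  have hco : ContDiffOn ℝ 1 δ (Ioo 0 T) := hc.mono Ioo_subset_Icc_self
  have hd : ∀ t ∈ Ioo 0 T, HasDerivAt δ (deriv δ t) t := fun t ht =>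
    ((hco.differentiableOn (by norm_num)).differentiableAt (isOpen_Ioo.mem_nhds ht)).hasDerivAt
  have hdc : ContinuousOn (deriv δ) (Ioo 0 T) :=
    hco.continuousOn_deriv_of_isOpen isOpen_Ioo le_rfl
  set e := stdOrthonormalBasis ℝ H
  have key : ∀ n j i, ∀ᵐ t ∂(timeMeasure T),
      inner ℝ (e i) (kconv (moll (epsSeq n)) (wt t) (TopologicalSpace.denseSeq (Space N) j))
      = inner ℝ (e i) (kconv (moll (epsSeq n)) (deriv δ t : Lp H 2 (volume : Measure (Space N))) (TopologicalSpace.denseSeq (Space N) j)) := by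
    intro n j i
    obtain ⟨κ, hκ⟩ := exists_inner_eq_kconv (epsSeq_pos n) (TopologicalSpace.denseSeq (Space N) j) (e i)
    have h1 : HasWeakDeriv T (fun t => inner ℝ κ (δ t)) (fun t => inner ℝ κ (deriv δ t)) := by
      refine hasWeakDeriv_of_hasDerivAt (fun t ht => ?_) (continuousOn_const.inner hdc)
      exact (innerSL ℝ κ).hasFDerivAt.comp_hasDerivAt t (hd t ht)
    have h2 := (hw n (TopologicalSpace.denseSeq (Space N) j) (e i)).congr (b := fun t => inner ℝ κ (δ t)) (by
      filter_upwards [hδ] with t ht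
      rw [hκ, kconv_congr ht]) EventuallyEq.rfl
    -- The same scalar function of time has two weak derivatives, one from the distributional
    -- equation and one from the classical derivative of `δ`; they must agree.
    filter_upwards [h2.unique hT h1] with t ht
    rw [ht, hκ]
  have key2 := ae_all_iff.2 fun n => ae_all_iff.2 fun j => ae_all_iff.2 fun i => key n j i
  filter_upwards [key2, hwt] with t ht htl
  refine ae_eq_of_kconv_eq htl ((Lp.memLp _).locallyIntegrable (by norm_num)) fun n j => ?_
  refine e.repr.injective (PiLp.ext fun i => ?_)
  rw [e.repr_apply_apply, e.repr_apply_apply]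
  exact ht n j i

end Identification

end InhomEuler


namespace InhomEuler

open Filter Topology Metric
open scoped ENNReal NNReal

/-! ### The coefficient `b(t)` and its integral -/

section Bounds

variable {N : ℕ} {T : ℝ}

lemma MemL1Linfty.aestronglyMeasurable {F : Type*} [NormedAddCommGroup F] {f : ℝ → Space N → F}
    (hf : MemL1Linfty T f) :
    AEStronglyMeasurable (Function.uncurry f) ((timeMeasure T).prod volume) := by
  rw [← restrict_slab]
  exact hf.meas

lemma MemL1Linfty.aemeasurable {F : Type*} [NormedAddCommGroup F] {f : ℝ → Space N → F}
    (hf : MemL1Linfty T f) : AEMeasurable (fun t => eLpNorm (f t) ⊤ volume) (timeMeasure T) :=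
  aemeasurable_eLpNorm_top hf.aestronglyMeasurable

/-- The integrand of `lipschitzIntegral`. -/
noncomputable def lipNorm (R : ℝ → Space N → Space N)
    (Du₁ Du₂ : ℝ → Space N → Space N →L[ℝ] Space N) (P₂ : ℝ → Space N → Space N) (t : ℝ) : ℝ≥0∞ :=
  eLpNorm (R t) ⊤ volume + eLpNorm (Du₁ t) ⊤ volume + eLpNorm (Du₂ t) ⊤ volume
    + eLpNorm (P₂ t) ⊤ volume

variable {R : ℝ → Space N → Space N} {Du₁ Du₂ : ℝ → Space N → Space N →L[ℝ] Space N}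
  {P₂ : ℝ → Space N → Space N}

lemma aemeasurable_lipNorm (h1 : MemL1Linfty T R) (h2 : MemL1Linfty T Du₁)
    (h3 : MemL1Linfty T Du₂) (h4 : MemL1Linfty T P₂) :
    AEMeasurable (lipNorm R Du₁ Du₂ P₂) (timeMeasure T) :=
  ((h1.aemeasurable.add h2.aemeasurable).add h3.aemeasurable).add h4.aemeasurable

lemma lintegral_lipNorm_ne_top (h1 : MemL1Linfty T R) (h2 : MemL1Linfty T Du₁)
    (h3 : MemL1Linfty T Du₂) (h4 : MemL1Linfty T P₂) :
    ∫⁻ t, lipNorm R Du₁ Du₂ P₂ t ∂(timeMeasure T) ≠ ⊤ := by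
  unfold lipNorm
  rw [lintegral_add_right' _ h4.aemeasurable, lintegral_add_right' _ h3.aemeasurable,
    lintegral_add_right' _ h2.aemeasurable]
  exact ENNReal.add_ne_top.2 ⟨ENNReal.add_ne_top.2 ⟨ENNReal.add_ne_top.2
    ⟨h1.finite.ne, h2.finite.ne⟩, h3.finite.ne⟩, h4.finite.ne⟩

lemma lipschitzIntegral_eq (h1 : MemL1Linfty T R) (h2 : MemL1Linfty T Du₁)
    (h3 : MemL1Linfty T Du₂) (h4 : MemL1Linfty T P₂) {t : ℝ} (ht : t ∈ Icc 0 T) :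
    lipschitzIntegral R Du₁ Du₂ P₂ t = ∫ τ in (0 : ℝ)..t, (lipNorm R Du₁ Du₂ P₂ τ).toReal := by
  have hm : volume.restrict (Ioo 0 t) ≤ timeMeasure T :=
    Measure.restrict_mono (Ioo_subset_Ioo_right ht.2) le_rfl
  have ha := (aemeasurable_lipNorm h1 h2 h3 h4).mono_measure hm
  rw [intervalIntegral.integral_of_le ht.1, integral_Ioc_eq_integral_Ioo,
    integral_toReal ha (ae_lt_top' ha ((lintegral_mono' hm le_rfl).trans_lt
      (lintegral_lipNorm_ne_top h1 h2 h3 h4).lt_top).ne)]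
  rfl

end Bounds

/-! ### Energy identity and energy bounds for a pair of solutions -/

/-- Two solutions with their time derivatives `a₁`, `a₂`, and the regularity of their difference. -/
structure SolutionPair {N : ℕ} (T lo hi : ℝ) (ρ₁ ρ₂ : ℝ → Space N → ℝ)
    (u₁ u₂ a₁ a₂ : ℝ → Space N → Space N) (Du₁ Du₂ : ℝ → Space N → Space N →L[ℝ] Space N)
    (P₁ P₂ R₂ : ℝ → Space N → Space N) (δρ : ℝ → Lp ℝ 2 (volume : Measure (Space N)))
    (δu : ℝ → Lp (Space N) 2 (volume : Measure (Space N))) : Prop where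
  time_pos : 0 < T
  lo_pos : 0 < lo
  sol₁ : IsEulerSolution T ρ₁ u₁ Du₁ P₁
  sol₂ : IsEulerSolution T ρ₂ u₂ Du₂ P₂
  time₁ : HasWeakTimeDeriv T u₁ a₁
  time₂ : HasWeakTimeDeriv T u₂ a₂
  momentum₁ : ∀ᵐ t ∂(timeMeasure T), ∀ᵐ x, ρ₁ t x • (a₁ t x + Du₁ t x (u₁ t x)) + P₁ t x = 0
  momentum₂ : ∀ᵐ t ∂(timeMeasure T), ∀ᵐ x, ρ₂ t x • (a₂ t x + Du₂ t x (u₂ t x)) + P₂ t x = 0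
  bounds : ∀ᵐ t ∂(timeMeasure T), ∀ᵐ x,
    lo ≤ ρ₁ t x ∧ ρ₁ t x ≤ hi ∧ lo ≤ ρ₂ t x ∧ ρ₂ t x ≤ hi
  density_ae_eq : ∀ᵐ t ∂(timeMeasure T), δρ t =ᵐ[volume] fun x => ρ₁ t x - ρ₂ t x
  velocity_ae_eq : ∀ᵐ t ∂(timeMeasure T), δu t =ᵐ[volume] fun x => u₁ t x - u₂ t x
  continuousOn_density : ContinuousOn δρ (Icc 0 T)
  contDiffOn_velocity : ContDiffOn ℝ 1 δu (Icc 0 T)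
  weakDensity : ∀ᵐ t ∂(timeMeasure T), HasWeakGradient (ρ₂ t) (R₂ t)
  memR₂ : MemL1Linfty T R₂
  memDu₁ : MemL1Linfty T Du₁
  memDu₂ : MemL1Linfty T Du₂
  memP₂ : MemL1Linfty T P₂

namespace SolutionPair

variable {N : ℕ} {T lo hi : ℝ} {ρ₁ ρ₂ : ℝ → Space N → ℝ}
    {u₁ u₂ a₁ a₂ : ℝ → Space N → Space N} {Du₁ Du₂ : ℝ → Space N → Space N →L[ℝ] Space N}
    {P₁ P₂ R₂ : ℝ → Space N → Space N} {δρ : ℝ → Lp ℝ 2 (volume : Measure (Space N))}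
    {δu : ℝ → Lp (Space N) 2 (volume : Measure (Space N))}

lemma integrable_bound
    (h : SolutionPair T lo hi ρ₁ ρ₂ u₁ u₂ a₁ a₂ Du₁ Du₂ P₁ P₂ R₂ δρ δu) :
    Integrable (fun t => (lipNorm R₂ Du₁ Du₂ P₂ t).toReal) (timeMeasure T) :=
  integrable_toReal_of_lintegral_ne_top
    (aemeasurable_lipNorm h.memR₂ h.memDu₁ h.memDu₂ h.memP₂)
    (lintegral_lipNorm_ne_top h.memR₂ h.memDu₁ h.memDu₂ h.memP₂)

lemma hasWeakDeriv_velocity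
    (h : SolutionPair T lo hi ρ₁ ρ₂ u₁ u₂ a₁ a₂ Du₁ Du₂ P₁ P₂ R₂ δρ δu) (n : ℕ) (x v : Space N) :
    HasWeakDeriv T (fun t => inner ℝ v (kconv (moll (epsSeq n)) (fun y => u₁ t y - u₂ t y) x))
      (fun t => inner ℝ v (kconv (moll (epsSeq n)) (fun y => a₁ t y - a₂ t y) x)) := by
  have hε := epsSeq_pos n
  have key : ∀ {f g : ℝ → Space N → Space N}, LocInt T f → LocInt T g →
      ∀ᵐ t ∂(timeMeasure T), (∫ y, moll (epsSeq n) (x - y) * inner ℝ v (f t y))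
        - (∫ y, moll (epsSeq n) (x - y) * inner ℝ v (g t y))
        = inner ℝ v (kconv (moll (epsSeq n)) (fun y => f t y - g t y) x) := by
    intro f g hf hg
    filter_upwards [hf.ae_locallyIntegrable h.time_pos, hg.ae_locallyIntegrable h.time_pos]
      with t h1 h2
    have hη := (moll_contDiff (N := N) (epsSeq n)).continuous
    have hηc := moll_hasCompactSupport (N := N) hε
    rw [← inner_kconv h1 hε, ← inner_kconv h2 hε, ← inner_sub_right]
    unfold kconv
    rw [← integral_sub (integrable_kconv hη hηc h1 x) (integrable_kconv hη hηc h2 x)]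
    simp_rw [smul_sub]
  exact ((h.time₁.hasWeakDeriv h.time_pos hε x v).sub
    (h.time₂.hasWeakDeriv h.time_pos hε x v)).congr (key h.time₁.locInt h.time₂.locInt)
    (key h.time₁.locInt_deriv h.time₂.locInt_deriv)

lemma hasWeakDeriv_densityDiff
    (h : SolutionPair T lo hi ρ₁ ρ₂ u₁ u₂ a₁ a₂ Du₁ Du₂ P₁ P₂ R₂ δρ δu) (n : ℕ) (x : Space N)
    (v : ℝ) :
    HasWeakDeriv T (fun t => inner ℝ v (kconv (moll (epsSeq n)) (fun y => ρ₁ t y - ρ₂ t y) x))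
      (fun t => inner ℝ v (-(∫ y, fderiv ℝ (moll (epsSeq n)) (x - y) (ρ₁ t y • u₁ t y))
          - -∫ y, fderiv ℝ (moll (epsSeq n)) (x - y) (ρ₂ t y • u₂ t y))) := by
  have hε := epsSeq_pos n
  have hη := (moll_contDiff (N := N) (epsSeq n)).continuous
  have hηc := moll_hasCompactSupport (N := N) hε
  have h1 := hasWeakDeriv_density h.time_pos h.sol₁.locInt_density h.sol₁.locInt_flux
    h.sol₁.transport hε x
  have h2 := hasWeakDeriv_density h.time_pos h.sol₂.locInt_density h.sol₂.locInt_flux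
    h.sol₂.transport hε x
  refine ((h1.sub h2).mul (HasWeakDeriv.zero T v) h.time_pos).congr ?_
    (ae_of_all _ fun t => by simp)
  filter_upwards [h.sol₁.locInt_density.ae_locallyIntegrable h.time_pos,
    h.sol₂.locInt_density.ae_locallyIntegrable h.time_pos] with t h3 h4
  simp only [RCLike.inner_apply, conj_trivial]
  unfold kconv
  rw [← integral_sub (integrable_kconv hη hηc h3 x) (integrable_kconv hη hηc h4 x)]
  simp_rw [smul_sub]

/-- This makes `∂ₜδu` square integrable at almost every time, the input of the pressure estimate. -/
lemma ae_eq_deriv (h : SolutionPair T lo hi ρ₁ ρ₂ u₁ u₂ a₁ a₂ Du₁ Du₂ P₁ P₂ R₂ δρ δu) :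
    ∀ᵐ t ∂(timeMeasure T), (fun x => a₁ t x - a₂ t x) =ᵐ[volume]
      ((deriv δu t : Lp (Space N) 2 (volume : Measure (Space N))) : Space N → Space N) := by
  refine InhomEuler.ae_eq_deriv (w := fun t x => u₁ t x - u₂ t x)
    (wt := fun t x => a₁ t x - a₂ t x) h.time_pos h.velocity_ae_eq h.contDiffOn_velocity ?_
    h.hasWeakDeriv_velocity
  filter_upwards [h.time₁.locInt_deriv.ae_locallyIntegrable h.time_pos,
    h.time₂.locInt_deriv.ae_locallyIntegrable h.time_pos] with t h1 h2
  exact h1.sub h2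

lemma l2_density_eq (h : SolutionPair T lo hi ρ₁ ρ₂ u₁ u₂ a₁ a₂ Du₁ Du₂ P₁ P₂ R₂ δρ δu) :
    ∀ᵐ t ∂(timeMeasure T), l2 (fun x => ρ₁ t x - ρ₂ t x) = ‖δρ t‖ := by
  filter_upwards [h.density_ae_eq] with t ht
  rw [← l2_congr ht, Lp.norm_def, l2]

lemma l2_velocity_eq (h : SolutionPair T lo hi ρ₁ ρ₂ u₁ u₂ a₁ a₂ Du₁ Du₂ P₁ P₂ R₂ δρ δu) :
    ∀ᵐ t ∂(timeMeasure T), l2 (fun x => u₁ t x - u₂ t x) = ‖δu t‖ := by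
  filter_upwards [h.velocity_ae_eq] with t ht
  rw [← l2_congr ht, Lp.norm_def, l2]

lemma ae_slice (h : SolutionPair T lo hi ρ₁ ρ₂ u₁ u₂ a₁ a₂ Du₁ Du₂ P₁ P₂ R₂ δρ δu) :
    ∀ᵐ t ∂(timeMeasure T), Slice lo hi (lipNorm R₂ Du₁ Du₂ P₂ t).toReal (ρ₁ t) (ρ₂ t) (u₁ t)
      (u₂ t) (a₁ t) (a₂ t) (P₁ t) (P₂ t) (R₂ t) (Du₁ t) (Du₂ t) := by
  have hfin := ae_lt_top' (aemeasurable_lipNorm h.memR₂ h.memDu₁ h.memDu₂ h.memP₂)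
    (lintegral_lipNorm_ne_top h.memR₂ h.memDu₁ h.memDu₂ h.memP₂)
  filter_upwards [hfin, h.bounds, h.sol₁.weak_gradVelocity, h.sol₂.weak_gradVelocity,
    h.weakDensity, h.sol₁.gradPressure, h.sol₂.gradPressure, h.sol₁.incompressible,
    h.sol₂.incompressible, h.momentum₁, h.momentum₂, h.density_ae_eq, h.velocity_ae_eq,
    h.ae_eq_deriv, h.sol₁.locInt_density.ae_locallyIntegrable h.time_pos,
    h.sol₁.locInt_gradPressure.ae_locallyIntegrable h.time_pos,
    h.sol₂.locInt_gradPressure.ae_locallyIntegrable h.time_pos] with t h0 h1 h2 h3 h4 h5 h6 h7 h8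
      h9 h10 h11 h12 h13 h14 h15 h16
  exact
    { lo_pos := h.lo_pos
      bounds := h1
      weak₁ := h2
      weak₂ := h3
      weakDensity := h4
      pressure₁ := h5
      pressure₂ := h6
      div₁ := h7
      div₂ := h8
      momentum₁ := h9
      momentum₂ := h10
      Du₁_le := norm_le_toReal_of_eLpNorm_top_le h0.ne
        (le_add_self.trans (le_self_add.trans le_self_add))
      Du₂_le := norm_le_toReal_of_eLpNorm_top_le h0.ne (le_add_self.trans le_self_add)
      R₂_le := norm_le_toReal_of_eLpNorm_top_le h0.ne
        (le_self_add.trans (le_self_add.trans le_self_add))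
      P₂_le := norm_le_toReal_of_eLpNorm_top_le h0.ne le_add_self
      memLp_density := (memLp_congr_ae h11).1 (Lp.memLp _)
      memLp_velocity := (memLp_congr_ae h12).1 (Lp.memLp _)
      memLp_accel := (memLp_congr_ae h13).2 (Lp.memLp _)
      locInt_density := h14
      locInt_P₁ := h15
      locInt_P₂ := h16 }

/-- Continuous curves in `L²` are bounded on the compact interval; for the time derivative this is
where continuity of the derivative up to the endpoints is used. -/
lemma exists_norm_bound (h : SolutionPair T lo hi ρ₁ ρ₂ u₁ u₂ a₁ a₂ Du₁ Du₂ P₁ P₂ R₂ δρ δu) :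
    ∃ Z, 0 ≤ Z ∧ ∀ᵐ t ∂(timeMeasure T), l2 (fun x => ρ₁ t x - ρ₂ t x) ≤ Z ∧
      l2 (fun x => u₁ t x - u₂ t x) ≤ Z ∧ l2 (fun x => a₁ t x - a₂ t x) ≤ Z := by
  obtain ⟨A, hA⟩ := isCompact_Icc.exists_bound_of_continuousOn h.continuousOn_density
  obtain ⟨B, hB⟩ := isCompact_Icc.exists_bound_of_continuousOn h.contDiffOn_velocity.continuousOn
  obtain ⟨D, hD⟩ := isCompact_Icc.exists_bound_of_continuousOn
    (h.contDiffOn_velocity.continuousOn_derivWithin (uniqueDiffOn_Icc h.time_pos) le_rfl)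
  refine ⟨max 0 (max A (max B D)), le_max_left _ _, ?_⟩
  filter_upwards [h.l2_density_eq, h.l2_velocity_eq, h.ae_eq_deriv,
    ae_restrict_mem measurableSet_Ioo] with t h1 h2 h3 ht
  have ht' := Ioo_subset_Icc_self ht
  have h4 : l2 (fun x => a₁ t x - a₂ t x) = ‖deriv δu t‖ := by
    rw [l2_congr h3, Lp.norm_def, l2]
  have h5 := hD t ht'
  rw [derivWithin_of_mem_nhds (Icc_mem_nhds ht.1 ht.2)] at h5
  rw [h1, h2, h4]
  refine ⟨(hA t ht').trans ?_, (hB t ht').trans ?_, h5.trans ?_⟩ <;> simp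

/-- A locally integrable majorant of all the quantities that enter the energy identities. -/
lemma exists_majorant (h : SolutionPair T lo hi ρ₁ ρ₂ u₁ u₂ a₁ a₂ Du₁ Du₂ P₁ P₂ R₂ δρ δu) :
    ∃ (Z : ℝ) (β : ℝ → ℝ), LocallyIntegrableOn β (Ioo 0 T) volume ∧
      ∀ᵐ t ∂(timeMeasure T), l2 (fun x => ρ₁ t x - ρ₂ t x) ≤ Z ∧
        l2 (fun x => u₁ t x - u₂ t x) ≤ Z ∧
        (∀ U, u₁ t =ᵐ[volume] U → LipschitzWith (lipNorm R₂ Du₁ Du₂ P₂ t).toReal.toNNReal U →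
          ‖U 0‖ + (lipNorm R₂ Du₁ Du₂ P₂ t).toReal.toNNReal ≤ β t) ∧
        (lipNorm R₂ Du₁ Du₂ P₂ t).toReal * l2 (fun x => u₁ t x - u₂ t x) ≤ β t ∧
        l2 (Slice.source (u₁ t) (a₁ t) (a₂ t) (Du₁ t) (Du₂ t)) ≤ β t := by
  obtain ⟨Z, hZ0, hZ⟩ := h.exists_norm_bound
  have hlo := h.lo_pos
  have hk := (cutC_pos N).le
  have hV := ballVol_pos N
  -- With `b` the coefficient at time `t`, the forcing has norm at most `b * f`, and inserting the
  -- pressure bound the source has norm at most `g * b + lo⁻¹ * |hi| * Z`. The absolute value makes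
  -- these constants nonnegative without a slice at hand.
  set f := Z / lo + |hi| * Z with hf
  set g := lo⁻¹ * f + lo⁻¹ * |hi| * (lo⁻¹ * f) + lo⁻¹ * |hi| * (1 + 8 * cutC N) * Z with hg
  have hf0 : 0 ≤ f := by positivity
  have hg0 : 0 ≤ g := by positivity
  set A : ℝ → ℝ := fun t => ∫ y in closedBall (0 : Space N) 1, ‖u₁ t y‖
  -- The summand `A t` and the `2` bound `‖U 0‖ + b` through the mean of `u₁` over the unit ball,
  -- `Z` bounds the density source, `g` the velocity source.
  refine ⟨Z, fun t => (ballVol N)⁻¹ * A t + (2 + Z + g) * (lipNorm R₂ Du₁ Du₂ P₂ t).toReal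
    + lo⁻¹ * |hi| * Z, ?_, ?_⟩
  · have hmul : ∀ (c : ℝ) {k : ℝ → ℝ}, LocallyIntegrableOn k (Ioo 0 T) volume →
        LocallyIntegrableOn (fun t => c * k t) (Ioo 0 T) volume := fun c k hk x hx =>
      let ⟨s, hs, hi⟩ := hk x hx
      ⟨s, hs, hi.const_mul c⟩
    have hb : IntegrableOn (fun t => (lipNorm R₂ Du₁ Du₂ P₂ t).toReal) (Ioo 0 T) volume :=
      h.integrable_bound
    exact ((hmul _ (h.sol₁.locInt_velocity.locallyIntegrableOn_integral 1)).add
      (hmul _ hb.locallyIntegrableOn)).add (locallyIntegrableOn_const _)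
  · filter_upwards [hZ, h.ae_slice] with t ht hs
    obtain ⟨z1, z2, z3⟩ := ht
    have hb0 := hs.nonneg
    set b := (lipNorm R₂ Du₁ Du₂ P₂ t).toReal
    have hA0 : 0 ≤ A t := integral_nonneg fun y => norm_nonneg _
    have hc2 : 0 ≤ (ballVol N)⁻¹ * A t := by positivity
    have hgb : 0 ≤ g * b := by positivity
    have hZb : 0 ≤ Z * b := by positivity
    have hZc : 0 ≤ lo⁻¹ * |hi| * Z := by positivity
    have habs : |hi| = hi := abs_of_pos hs.hi_pos
    refine ⟨z1, z2, fun U hU hL => ?_, ?_, ?_⟩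
    · have h1 := Slice.norm_apply_zero_le hL hU
      rw [Real.coe_toNNReal _ hb0] at h1 ⊢
      linarith
    · have := mul_le_mul_of_nonneg_left z2 hb0
      linarith
    · have hF : l2 (Slice.forcing (ρ₁ t) (ρ₂ t) (u₁ t) (u₂ t) (P₂ t) (Du₂ t)) ≤ b * f := by
        refine hs.memLp_forcing.2.trans ?_
        calc b / lo * l2 (fun x => ρ₁ t x - ρ₂ t x) + hi * b * l2 (fun x => u₁ t x - u₂ t x)
            ≤ b / lo * Z + hi * b * Z := by
              have := hs.hi_pos
              gcongr
          _ = b * f := by rw [hf, habs]; ring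
      have hP := hs.memLp_pressure_diff.2
      have hi0 := hs.hi_pos
      have hS := hs.memLp_source.2
      have hP2 : l2 (fun x => P₁ t x - P₂ t x)
          ≤ hi * (lo⁻¹ * (b * f) + Z + b * (1 + 8 * cutC N) * Z) :=
        hP.trans (by gcongr)
      have hS2 : l2 (Slice.source (u₁ t) (a₁ t) (a₂ t) (Du₁ t) (Du₂ t)) ≤
          lo⁻¹ * (b * f + hi * (lo⁻¹ * (b * f) + Z + b * (1 + 8 * cutC N) * Z)) :=
        hS.trans (by gcongr)
      have e : lo⁻¹ * (b * f + hi * (lo⁻¹ * (b * f) + Z + b * (1 + 8 * cutC N) * Z))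
          = g * b + lo⁻¹ * |hi| * Z := by rw [hg, habs]; ring
      rw [e] at hS2
      linarith

/-- Two instances of the energy identity: constant density with the field `ρ₁ - ρ₂`, and density
`ρ₁` with the field `u₁ - u₂`. -/
lemma hasWeakDeriv_energies
    (h : SolutionPair T lo hi ρ₁ ρ₂ u₁ u₂ a₁ a₂ Du₁ Du₂ P₁ P₂ R₂ δρ δu) :
    HasWeakDeriv T (fun t => (∫ x, (1 : ℝ) * ‖ρ₁ t x - ρ₂ t x‖ ^ 2)
        + ∫ x, ρ₁ t x * ‖u₁ t x - u₂ t x‖ ^ 2)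
      (fun t => (2 * ∫ x, (1 : ℝ) * inner ℝ (ρ₁ t x - ρ₂ t x)
          (Slice.densitySource (u₁ t) (u₂ t) (R₂ t) x))
        + 2 * ∫ x, ρ₁ t x * inner ℝ (u₁ t x - u₂ t x)
          (Slice.source (u₁ t) (a₁ t) (a₂ t) (Du₁ t) (Du₂ t) x)) := by
  obtain ⟨Z, β, hβ, hZ⟩ := h.exists_majorant
  have m1 := h.sol₁.locInt_density.aestronglyMeasurable
  have m2 := h.sol₂.locInt_density.aestronglyMeasurable
  have m3 := h.sol₁.locInt_velocity.aestronglyMeasurable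
  have m4 := h.sol₂.locInt_velocity.aestronglyMeasurable
  have m5 := h.time₁.locInt_deriv.aestronglyMeasurable
  have m6 := h.time₂.locInt_deriv.aestronglyMeasurable
  have mf1 := fun n => (aestronglyMeasurable_conv (continuous_fderiv_moll (epsSeq n))
    h.sol₁.locInt_flux.aestronglyMeasurable).neg
  have mf2 := fun n => (aestronglyMeasurable_conv (continuous_fderiv_moll (epsSeq n))
    h.sol₂.locInt_flux.aestronglyMeasurable).neg
  refine HasWeakDeriv.add ?_ ?_
  · refine hasWeakDeriv_energy (M := 1) (Z := Z) (β := β) (k := fun _ _ _ => 0)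
      (ρ := fun _ _ => (1 : ℝ)) (w := fun t x => ρ₁ t x - ρ₂ t x)
      (G := fun t => Slice.densitySource (u₁ t) (u₂ t) (R₂ t))
      (zt := fun n t x => -(∫ y, fderiv ℝ (moll (epsSeq n)) (x - y) (ρ₁ t y • u₁ t y))
          - -∫ y, fderiv ℝ (moll (epsSeq n)) (x - y) (ρ₂ t y • u₂ t y))
      h.time_pos aestronglyMeasurable_const (m1.sub m2) (fun n => aestronglyMeasurable_const)
      (fun n => (mf1 n).sub (mf2 n)) (fun n x => ?_) h.hasWeakDeriv_densityDiff hβ ?_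
    · simp_rw [kconv_moll_one (epsSeq_pos n)]
      exact HasWeakDeriv.zero T 1
    · filter_upwards [hZ, h.ae_slice] with t ht hs
      obtain ⟨U, W, hU, hW, hU1, hW1, hW2⟩ := hs.exists_velocity
      exact ⟨U, _, hs.energyState_density ht.1 hU hW hU1 hW1 (ht.2.2.1 U hU1 hU.lip) ht.2.2.2.1⟩
  · refine hasWeakDeriv_energy (M := hi) (Z := Z) (β := β)
      (ρ := ρ₁) (w := fun t x => u₁ t x - u₂ t x)
      (G := fun t => Slice.source (u₁ t) (a₁ t) (a₂ t) (Du₁ t) (Du₂ t))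
      (k := fun n t x => -∫ y, fderiv ℝ (moll (epsSeq n)) (x - y) (ρ₁ t y • u₁ t y))
      (zt := fun n t x => kconv (moll (epsSeq n)) (fun y => a₁ t y - a₂ t y) x)
      h.time_pos m1 (m3.sub m4) mf1 (fun n => aestronglyMeasurable_kconv (f := fun t y =>
        a₁ t y - a₂ t y) (m5.sub m6) _) (fun n x => hasWeakDeriv_density h.time_pos
        h.sol₁.locInt_density h.sol₁.locInt_flux h.sol₁.transport (epsSeq_pos n) x)
      h.hasWeakDeriv_velocity hβ ?_
    filter_upwards [hZ, h.ae_slice] with t ht hs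
    obtain ⟨U, W, hU, hW, hU1, hW1, hW2⟩ := hs.exists_velocity
    exact ⟨U, _, hs.energyState_velocity ht.2.1 hU hW hU1 hW1 hW2 (ht.2.2.1 U hU1 hU.lip)
      ht.2.2.2.2⟩

/-- The rate of change of the energy is controlled by the energy. -/
lemma ae_abs_energy_rate_le (hN : 0 < N)
    (h : SolutionPair T lo hi ρ₁ ρ₂ u₁ u₂ a₁ a₂ Du₁ Du₂ P₁ P₂ R₂ δρ δu) :
    ∀ᵐ t ∂(timeMeasure T), |(2 * ∫ x, (1 : ℝ) * inner ℝ (ρ₁ t x - ρ₂ t x)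
          (Slice.densitySource (u₁ t) (u₂ t) (R₂ t) x))
        + 2 * ∫ x, ρ₁ t x * inner ℝ (u₁ t x - u₂ t x)
          (Slice.source (u₁ t) (a₁ t) (a₂ t) (Du₁ t) (Du₂ t) x)|
      ≤ (1 + lo⁻¹ + 2 * max 1 hi) * ((lipNorm R₂ Du₁ Du₂ P₂ t).toReal *
        (‖δρ t‖ ^ 2 + ‖δu t‖ ^ 2)) := by
  filter_upwards [h.ae_slice, h.l2_density_eq, h.l2_velocity_eq] with t hs h1 h2
  have h3 := hs.abs_integral_source_le hN
  have h4 := abs_integral_mul_inner_le (a := fun _ => (1 : ℝ)) zero_le_one hs.memLp_density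
    hs.memLp_densitySource.1 (ae_of_all _ fun x => by simp)
  have h5 := hs.memLp_densitySource.2
  rw [h1, h2] at h3
  rw [h1, one_mul] at h4
  rw [h2] at h5
  have hb := hs.nonneg
  have hlo := inv_pos.2 h.lo_pos
  have hhi := le_max_right 1 hi
  set b := (lipNorm R₂ Du₁ Du₂ P₂ t).toReal
  set s := ‖δρ t‖
  set w := ‖δu t‖
  have hs0 : 0 ≤ s := norm_nonneg _
  have hw0 : 0 ≤ w := norm_nonneg _
  have h6 := h4.trans (mul_le_mul_of_nonneg_left h5 hs0)
  refine (abs_add_le _ _).trans ?_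
  rw [abs_mul, abs_mul, abs_two]
  refine (add_le_add (mul_le_mul_of_nonneg_left h6 zero_le_two)
    (mul_le_mul_of_nonneg_left h3 zero_le_two)).trans ?_
  -- The cross terms carry `1 + lo⁻¹` and are split by `2 s w ≤ s² + w²`; the remaining term `2 hi
  -- w²` accounts for `2 * max 1 hi`.
  have e1 : 2 * (s * (b * w)) + 2 * (w * (b / lo * s + hi * b * w))
      = b * ((1 + lo⁻¹) * (2 * s * w) + 2 * hi * w ^ 2) := by rw [div_eq_mul_inv]; ring
  have e2 : (1 + lo⁻¹ + 2 * max 1 hi) * (b * (s ^ 2 + w ^ 2))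
      = b * ((1 + lo⁻¹) * (s ^ 2 + w ^ 2) + 2 * max 1 hi * (s ^ 2 + w ^ 2)) := by ring
  rw [e1, e2]
  have h7 := two_mul_le_add_sq s w
  have h8 : hi * w ^ 2 ≤ max 1 hi * (s ^ 2 + w ^ 2) :=
    (mul_le_mul_of_nonneg_right hhi (sq_nonneg w)).trans
      (mul_le_mul_of_nonneg_left (by nlinarith [sq_nonneg s]) (by positivity))
  refine mul_le_mul_of_nonneg_left (add_le_add (mul_le_mul_of_nonneg_left h7 (by positivity)) ?_) hb
  linarith

lemma ae_energy_bounds (h : SolutionPair T lo hi ρ₁ ρ₂ u₁ u₂ a₁ a₂ Du₁ Du₂ P₁ P₂ R₂ δρ δu) :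
    ∀ᵐ t ∂(timeMeasure T), min 1 lo * (‖δρ t‖ ^ 2 + ‖δu t‖ ^ 2) ≤
        (∫ x, (1 : ℝ) * ‖ρ₁ t x - ρ₂ t x‖ ^ 2) + ∫ x, ρ₁ t x * ‖u₁ t x - u₂ t x‖ ^ 2 ∧
      (∫ x, (1 : ℝ) * ‖ρ₁ t x - ρ₂ t x‖ ^ 2) + ∫ x, ρ₁ t x * ‖u₁ t x - u₂ t x‖ ^ 2 ≤
        max 1 hi * (‖δρ t‖ ^ 2 + ‖δu t‖ ^ 2) := by
  filter_upwards [h.ae_slice, h.l2_density_eq, h.l2_velocity_eq] with t hs h1 h2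
  have hi2 := integrable_norm_sq hs.memLp_velocity
  have hw := l2_sq hs.memLp_velocity
  simp_rw [one_mul]
  rw [← l2_sq hs.memLp_density, h1]
  rw [h2] at hw
  have hi1 : Integrable (fun x => ρ₁ t x * ‖u₁ t x - u₂ t x‖ ^ 2) volume := by
    refine (hi2.const_mul hi).mono' (hs.locInt_density.aestronglyMeasurable.mul hi2.1) ?_
    filter_upwards [hs.bounds] with x hx
    rw [norm_mul, Real.norm_of_nonneg (h.lo_pos.le.trans hx.1),
      Real.norm_of_nonneg (sq_nonneg ‖u₁ t x - u₂ t x‖)]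
    exact mul_le_mul_of_nonneg_right hx.2.1 (sq_nonneg _)
  have b1 : lo * ‖δu t‖ ^ 2 ≤ ∫ x, ρ₁ t x * ‖u₁ t x - u₂ t x‖ ^ 2 := by
    rw [hw, ← integral_const_mul]
    refine integral_mono_ae (hi2.const_mul lo) hi1 ?_
    filter_upwards [hs.bounds] with x hx
    exact mul_le_mul_of_nonneg_right hx.1 (sq_nonneg _)
  have b2 : ∫ x, ρ₁ t x * ‖u₁ t x - u₂ t x‖ ^ 2 ≤ hi * ‖δu t‖ ^ 2 := by
    rw [hw, ← integral_const_mul]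
    refine integral_mono_ae hi1 (hi2.const_mul hi) ?_
    filter_upwards [hs.bounds] with x hx
    exact mul_le_mul_of_nonneg_right hx.2.1 (sq_nonneg _)
  have c1 := mul_le_mul_of_nonneg_right (min_le_left 1 lo) (sq_nonneg ‖δρ t‖)
  have c2 := mul_le_mul_of_nonneg_right (min_le_right 1 lo) (sq_nonneg ‖δu t‖)
  have c3 := mul_le_mul_of_nonneg_right (le_max_left 1 hi) (sq_nonneg ‖δρ t‖)
  have c4 := mul_le_mul_of_nonneg_right (le_max_right 1 hi) (sq_nonneg ‖δu t‖)
  constructor <;> linarith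

end SolutionPair

end InhomEuler


namespace InhomEuler

open Filter Topology Metric
open scoped ENNReal NNReal

/-! ### Grönwall's inequality with almost everywhere data -/

section Gronwall

variable {T : ℝ}

/-- Continuous functions equal almost everywhere on an interval are equal there; this is applied to
`max f g` and `g`. -/
lemma le_on_Icc_of_ae_le (hT : 0 < T) {f g : ℝ → ℝ} (hf : ContinuousOn f (Icc 0 T))
    (hg : ContinuousOn g (Icc 0 T)) (h : ∀ᵐ t ∂(timeMeasure T), f t ≤ g t) :
    ∀ t ∈ Icc 0 T, f t ≤ g t := by
  have h1 : (fun t => max (f t) (g t)) =ᵐ[volume.restrict (Icc 0 T)] g := by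
    rw [← restrict_Ioo_eq_restrict_Icc]
    exact h.mono fun t ht => max_eq_right ht
  intro t ht
  exact (le_max_left _ _).trans_eq (Measure.eqOn_Icc_of_ae_eq volume hT.ne h1 (hf.sup hg) hg ht)

/-- Almost everywhere the integrand is `1 / l` times the derivative of the exponential, which is
monotone since `0 ≤ b`. For a monotone function the integral of the derivative is at most the
increment, so absolute continuity is not needed. -/
lemma integral_mul_exp_primitive_le {b : ℝ → ℝ} {t l : ℝ} (ht : 0 ≤ t) (hl : 0 < l)
    (hb : IntervalIntegrable b volume 0 t) (hb0 : ∀ s, 0 ≤ b s) :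
    ∫ s in (0 : ℝ)..t, b s * Real.exp (l * ∫ τ in (0 : ℝ)..s, b τ)
      ≤ Real.exp (l * ∫ τ in (0 : ℝ)..t, b τ) / l := by
  set f : ℝ → ℝ := fun s => Real.exp (l * ∫ τ in (0 : ℝ)..s, b τ) with hf
  have hsub : ∀ x ∈ Icc 0 t, ∀ y ∈ Icc 0 t, IntervalIntegrable b volume x y := fun x hx y hy =>
    hb.mono_set (by rw [uIcc_of_le ht]; exact uIcc_subset_Icc hx hy)
  have hmono : MonotoneOn f (uIcc 0 t) := by
    rw [uIcc_of_le ht]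
    intro x hx y hy hxy
    refine Real.exp_le_exp.2 (mul_le_mul_of_nonneg_left ?_ hl.le)
    rw [← intervalIntegral.integral_add_adjacent_intervals (hsub 0 ⟨le_rfl, ht⟩ x hx)
      (hsub x hx y hy)]
    linarith [intervalIntegral.integral_nonneg (μ := volume) hxy fun s _ => hb0 s]
  have h0 : 0 ≤ f t - f 0 := sub_nonneg.2 (hmono left_mem_uIcc right_mem_uIcc ht)
  have h1 := hmono.intervalIntegral_deriv_mem_uIcc
  rw [uIcc_of_le h0] at h1
  have h2 : ∫ s in (0 : ℝ)..t, deriv f s = l * ∫ s in (0 : ℝ)..t, b s * f s := by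
    rw [← intervalIntegral.integral_const_mul]
    refine intervalIntegral.integral_congr_ae ?_
    filter_upwards [hb.ae_hasDerivAt_integral] with s hs hst
    have h3 := ((hs (uIoc_subset_uIcc hst) 0 left_mem_uIcc).const_mul l).exp
    rw [h3.deriv]
    ring
  rw [h2] at h1
  rw [le_div_iff₀ hl, mul_comm]
  have : 0 < f 0 := Real.exp_pos _
  linarith [h1.2]

/-- Grönwall's inequality in integral form, with an integrable coefficient. -/
lemma gronwall_integral (hT : 0 < T) {y b : ℝ → ℝ} {m M C : ℝ} (hm : 0 < m) (hC : 0 < C)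
    (hy : ContinuousOn y (Icc 0 T)) (hb : IntervalIntegrable b volume 0 T) (hb0 : ∀ s, 0 ≤ b s)
    (h : ∀ t ∈ Icc 0 T, m * y t ≤ M * y 0 + C * ∫ s in (0 : ℝ)..t, b s * y s)
    (hMy : 0 ≤ M * y 0) :
    ∀ t ∈ Icc 0 T, y t ≤ 2 * (M / m) * y 0 * Real.exp (2 * C / m * ∫ s in (0 : ℝ)..t, b s) := by
  -- The rate is twice the natural one, so that the integral term is at most half of `m * y` at the
  -- maximum point below and can be absorbed.
  set l := 2 * C / m with hl
  have hl0 : 0 < l := by positivity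
  set B : ℝ → ℝ := fun t => ∫ s in (0 : ℝ)..t, b s with hB
  have hBc : ContinuousOn B (Icc 0 T) := by
    have := intervalIntegral.continuousOn_primitive_interval' hb left_mem_uIcc
    rwa [uIcc_of_le hT.le] at this
  have hec : ContinuousOn (fun t => Real.exp (l * B t)) (Icc 0 T) :=
    (continuousOn_const.mul hBc).rexp
  -- It suffices to bound `y * exp (-l * B)` at its maximum point `r`, where the hypothesis is used
  -- once.
  obtain ⟨r, hr, hmax⟩ := isCompact_Icc.exists_isMaxOn (nonempty_Icc.2 hT.le)
    (hy.mul (continuousOn_const.mul hBc).rexp :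
      ContinuousOn (fun t => y t * Real.exp (-l * B t)) (Icc 0 T))
  set S := y r * Real.exp (-l * B r) with hS
  have hexp : ∀ t, Real.exp (-l * B t) * Real.exp (l * B t) = 1 := fun t => by
    rw [← Real.exp_add]; simp
  have hyS : ∀ t ∈ Icc 0 T, y t ≤ S * Real.exp (l * B t) := fun t ht => by
    have h1 : y t * Real.exp (-l * B t) ≤ S := hmax ht
    have h2 := mul_le_mul_of_nonneg_right h1 (Real.exp_pos (l * B t)).le
    rwa [mul_assoc, hexp, mul_one] at h2
  have hbr : IntervalIntegrable b volume 0 r :=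
    hb.mono_set (by rw [uIcc_of_le hr.1, uIcc_of_le hT.le]; exact Icc_subset_Icc_right hr.2)
  have hrT : uIcc 0 r ⊆ Icc 0 T := by
    rw [uIcc_of_le hr.1]; exact Icc_subset_Icc_right hr.2
  have hint : ∫ s in (0 : ℝ)..r, b s * y s ≤ S * ∫ s in (0 : ℝ)..r, b s * Real.exp (l * B s) := by
    rw [← intervalIntegral.integral_const_mul]
    refine intervalIntegral.integral_mono_on hr.1 (hbr.mul_continuousOn (hy.mono hrT))
      ((hbr.mul_continuousOn (hec.mono hrT)).const_mul S) fun s hs => ?_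
    have := mul_le_mul_of_nonneg_left (hyS s ⟨hs.1, hs.2.trans hr.2⟩) (hb0 s)
    linarith
  have hSle : S ≤ 2 * (M / m) * y 0 := by
    have hpos : 0 ≤ 2 * (M / m) * y 0 := by
      have : 2 * (M / m) * y 0 = 2 * (M * y 0) / m := by ring
      rw [this]; positivity
    rcases le_or_gt S 0 with h0 | h0
    · exact h0.trans hpos
    have h1 := integral_mul_exp_primitive_le hr.1 hl0 hbr hb0
    have h2 : C * (S * ∫ s in (0 : ℝ)..r, b s * Real.exp (l * B s)) ≤ m / 2 * y r := by
      have h3 := mul_le_mul_of_nonneg_left (mul_le_mul_of_nonneg_left h1 h0.le) hC.le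
      refine h3.trans_eq ?_
      have h4 : S * Real.exp (l * B r) = y r := by rw [hS, mul_assoc, hexp, mul_one]
      have h5 : C / l = m / 2 := by rw [hl]; field_simp
      rw [← h4, ← h5]
      ring
    have h5 := h r hr
    have h6 := mul_le_mul_of_nonneg_left hint hC.le
    have h7 : m * y r ≤ 2 * (M * y 0) := by linarith
    have h8 : y r ≤ 2 * (M / m) * y 0 := by
      have : 2 * (M / m) * y 0 = 2 * (M * y 0) / m := by ring
      rw [this, le_div_iff₀ hm]
      linarith
    have h9 : Real.exp (-l * B r) ≤ 1 := by
      rw [Real.exp_le_one_iff]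
      have : 0 ≤ B r := intervalIntegral.integral_nonneg hr.1 fun s _ => hb0 s
      nlinarith
    calc S ≤ 2 * (M / m) * y 0 * Real.exp (-l * B r) :=
          mul_le_mul_of_nonneg_right h8 (Real.exp_pos _).le
      _ ≤ 2 * (M / m) * y 0 * 1 := mul_le_mul_of_nonneg_left h9 hpos
      _ = _ := mul_one _
  intro t ht
  exact (hyS t ht).trans (mul_le_mul_of_nonneg_right hSle (Real.exp_pos _).le)

/-- Integrated energy inequality for an energy known at almost every time. -/
lemma energy_inequality (hT : 0 < T) {E D y b : ℝ → ℝ} {m M C : ℝ} (hC : 0 ≤ C)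
    (hE : HasWeakDeriv T E D) (hy : ContinuousOn y (Icc 0 T)) (hy0 : ∀ t, 0 ≤ y t)
    (hb : IntervalIntegrable b volume 0 T) (hb0 : ∀ s, 0 ≤ b s)
    (hD : ∀ᵐ t ∂(timeMeasure T), |D t| ≤ C * (b t * y t))
    (hEy : ∀ᵐ t ∂(timeMeasure T), m * y t ≤ E t ∧ E t ≤ M * y t) :
    ∀ t ∈ Icc 0 T, m * y t ≤ M * y 0 + C * ∫ s in (0 : ℝ)..t, b s * y s := by
  have hby : IntervalIntegrable (fun s => b s * y s) volume 0 T :=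
    hb.mul_continuousOn (by rwa [uIcc_of_le hT.le])
  have hbyI : ∀ s ∈ Icc 0 T, ∀ t ∈ Icc 0 T,
      IntervalIntegrable (fun s => b s * y s) volume s t := fun s hs t ht =>
    hby.mono_set (by rw [uIcc_of_le hT.le]; exact uIcc_subset_Icc hs ht)
  obtain ⟨c, hc⟩ := hE.ae_eq
  refine le_on_Icc_of_ae_le hT (continuousOn_const.mul hy) (continuousOn_const.add
    (continuousOn_const.mul ?_)) ?_
  · have := intervalIntegral.continuousOn_primitive_interval' hby left_mem_uIcc
    rwa [uIcc_of_le hT.le] at this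
  filter_upwards [hc, hEy, ae_restrict_mem measurableSet_Ioo] with t ht1 ht2 ht
  -- `E` has no meaning at the single time `0`. For fixed `t` the inequality is shown with almost
  -- every starting time `s` in place of `0`, and continuity of `y` allows taking `s = 0`.
  refine le_on_Icc_of_ae_le ht.1 (f := fun _ => m * y t)
    (g := fun s => M * y s + C * ∫ s in (0 : ℝ)..t, b s * y s) continuousOn_const
    ((continuousOn_const.mul (hy.mono (Icc_subset_Icc_right ht.2.le))).add continuousOn_const) ?_ 0
    ⟨le_rfl, ht.1.le⟩
  have hle : timeMeasure t ≤ timeMeasure T :=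
    Measure.restrict_mono (Ioo_subset_Ioo_right ht.2.le) le_rfl
  filter_upwards [ae_mono hle hc, ae_mono hle hEy, ae_restrict_mem measurableSet_Ioo]
    with s hs1 hs2 hs
  have hsT : s ∈ Ioo 0 T := ⟨hs.1, hs.2.trans ht.2⟩
  have hi := hE.intervalIntegrable
  have hm := half_mem ht
  have e1 : E t - E s = ∫ τ in s..t, D τ := by
    rw [ht1, hs1, ← intervalIntegral.integral_interval_sub_left (hi _ hm t ht) (hi _ hm s hsT)]
    ring
  have e2 : ∫ τ in s..t, D τ ≤ C * ∫ τ in s..t, b τ * y τ := by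
    rw [← intervalIntegral.integral_const_mul]
    refine intervalIntegral.integral_mono_ae_restrict hs.2.le (hi s hsT t ht)
      ((hbyI s (Ioo_subset_Icc_self hsT) t (Ioo_subset_Icc_self ht)).const_mul C) ?_
    have : Icc s t ⊆ Ioo 0 T := fun x hx => ⟨hs.1.trans_le hx.1, hx.2.trans_lt ht.2⟩
    filter_upwards [ae_mono (Measure.restrict_mono this le_rfl) hD] with τ hτ
    exact (le_abs_self _).trans hτ
  have e3 : ∫ τ in s..t, b τ * y τ ≤ ∫ τ in (0 : ℝ)..t, b τ * y τ := by
    rw [← intervalIntegral.integral_add_adjacent_intervals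
      (hbyI 0 ⟨le_rfl, hT.le⟩ s (Ioo_subset_Icc_self hsT))
      (hbyI s (Ioo_subset_Icc_self hsT) t (Ioo_subset_Icc_self ht))]
    linarith [intervalIntegral.integral_nonneg (μ := volume) hs.1.le
      fun τ _ => mul_nonneg (hb0 τ) (hy0 τ)]
  have e4 := mul_le_mul_of_nonneg_left e3 hC
  linarith [ht2.1, hs2.2]

end Gronwall

/-! ### The stability estimate and uniqueness -/

namespace SolutionPair

variable {N : ℕ} {T lo hi : ℝ} {ρ₁ ρ₂ : ℝ → Space N → ℝ}
    {u₁ u₂ a₁ a₂ : ℝ → Space N → Space N} {Du₁ Du₂ : ℝ → Space N → Space N →L[ℝ] Space N}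
    {P₁ P₂ R₂ : ℝ → Space N → Space N} {δρ : ℝ → Lp ℝ 2 (volume : Measure (Space N))}
    {δu : ℝ → Lp (Space N) 2 (volume : Measure (Space N))}

lemma sq_norm_le (hN : 0 < N)
    (h : SolutionPair T lo hi ρ₁ ρ₂ u₁ u₂ a₁ a₂ Du₁ Du₂ P₁ P₂ R₂ δρ δu) {t : ℝ}
    (ht : t ∈ Icc 0 T) :
    ‖δρ t‖ ^ 2 + ‖δu t‖ ^ 2 ≤ 2 * (max 1 hi / min 1 lo) * (‖δρ 0‖ ^ 2 + ‖δu 0‖ ^ 2) *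
      Real.exp (2 * (1 + lo⁻¹ + 2 * max 1 hi) / min 1 lo
        * lipschitzIntegral R₂ Du₁ Du₂ P₂ t) := by
  have hlo := h.lo_pos
  have hT := h.time_pos
  have hM : 0 < max 1 hi := lt_max_of_lt_left one_pos
  have hm : 0 < min 1 lo := lt_min one_pos hlo
  have hC : 0 < 1 + lo⁻¹ + 2 * max 1 hi := by positivity
  have hy : ContinuousOn (fun t => ‖δρ t‖ ^ 2 + ‖δu t‖ ^ 2) (Icc 0 T) :=
    (h.continuousOn_density.norm.pow 2).add (h.contDiffOn_velocity.continuousOn.norm.pow 2)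
  have hb : IntervalIntegrable (fun t => (lipNorm R₂ Du₁ Du₂ P₂ t).toReal) volume 0 T :=
    (intervalIntegrable_iff_integrableOn_Ioo_of_le hT.le).2 h.integrable_bound
  rw [lipschitzIntegral_eq h.memR₂ h.memDu₁ h.memDu₂ h.memP₂ ht]
  exact gronwall_integral (y := fun t => ‖δρ t‖ ^ 2 + ‖δu t‖ ^ 2) hT hm hC hy hb
    (fun s => ENNReal.toReal_nonneg)
    (energy_inequality hT hC.le h.hasWeakDeriv_energies hy (fun t => by positivity) hb
      (fun s => ENNReal.toReal_nonneg) (h.ae_abs_energy_rate_le hN) h.ae_energy_bounds)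
    (by positivity) t ht

/-- The stability estimate. -/
lemma norm_add_norm_le (hN : 0 < N)
    (h : SolutionPair T lo hi ρ₁ ρ₂ u₁ u₂ a₁ a₂ Du₁ Du₂ P₁ P₂ R₂ δρ δu) {t : ℝ}
    (ht : t ∈ Icc 0 T) :
    ‖δρ t‖ + ‖δu t‖ ≤ 2 * (max 1 hi / min 1 lo) *
      Real.exp ((1 + lo⁻¹ + 2 * max 1 hi) / min 1 lo * lipschitzIntegral R₂ Du₁ Du₂ P₂ t) *
        (‖δρ 0‖ + ‖δu 0‖) := by
  have hm : 0 < min 1 lo := lt_min one_pos h.lo_pos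
  have hM : 0 < max 1 hi := lt_max_of_lt_left one_pos
  have hq : 1 ≤ max 1 hi / min 1 lo := by
    rw [le_div_iff₀ hm, one_mul]
    exact (min_le_left _ _).trans (le_max_left _ _)
  have key := h.sq_norm_le hN ht
  set I := lipschitzIntegral R₂ Du₁ Du₂ P₂ t
  set q := max 1 hi / min 1 lo
  set c := (1 + lo⁻¹ + 2 * max 1 hi) / min 1 lo with hc
  -- Taking the square root halves the exponent of the quadratic estimate.
  have he : Real.exp (2 * (1 + lo⁻¹ + 2 * max 1 hi) / min 1 lo * I) = Real.exp (c * I) ^ 2 := by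
    rw [sq, ← Real.exp_add, hc]
    ring_nf
  rw [he] at key
  have h1 : 0 ≤ ‖δρ 0‖ := norm_nonneg _
  have h2 : 0 ≤ ‖δu 0‖ := norm_nonneg _
  refine (sq_le_sq₀ (by positivity) (by positivity)).1 ?_
  calc (‖δρ t‖ + ‖δu t‖) ^ 2 ≤ 2 * (‖δρ t‖ ^ 2 + ‖δu t‖ ^ 2) := add_sq_le
    _ ≤ 2 * (2 * q * (‖δρ 0‖ ^ 2 + ‖δu 0‖ ^ 2) * Real.exp (c * I) ^ 2) := by gcongr
    _ = 4 * (q * 1) * (‖δρ 0‖ ^ 2 + ‖δu 0‖ ^ 2) * Real.exp (c * I) ^ 2 := by ring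
    -- Enlarging `q` to `q * q`, which is allowed as `1 ≤ q`, makes the right side a perfect square.
    _ ≤ 4 * (q * q) * (‖δρ 0‖ + ‖δu 0‖) ^ 2 * Real.exp (c * I) ^ 2 := by
      have : ‖δρ 0‖ ^ 2 + ‖δu 0‖ ^ 2 ≤ (‖δρ 0‖ + ‖δu 0‖) ^ 2 := by
        linarith [mul_nonneg h1 h2, add_sq ‖δρ 0‖ ‖δu 0‖]
      gcongr
    _ = (2 * q * Real.exp (c * I) * (‖δρ 0‖ + ‖δu 0‖)) ^ 2 := by ring

/-- If the differences vanish, the solutions agree, including their pressure gradients. -/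
lemma ae_eq_of_eq_zero (h : SolutionPair T lo hi ρ₁ ρ₂ u₁ u₂ a₁ a₂ Du₁ Du₂ P₁ P₂ R₂ δρ δu)
    (hz : ∀ t ∈ Icc 0 T, δρ t = 0 ∧ δu t = 0) :
    ∀ᵐ t ∂(timeMeasure T), ∀ᵐ x, ρ₁ t x = ρ₂ t x ∧ u₁ t x = u₂ t x ∧ P₁ t x = P₂ t x := by
  filter_upwards [h.ae_slice, h.density_ae_eq, h.velocity_ae_eq, h.ae_eq_deriv,
    ae_restrict_mem measurableSet_Ioo] with t hs h1 h2 h3 ht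
  rw [(hz t (Ioo_subset_Icc_self ht)).1] at h1
  rw [(hz t (Ioo_subset_Icc_self ht)).2] at h2
  -- `δu` vanishes near `t`, so the time derivatives agree; the continuous `W` vanishes identically,
  -- so the spatial gradients agree. The momentum equations then identify the pressure gradients.
  have hd : deriv δu t = 0 := by
    have : δu =ᶠ[𝓝 t] fun _ => 0 := by
      filter_upwards [Ioo_mem_nhds ht.1 ht.2] with s hs
      exact (hz s (Ioo_subset_Icc_self hs)).2
    rw [this.deriv_eq, deriv_const]
  rw [hd] at h3
  obtain ⟨U, W, hU, hW, hU1, hW1, hW2⟩ := hs.exists_velocity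
  have hW0 : W = fun _ => 0 := (hW.lip.continuous.ae_eq_iff_eq volume continuous_const).1 <| by
    filter_upwards [h2, hW1, Lp.coeFn_zero (Space N) 2 (volume : Measure (Space N))]
      with x e1 e2 e3
    rw [← e2, ← e1, e3, Pi.zero_apply]
  filter_upwards [h1, h2, h3, hW2, Lp.coeFn_zero ℝ 2 (volume : Measure (Space N)),
    Lp.coeFn_zero (Space N) 2 (volume : Measure (Space N)), hs.momentum₁, hs.momentum₂]
    with x e1 e2 e3 e4 z1 z2 p1 p2
  rw [z1, Pi.zero_apply] at e1
  rw [z2, Pi.zero_apply] at e2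
  rw [z2, Pi.zero_apply] at e3
  rw [hW0, fderiv_fun_const, Pi.zero_apply] at e4
  have r : ρ₁ t x = ρ₂ t x := sub_eq_zero.1 e1.symm
  have u : u₁ t x = u₂ t x := sub_eq_zero.1 e2.symm
  refine ⟨r, u, ?_⟩
  rw [r, u, sub_eq_zero.1 e3, sub_eq_zero.1 e4, ← p2] at p1
  exact add_left_cancel p1

end SolutionPair

end InhomEuler

theorem proposition4p3 (N : ℕ) (hN : 2 ≤ N) (rhoLow rhoUp : ℝ) (hLow : 0 < rhoLow) :
    ∃ C c : ℝ, 0 < C ∧ 0 < c ∧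
      ∀ (T : ℝ), 0 < T →
      ∀ (ρ₁ ρ₂ : ℝ → InhomEuler.Space N → ℝ)
        (u₁ u₂ : ℝ → InhomEuler.Space N → InhomEuler.Space N)
        (Du₁ Du₂ : ℝ → InhomEuler.Space N → InhomEuler.Space N →L[ℝ] InhomEuler.Space N)
        (P₁ P₂ : ℝ → InhomEuler.Space N → InhomEuler.Space N)
        (R₂ : ℝ → InhomEuler.Space N → InhomEuler.Space N)
        (δρ : ℝ → Lp ℝ 2 (volume : Measure (InhomEuler.Space N)))
        (δu : ℝ → Lp (InhomEuler.Space N) 2 (volume : Measure (InhomEuler.Space N))),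
      InhomEuler.IsEulerSolution T ρ₁ u₁ Du₁ P₁ →
      InhomEuler.IsEulerSolution T ρ₂ u₂ Du₂ P₂ →
      (∀ᵐ t ∂(volume.restrict (Ioo 0 T)), ∀ᵐ x,
        rhoLow ≤ ρ₁ t x ∧ ρ₁ t x ≤ rhoUp ∧ rhoLow ≤ ρ₂ t x ∧ ρ₂ t x ≤ rhoUp) →
      (∀ᵐ t ∂(volume.restrict (Ioo 0 T)), δρ t =ᵐ[volume] fun x => ρ₁ t x - ρ₂ t x) →
      (∀ᵐ t ∂(volume.restrict (Ioo 0 T)), δu t =ᵐ[volume] fun x => u₁ t x - u₂ t x) →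
      ContinuousOn δρ (Icc 0 T) →
      ContDiffOn ℝ 1 δu (Icc 0 T) →
      (∀ᵐ t ∂(volume.restrict (Ioo 0 T)), InhomEuler.HasWeakGradient (ρ₂ t) (R₂ t)) →
      InhomEuler.MemL1Linfty T R₂ →
      InhomEuler.MemL1Linfty T Du₁ →
      InhomEuler.MemL1Linfty T Du₂ →
      InhomEuler.MemL1Linfty T P₂ →
      (∀ t ∈ Icc 0 T, ‖δρ t‖ + ‖δu t‖ ≤
        C * Real.exp (c * InhomEuler.lipschitzIntegral R₂ Du₁ Du₂ P₂ t) *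
          (‖δρ 0‖ + ‖δu 0‖)) ∧
      (δρ 0 = 0 → δu 0 = 0 →
        ∀ᵐ t ∂(volume.restrict (Ioo 0 T)), ∀ᵐ x,
          ρ₁ t x = ρ₂ t x ∧ u₁ t x = u₂ t x ∧ P₁ t x = P₂ t x) := by
  have hm : 0 < min 1 rhoLow := lt_min one_pos hLow
  have hM : 0 < max 1 rhoUp := lt_max_of_lt_left one_pos
  -- The first constant compares the energy with the squared norms from above and below; the second
  -- is the energy growth factor divided by the lower comparison constant. Neither depends on `N`.
  refine ⟨2 * (max 1 rhoUp / min 1 rhoLow),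
    (1 + rhoLow⁻¹ + 2 * max 1 rhoUp) / min 1 rhoLow, by positivity, by positivity, ?_⟩
  intro T hT ρ₁ ρ₂ u₁ u₂ Du₁ Du₂ P₁ P₂ R₂ δρ δu h₁ h₂ hρ hδρ hδu hcρ hcu hR mR mDu₁ mDu₂ mP₂
  obtain ⟨a₁, ha₁, hm₁⟩ := h₁.momentum
  obtain ⟨a₂, ha₂, hm₂⟩ := h₂.momentum
  have h : InhomEuler.SolutionPair T rhoLow rhoUp ρ₁ ρ₂ u₁ u₂ a₁ a₂ Du₁ Du₂ P₁ P₂ R₂ δρ δu :=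
    ⟨hT, hLow, h₁, h₂, ha₁, ha₂, hm₁, hm₂, hρ, hδρ, hδu, hcρ, hcu, hR, mR, mDu₁, mDu₂, mP₂⟩
  have key := fun t ht => h.norm_add_norm_le (zero_lt_two.trans_le hN) (t := t) ht
  refine ⟨key, fun hρ0 hu0 => h.ae_eq_of_eq_zero fun t ht => ?_⟩
  have h0 := key t ht
  rw [hρ0, hu0, norm_zero, norm_zero, add_zero, mul_zero] at h0
  exact ⟨norm_le_zero_iff.1 (by linarith [norm_nonneg (δu t)]),
    norm_le_zero_iff.1 (by linarith [norm_nonneg (δρ t)])⟩
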